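/- **Moulds.** A mould $Z$ with values in a commutative $\mathbb Q$-algebra $A$ is a family of power series $Z(X_1,\dots,X_r)=\sum_{k_1,\dots,k_r\ge1}z(k_1,\dots,k_r)X_1^{k_1-1}\cdots X_r^{k_r-1}\in A[[X_1,\dots,X_r]]$, $r\ge 0$. A bimould $B$ is a family of power series $B\binom{X_1,\dots,X_r}{Y_1,\dots,Y_r}\in A[[X_1,\dots,X_r,Y_1,\dots,Y_r]]$, $r\ge0$. The product of (bi)moulds is obtained by deconcatenation of the variables, $(Z_1\times Z_2)(X_1,\dots,X_r)=\sum_{j=0}^rZ_1(X_1,\dots,X_j)Z_2(X_{j+1},\dots,X_r)$, and similarly for bimoulds. A power series $\sum_r a_rT^r$ is regarded as the constant (bi)mould equal to $a_r$ in depth $r$. The mould $Z$ is called symmetril (resp. symmetral) if the $\mathbb Q$-linear map on $\mathbb Q\langle z_k\mid k\ge1\rangle$ with $\mathbf 1\mapsto1$, $z_{k_1}\cdots z_{k_r}\mapsto z(k_1,\dots,k_r)$ (in particular $Z=1$ in depth $0$) is an algebra homomorphism for the quasi-shuffle product determined by $\mathbf 1*w=w*\mathbf 1=w$ and $aw*bv=a(w*bv)+b(aw*v)+(a\diamond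 b)(w*v)$ with $z_i\diamond z_j=z_{i+j}$ (resp. $z_i\diamond z_j=0$). Put $$Z_\gamma=Z^\sharp\times\exp\Big(\sum_{n\ge2}\tfrac{(-1)^n}{n}z(n)T^n\Big),\qquad Z^\sharp(X_1,\dots,X_r)=Z(X_1+\dots+X_r,\dots,X_1+X_2,X_1).$$ $Z$ satisfies the extended double shuffle equations if $Z$ is symmetril and $Z_\gamma$ is symmetral. **Combinatorial bi-multiple Eisenstein series.** Let $\beta$ be any $\mathbb Q$-valued mould satisfying the extended double shuffle equations, with depth one part $\beta(X)=-\sum_{k\ge2}\frac{B_k}{2\,k!}X^{k-1}$ ($B_k$ the Bernoulli numbers). Write $X^\beta,Y^\beta$ for the bimoulds $\beta(X_1,\dots,X_r)$, $\beta(Y_1,\dots,Y_r)$ (and similarly for other moulds), let $\beta_\gamma^-(X_1,\dots,X_r)=\beta_\gamma(-X_1,\dots,-X_r)$, and set $$\mathfrak b=Y^{\beta_\gamma}\times X^\beta,\qquad\tilde{\mathfrak b}=Y^{\beta_\gamma^-}\times\exp(-\tfrac T2)\times X^\beta .$$ For $m\ge1$ let $L_m\binom XY=\frac{e^{X+mY}q^m}{1-e^Xq^m}\in\mathbb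 Q[[q]][[X,Y]]$ and, in depth $r\ge1$, $$\mathfrak L_m\tbinom{X_1,\dots,X_r}{Y_1,\dots,Y_r}=\sum_{j=1}^r\mathfrak b\tbinom{X_1-X_j,\dots,X_{j-1}-X_j}{Y_1,\dots,Y_{j-1}}\,L_m\tbinom{X_j}{Y_1+\dots+Y_r}\,\tilde{\mathfrak b}\tbinom{X_r-X_j,\dots,X_{j+1}-X_j}{Y_r,\dots,Y_{j+1}},$$ $$\mathfrak g^*\tbinom{X_1,\dots,X_r}{Y_1,\dots,Y_r}=\sum_{\substack{1\le j\le r\\0=r_0<r_1<\dots<r_j=r\\m_1>\dots>m_j>0}}\ \prod_{i=1}^j\mathfrak L_{m_i}\tbinom{X_{r_{i-1}+1},\dots,X_{r_i}}{Y_{r_{i-1}+1},\dots,Y_{r_i}},$$ with $\mathfrak g^*=1$ in depth $0$. Let $\mathfrak G=\mathfrak g^*\times\mathfrak b$, and define $G\binom{k_1,\dots,k_r}{d_1,\dots,d_r}\in\mathbb Q[[q]]$ ($k_i\ge1$, $d_i\ge0$) by $$\mathfrak G\tbinom{X_1,\dots,X_r}{Y_1,\dots,Y_r}=\sum_{k_i\ge1,\,d_i\ge0}G\tbinom{k_1,\dots,k_r}{d_1,\dots,d_r}X_1^{k_1-1}\cdots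 X_r^{k_r-1}\tfrac{Y_1^{d_1}}{d_1!}\cdots\tfrac{Y_r^{d_r}}{d_r!}.$$ **Quasi-modular forms.** For even $k\ge2$ let $G_k=-\frac{B_k}{2\,k!}+\frac1{(k-1)!}\sum_{n\ge1}\sigma_{k-1}(n)q^n$, where $\sigma_{k-1}(n)=\sum_{e\mid n}e^{k-1}$. The quasi-modular forms (for $\mathrm{SL}_2(\mathbb Z)$, with rational coefficients) of weight $w$ are the elements of $\mathbb Q[G_2,G_4,G_6]\subset\mathbb Q[[q]]$ that are $\mathbb Q$-linear combinations of monomials $G_2^aG_4^bG_6^c$ with $2a+4b+6c=w$. **Proposition 5.7.** For all $k\ge1$ and $d\ge0$ with $k+d$ even and all $r\ge1$, the series $G\binom{k,\dots,k}{d,\dots,d}$ (depth $r$) is a quasi-modular form, of weight $r(k+d)$. -/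

import Mathlib

open scoped Nat

noncomputable section

namespace CombEis

/-! ### Moulds and bimoulds -/

/-- A mould with values in `A`: for every depth `r` a power series in `X_1, …, X_r`. -/
abbrev Mould (A : Type*) := (r : ℕ) → MvPowerSeries (Fin r) A

/-- A bimould with values in `A`: for every depth `r` a power series in `X_1, …, X_r`
(indexed by `Sum.inl`) and `Y_1, …, Y_r` (indexed by `Sum.inr`). -/
abbrev Bimould (A : Type*) := (r : ℕ) → MvPowerSeries (Fin r ⊕ Fin r) A

/-- The word `z_{k_1} … z_{k_r}` is the list `[k_1, …, k_r]`; `Z.coeff [k_1, …, k_r]` is the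
coefficient of `X_1^{k_1-1} ⋯ X_r^{k_r-1}` in the depth `r` part of `Z`. -/
def Mould.coeff {A : Type*} [CommRing A] (Z : Mould A) (w : List ℕ+) : A :=
  MvPowerSeries.coeff
    (Finsupp.equivFunOnFinite.symm fun i : Fin w.length => (w.get i).natPred) (Z w.length)

/-- The bi-word with letters `z^{k_i}_{d_i}` is the list of the pairs `(k_i, d_i)`; `B.coeff` of it
is the coefficient of `X_1^{k_1-1} ⋯ X_r^{k_r-1} (Y_1^{d_1}/d_1!) ⋯ (Y_r^{d_r}/d_r!)` in the depth
`r` part of `B`. -/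
def Bimould.coeff {A : Type*} [CommRing A] (B : Bimould A) (w : List (ℕ+ × ℕ)) : A :=
  (∏ i : Fin w.length, ((w.get i).2 ! : A)) *
    MvPowerSeries.coeff
      (Finsupp.equivFunOnFinite.symm
        (Sum.elim (fun i : Fin w.length => (w.get i).1.natPred)
          (fun i : Fin w.length => (w.get i).2)))
      (B w.length)

/-- `Z(x_1, …, x_r)` for a list of power series `x_1, …, x_r` (without constant term). -/
def Mould.eval {A S σ : Type*} [CommRing A] [CommRing S] [Algebra A S]
    (Z : Mould A) (l : List (MvPowerSeries σ S)) : MvPowerSeries σ S :=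
  MvPowerSeries.subst (fun i : Fin l.length => l.get i) (Z l.length)

/-- `B(x_1, …, x_r; y_1, …, y_r)` for a list of pairs `(x_i, y_i)` of power series (without constant
term). -/
def Bimould.eval {A S σ : Type*} [CommRing A] [CommRing S] [Algebra A S]
    (B : Bimould A) (l : List (MvPowerSeries σ S × MvPowerSeries σ S)) : MvPowerSeries σ S :=
  MvPowerSeries.subst
    (Sum.elim (fun i : Fin l.length => (l.get i).1) (fun i : Fin l.length => (l.get i).2))
    (B l.length)

/-- The list `[X_1, …, X_r]`. -/
def vars (A : Type*) [CommRing A] (r : ℕ) : List (MvPowerSeries (Fin r) A) :=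
  List.ofFn fun i => MvPowerSeries.X i

/-- The list `[(X_1, Y_1), …, (X_r, Y_r)]`. -/
def bivars (A : Type*) [CommRing A] (r : ℕ) :
    List (MvPowerSeries (Fin r ⊕ Fin r) A × MvPowerSeries (Fin r ⊕ Fin r) A) :=
  List.ofFn fun i => (MvPowerSeries.X (Sum.inl i), MvPowerSeries.X (Sum.inr i))

/-- The product of moulds,
`(Z₁ × Z₂)(X_1, …, X_r) = ∑_{j=0}^r Z₁(X_1, …, X_j) Z₂(X_{j+1}, …, X_r)`. -/
def Mould.mul {A : Type*} [CommRing A] (Z₁ Z₂ : Mould A) : Mould A := fun r =>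
  ∑ j ∈ Finset.range (r + 1), Z₁.eval ((vars A r).take j) * Z₂.eval ((vars A r).drop j)

/-- The product of bimoulds. -/
def Bimould.mul {A : Type*} [CommRing A] (B C : Bimould A) : Bimould A := fun r =>
  ∑ j ∈ Finset.range (r + 1), B.eval ((bivars A r).take j) * C.eval ((bivars A r).drop j)

/-- The constant mould attached to a power series `∑ a_r T^r`. -/
def Mould.const {A : Type*} [CommRing A] (F : PowerSeries A) : Mould A := fun r =>
  MvPowerSeries.C (PowerSeries.coeff r F)

/-- The constant bimould attached to a power series `∑ a_r T^r`. -/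
def Bimould.const {A : Type*} [CommRing A] (F : PowerSeries A) : Bimould A := fun r =>
  MvPowerSeries.C (PowerSeries.coeff r F)

/-- Extension of scalars from `A` to `S`. -/
def Bimould.baseChange {A : Type*} (S : Type*) [CommRing A] [CommRing S] [Algebra A S]
    (B : Bimould A) : Bimould S := fun r =>
  MvPowerSeries.map (algebraMap A S) (B r)

/-- `Z^♯(X_1, …, X_r) = Z(X_1 + ⋯ + X_r, …, X_1 + X_2, X_1)`. -/
def Mould.sharp {A : Type*} [CommRing A] (Z : Mould A) : Mould A := fun r =>
  Z.eval (List.ofFn fun i : Fin r => ∑ j ∈ Finset.Iic i.rev, MvPowerSeries.X j)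

/-- `Z^-(X_1, …, X_r) = Z(-X_1, …, -X_r)`. -/
def Mould.minus {A : Type*} [CommRing A] (Z : Mould A) : Mould A := fun r =>
  Z.eval ((vars A r).map fun x => -x)

/-- The power series `Γ^Z(T) = exp (∑_{n ≥ 2} ((-1)^n / n) z(n) T^n)`. -/
def Mould.Gamma {A : Type*} [CommRing A] [Algebra ℚ A] (Z : Mould A) : PowerSeries A :=
  PowerSeries.subst
    (PowerSeries.mk fun n : ℕ =>
      if 2 ≤ n then ((-1 : ℚ) ^ n / n) • Z.coeff [n.toPNat'] else 0 : PowerSeries A)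
    (PowerSeries.exp ℚ)

/-- `Z_γ = Z^♯ × Γ^Z`. -/
def Mould.gamma {A : Type*} [CommRing A] [Algebra ℚ A] (Z : Mould A) : Mould A :=
  Z.sharp.mul (Mould.const Z.Gamma)

/-! ### Quasi-shuffle products and the extended double shuffle equations -/

/-- The quasi-shuffle product of two words, attached to a product `⋄` on the span of the letters:
`a w * b v = a (w * b v) + b (a w * v) + (a ⋄ b) (w * v)`. -/
def quasiShuffle {L : Type*} (dia : L → L → (L →₀ ℚ)) : List L → List L → (List L →₀ ℚ)
  | [], v => Finsupp.single v 1
  | a :: w, [] => Finsupp.single (a :: w) 1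
  | a :: w, b :: v =>
      Finsupp.mapDomain (List.cons a) (quasiShuffle dia w (b :: v)) +
      Finsupp.mapDomain (List.cons b) (quasiShuffle dia (a :: w) v) +
      (dia a b).sum fun c t => t • Finsupp.mapDomain (List.cons c) (quasiShuffle dia w v)
termination_by w v => w.length + v.length

/-- The bilinear extension of the quasi-shuffle product to `ℚ⟨L⟩`, the space with basis the words
in the letters `L`. -/
def quasiShuffleMul {L : Type*} (dia : L → L → (L →₀ ℚ)) (x y : List L →₀ ℚ) : List L →₀ ℚ :=
  x.sum fun w s => y.sum fun v t => (s * t) • quasiShuffle dia w v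

/-- The coefficient map `ℚ⟨z_k | k ≥ 1⟩ → A` of a mould. -/
def Mould.coeffMap {A : Type*} [CommRing A] [Algebra ℚ A] (Z : Mould A) :
    (List ℕ+ →₀ ℚ) →ₗ[ℚ] A :=
  Finsupp.linearCombination ℚ Z.coeff

/-- `Z` is `⋄`-symmetril: its coefficient map is a (unital) algebra homomorphism for the
quasi-shuffle product. -/
def Mould.IsDiaSymmetril {A : Type*} [CommRing A] [Algebra ℚ A]
    (dia : ℕ+ → ℕ+ → (ℕ+ →₀ ℚ)) (Z : Mould A) : Prop :=
  Z.coeffMap (Finsupp.single [] 1) = 1 ∧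
    ∀ x y, Z.coeffMap (quasiShuffleMul dia x y) = Z.coeffMap x * Z.coeffMap y

/-- `Z` is symmetril: `z_i ⋄ z_j = z_{i+j}`. -/
def Mould.IsSymmetril {A : Type*} [CommRing A] [Algebra ℚ A] (Z : Mould A) : Prop :=
  Z.IsDiaSymmetril fun i j => Finsupp.single (i + j) 1

/-- `Z` is symmetral: `z_i ⋄ z_j = 0`. -/
def Mould.IsSymmetral {A : Type*} [CommRing A] [Algebra ℚ A] (Z : Mould A) : Prop :=
  Z.IsDiaSymmetril fun _ _ => 0

/-- `Z` satisfies the extended double shuffle equations. -/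
def Mould.SatisfiesEDS {A : Type*} [CommRing A] [Algebra ℚ A] (Z : Mould A) : Prop :=
  Z.IsSymmetril ∧ Z.gamma.IsSymmetral

/-! ### The bimoulds `𝔟` and `𝔟̃` -/

/-- `X^Z(X_1, …, X_r; Y_1, …, Y_r) = Z(X_1, …, X_r)`. -/
def Mould.toX {A : Type*} [CommRing A] (Z : Mould A) : Bimould A := fun r =>
  Z.eval ((bivars A r).map Prod.fst)

/-- `Y^Z(X_1, …, X_r; Y_1, …, Y_r) = Z(Y_1, …, Y_r)`. -/
def Mould.toY {A : Type*} [CommRing A] (Z : Mould A) : Bimould A := fun r =>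
  Z.eval ((bivars A r).map Prod.snd)

/-- The bimould `𝔟 = Y^{β_γ} × X^β` attached to a mould `β`. -/
def bimouldB (β : Mould ℚ) : Bimould ℚ :=
  β.gamma.toY.mul β.toX

/-- The bimould `𝔟̃ = Y^{β_γ^-} × exp(-T/2) × X^β`. -/
def bimouldBTilde (β : Mould ℚ) : Bimould ℚ :=
  (β.gamma.minus.toY.mul
    (Bimould.const (PowerSeries.rescale (-1 / 2 : ℚ) (PowerSeries.exp ℚ)))).mul β.toX

/-! ### The bimoulds `𝔏_m`, `𝔤^*` and `𝔊`

The values lie in `ℚ⟦q⟧`, which is `PowerSeries ℚ` with `q = PowerSeries.X`. -/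

/-- `e^x` for a power series `x` without constant term. -/
def expSeries {σ : Type*} (x : MvPowerSeries σ (PowerSeries ℚ)) :
    MvPowerSeries σ (PowerSeries ℚ) :=
  PowerSeries.subst x (PowerSeries.exp ℚ)

/-- The power series `q^m`, as a constant. -/
def qpow (σ : Type*) (m : ℕ) : MvPowerSeries σ (PowerSeries ℚ) :=
  MvPowerSeries.C ((PowerSeries.X : PowerSeries ℚ) ^ m)

/-- `L_m(x; y) = e^{x + m y} q^m / (1 - e^x q^m)`; for `m ≥ 1` the denominator is a unit. -/
def seriesL {σ : Type*} (m : ℕ) (x y : MvPowerSeries σ (PowerSeries ℚ)) :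
    MvPowerSeries σ (PowerSeries ℚ) :=
  expSeries (x + m • y) * qpow σ m * Ring.inverse (1 - expSeries x * qpow σ m)

/-- The bimould `𝔏_m`, in depth `r ≥ 1` the sum over `1 ≤ j ≤ r` of
`𝔟(X_1 - X_j, …, X_{j-1} - X_j; Y_1, …, Y_{j-1}) · L_m(X_j; Y_1 + ⋯ + Y_r) ·
  𝔟̃(X_r - X_j, …, X_{j+1} - X_j; Y_r, …, Y_{j+1})`. Here `j : Fin r` counts from `0`. -/
def bimouldL (β : Mould ℚ) (m : ℕ) : Bimould (PowerSeries ℚ) := fun r =>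
  if r = 0 then 1 else
    ∑ j : Fin r,
      (bimouldB β).eval (((bivars (PowerSeries ℚ) r).take (j : ℕ)).map
          fun p => (p.1 - MvPowerSeries.X (Sum.inl j), p.2)) *
        seriesL m (MvPowerSeries.X (Sum.inl j)) (∑ i : Fin r, MvPowerSeries.X (Sum.inr i)) *
        (bimouldBTilde β).eval (((bivars (PowerSeries ℚ) r).drop ((j : ℕ) + 1)).reverse.map
          fun p => (p.1 - MvPowerSeries.X (Sum.inl j), p.2))

/-- The formal sum of a family of power series over `ℚ⟦q⟧`, computed coefficient by coefficient:
for each monomial in the variables and each power of `q` only finitely many members of the families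
used below contribute. -/
def formalSum {ι σ : Type*} (f : ι → MvPowerSeries σ (PowerSeries ℚ)) :
    MvPowerSeries σ (PowerSeries ℚ) := fun e =>
  PowerSeries.mk fun n => ∑ᶠ i, PowerSeries.coeff n (MvPowerSeries.coeff e (f i))

/-- The bimould `𝔤^*`: the sum over all `0 = r_0 < r_1 < ⋯ < r_j = r` (a composition `c` of `r`) and
all `m_1 > ⋯ > m_j > 0` of
`∏_i 𝔏_{m_i}(X_{r_{i-1}+1}, …, X_{r_i}; Y_{r_{i-1}+1}, …, Y_{r_i})`.
In depth `0` this is `1`. -/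
def bimouldGStar (β : Mould ℚ) : Bimould (PowerSeries ℚ) := fun r =>
  ∑ c : Composition r,
    formalSum fun m : {m : Fin c.length → ℕ // StrictAnti m ∧ ∀ i, 0 < m i} =>
      ∏ i : Fin c.length, (bimouldL β (m.1 i)).eval
        (List.ofFn fun a : Fin (c.blocksFun i) =>
          ((MvPowerSeries.X (Sum.inl (c.embedding i a)),
            MvPowerSeries.X (Sum.inr (c.embedding i a))) :
            MvPowerSeries (Fin r ⊕ Fin r) (PowerSeries ℚ) ×
              MvPowerSeries (Fin r ⊕ Fin r) (PowerSeries ℚ)))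

/-- The bimould `𝔊 = 𝔤^* × 𝔟`. -/
def bimouldG (β : Mould ℚ) : Bimould (PowerSeries ℚ) :=
  (bimouldGStar β).mul ((bimouldB β).baseChange (PowerSeries ℚ))

/-- The combinatorial bi-multiple Eisenstein series `G(k_1, …, k_r; d_1, …, d_r) ∈ ℚ⟦q⟧` attached
to `β`; the index is the list of the pairs `(k_i, d_i)`. -/
def combEisenstein (β : Mould ℚ) (w : List (ℕ+ × ℕ)) : PowerSeries ℚ :=
  (bimouldG β).coeff w

/-! ### Quasi-modular forms -/

/-- The classical Eisenstein series of even weight `k ≥ 2`,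
`-B_k / (2 k!) + (1 / (k-1)!) ∑_{n ≥ 1} σ_{k-1}(n) q^n`. -/
def eisenstein (k : ℕ) : PowerSeries ℚ :=
  PowerSeries.mk fun n =>
    if n = 0 then -(bernoulli k / (2 * (k ! : ℚ)))
    else (ArithmeticFunction.sigma (k - 1) n : ℚ) / ((k - 1)! : ℚ)

/-- The space of (`q`-expansions of) quasi-modular forms of weight `w` for `SL₂(ℤ)` with rational
coefficients: the part of weight `w` of `ℚ[G₂, G₄, G₆]`, where `G_k` has weight `k`. -/
def quasiModularForms (w : ℕ) : Submodule ℚ (PowerSeries ℚ) :=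
  Submodule.span ℚ {f | ∃ a b c : ℕ, 2 * a + 4 * b + 6 * c = w ∧
    f = eisenstein 2 ^ a * eisenstein 4 ^ b * eisenstein 6 ^ c}

end CombEis

end

/-! Fix k and d and put F(T) = ∑_r G(k,…,k; d,…,d) T^r. The proof computes the logarithmic
derivative T F'/F = ∑_{n ≥ 1} (-1)^(n-1) c_n T^n, where c_n = ∑_{l,m ≥ 1} m^(nd) l^(nk-1)/(nk-1)!
q^(lm) plus a constant. This has the shape of Newton's identities between elementary symmetric
functions and power sums. Hence the coefficient of T^r in F is an isobaric rational polynomial in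
the c_n, and it is enough that c_n is quasi-modular of weight n(k+d). Up to a scalar, c_n is an
iterated q d/dq of some Eisenstein series (`lambertSeries_add_const_mem`), and q d/dq preserves
quasi-modularity (`theta_mem_quasiModularForms`), by Ramanujan's formula for E₂ and by the Serre
derivative for the other Eisenstein series.

Logarithmic derivatives add up because the structure is multiplicative. The product of bimoulds
becomes the product of diagonal series, which separates 𝔤^* from 𝔟. The sum over compositions and
decreasing sequences makes the diagonal series of 𝔤^* the product over m of those of 𝔏_m
(`sum_composition_antiSum`). For a character of the shuffle or stuffle algebra, Newton's identities
hold for arbitrarily weighted sums over words (`hasLogDeriv_wordSeries_shuffle`,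
`hasLogDeriv_wordSeries_stuffle`); applied to 𝔟 they give the constant terms of the c_n.

The heart is 𝔏_m. In the j-th summand write Z for X_j. Extracting X_i^(k-1) Y_i^d at another
position i gives a weight in ℚ⟦Z⟧ that depends only on the letter of the word placed there. The
summand therefore becomes [Z^(k-1)] of e^Z q^m/(1 - e^Z q^m) times weighted word sums of 𝔟 and 𝔟̃.
In the product of the two generating series the Y-parts cancel, since β(n) = 0 for odd n, and what
remains agrees modulo Z^k (after scaling T by m^d) with a series V(T) of Todd type, for which
V(-Y^k) = ∏_{ζ^k = 1} Z/(1 - e^{-Z}) · (1 - e^{-(Z-ζY)})/(Z - ζY). Multiplication by Z^k - Y^k = ∏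
(Z - ζY) removes the denominators in Z - ζY. Then [Z^(k-1)] of e^{lZ} times the result is a binomial
coefficient evaluation, and the generating series over l is ∏_ζ (1 - t e^{ζY})/(1 - t), whose
logarithmic derivative is explicit (`hasLogDeriv_residueSeries`). Setting t = q^m and summing over m
gives the Lambert series c_n. -/

namespace CombEis
noncomputable section

open UpperHalfPlane hiding I
open ModularForm Complex MatrixGroups EisensteinSeries Derivative
open scoped Manifold

/-! ### Functions on the upper half plane and their q-series -/

/-- `F` is given on the upper half plane by the convergent `q`-series `p`. -/
def HasQSeries (F : ℍ → ℂ) (p : PowerSeries ℂ) : Prop :=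
  ∀ τ : ℍ, HasSum (fun m : ℕ => PowerSeries.coeff m p • Function.Periodic.qParam (1 : ℝ) τ ^ m) (F τ)

theorem HasQSeries.add {F G : ℍ → ℂ} {p s : PowerSeries ℂ} (hF : HasQSeries F p)
    (hG : HasQSeries G s) : HasQSeries (F + G) (p + s) := fun τ => by
  simpa [add_mul] using (hF τ).add (hG τ)

theorem HasQSeries.smul {F : ℍ → ℂ} {p : PowerSeries ℂ} (hF : HasQSeries F p) (c : ℂ) :
    HasQSeries (c • F) (c • p) := fun τ => by
  simpa [mul_assoc] using (hF τ).mul_left c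

theorem HasQSeries.mul {F G : ℍ → ℂ} {p s : PowerSeries ℂ} (hF : HasQSeries F p)
    (hG : HasQSeries G s) : HasQSeries (F * G) (p * s) := fun τ => by
  have hf := (hF τ).summable.norm
  have hg := (hG τ).summable.norm
  have hs := (summable_norm_sum_mul_antidiagonal_of_summable_norm hf hg).of_norm
  have ht := tsum_mul_tsum_eq_tsum_sum_antidiagonal_of_summable_norm hf hg
  rw [(hF τ).tsum_eq, (hG τ).tsum_eq] at ht
  rw [Pi.mul_apply, ht]
  have he : (fun n => ∑ kl ∈ Finset.HasAntidiagonal.antidiagonal n,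
      PowerSeries.coeff kl.1 p • Function.Periodic.qParam (1 : ℝ) τ ^ kl.1 *
        PowerSeries.coeff kl.2 s • Function.Periodic.qParam (1 : ℝ) τ ^ kl.2) =
      fun n => PowerSeries.coeff n (p * s) • Function.Periodic.qParam (1 : ℝ) τ ^ n := by
    funext n
    rw [PowerSeries.coeff_mul, Finset.sum_smul]
    refine Finset.sum_congr rfl fun a ha => ?_
    rw [← Finset.HasAntidiagonal.mem_antidiagonal.1 ha, pow_add]
    simp only [smul_eq_mul]; ring
  rw [← he]
  exact hs.hasSum

/-- The derivation `q d/dq`. -/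
def theta {A : Type*} [CommRing A] (p : PowerSeries A) : PowerSeries A :=
  PowerSeries.mk fun n => n * PowerSeries.coeff n p

theorem HasQSeries.deriv {F : ℍ → ℂ} {p : PowerSeries ℂ} (hF : HasQSeries F p) :
    HasQSeries (D F) (theta p) := fun τ => by
  set U : Set ℂ := {w | τ.im / 2 < w.im}
  have hU : IsOpen U := isOpen_lt continuous_const Complex.continuous_im
  have hτU : (τ : ℂ) ∈ U := by
    simp only [U, Set.mem_ofPred_eq, coe_im]; linarith [τ.im_pos]
  -- The absolutely convergent series at this point of half the height dominates the series
  -- uniformly on `U`, which permits termwise differentiation.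
  let τ' : ℍ := ⟨((τ.im / 2 : ℝ) : ℂ) * I, by simpa using τ.im_pos⟩
  have key := hasSum_deriv_of_summable_norm (U := U) (z := (τ : ℂ))
    (F := fun m w => PowerSeries.coeff m p • Function.Periodic.qParam (1 : ℝ) w ^ m)
    (hF τ').summable.norm (fun m => by
      simp only [Function.Periodic.qParam]; fun_prop) hU
    (fun m w hw => by
      simp only [smul_eq_mul, norm_mul, norm_pow]
      gcongr
      rw [Function.Periodic.norm_qParam, Function.Periodic.norm_qParam]
      apply Real.exp_le_exp.2
      have : (τ' : ℂ).im = τ.im / 2 := by simp [τ']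
      rw [this]
      have hw' : τ.im / 2 < w.im := hw
      have := Real.pi_pos
      have := τ.im_pos
      simp only [div_one]
      nlinarith) hτU
  have heq : (fun w => ∑' m, PowerSeries.coeff m p • Function.Periodic.qParam (1 : ℝ) w ^ m)
      =ᶠ[nhds (τ : ℂ)] F ∘ ofComplex := by
    filter_upwards [isOpen_upperHalfPlaneSet.mem_nhds τ.im_pos] with w hw
    have := (hF ⟨w, hw⟩).tsum_eq
    rw [Function.comp_apply, ofComplex_apply_of_im_pos hw, ← this]
  rw [heq.deriv_eq] at key
  have := key.mul_left ((2 * Real.pi * I)⁻¹)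
  have hval : (2 * Real.pi * I)⁻¹ * _root_.deriv (F ∘ ofComplex) τ = D F τ := rfl
  rw [hval] at this
  refine Eq.mp (congrArg (fun c => HasSum c (D F τ)) (funext fun m => ?_)) this
  have h1 : HasDerivAt (fun w : ℂ => PowerSeries.coeff m p • Function.Periodic.qParam (1 : ℝ) w ^ m)
      (PowerSeries.coeff m p *
        (m * (2 * Real.pi * I) * Function.Periodic.qParam (1 : ℝ) τ ^ m)) τ := by
    have h2 : (fun w : ℂ => PowerSeries.coeff m p • Function.Periodic.qParam (1 : ℝ) w ^ m) =
        fun w : ℂ => PowerSeries.coeff m p * Complex.exp (m * (2 * Real.pi * I * w)) := by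
      funext w
      simp [Function.Periodic.qParam, Complex.exp_nat_mul]
    have h3 : Function.Periodic.qParam (1 : ℝ) τ ^ m =
        Complex.exp (m * (2 * Real.pi * I * τ)) := by
      simp [Function.Periodic.qParam, Complex.exp_nat_mul]
    rw [h2, h3]
    have h4 : HasDerivAt (fun w : ℂ => (m : ℂ) * (2 * Real.pi * I * w))
        (m * (2 * Real.pi * I)) (τ : ℂ) := by
      simpa using ((hasDerivAt_id (τ : ℂ)).const_mul (2 * Real.pi * I)).const_mul (m : ℂ)
    rw [mul_comm ((m : ℂ) * _)]
    exact h4.cexp.const_mul (PowerSeries.coeff m p)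
  rw [h1.deriv]
  have : (2 * Real.pi * I : ℂ) ≠ 0 := two_pi_I_ne_zero
  simp only [theta, PowerSeries.coeff_mk, smul_eq_mul]
  field_simp

/-- A holomorphic function on the upper half plane which is invariant under the weight `k` action of
`SL(2, ℤ)` and given by a `q`-series is a modular form. -/
def modularFormOfQSeries {F : ℍ → ℂ} {p : PowerSeries ℂ} {k : ℤ} (hF : MDiff F)
    (hp : HasQSeries F p) (hinv : ∀ γ : SL(2, ℤ), F ∣[k] γ = F) : ModularForm 𝒮ℒ k where
  toFun := F
  slash_action_eq' := by
    rintro _ ⟨γ, rfl⟩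
    exact hinv γ
  holo' := hF
  bdd_at_cusps' {c} hc := by
    -- Every cusp is a translate of ∞, so by invariance boundedness is only needed at ∞, where the
    -- q-series gives it.
    rw [Subgroup.IsArithmetic.isCusp_iff_isCusp_SL2Z] at hc
    rw [OnePoint.isBoundedAt_iff_forall_SL2Z hc]
    intro γ _
    rw [hinv γ]
    exact isBoundedAtImInfty_of_hasSum_qExpansion one_pos hp

theorem qExpansion_modularFormOfQSeries {F : ℍ → ℂ} {p : PowerSeries ℂ} {k : ℤ} (hF : MDiff F)
    (hp : HasQSeries F p) (hinv : ∀ γ : SL(2, ℤ), F ∣[k] γ = F) :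
    qExpansion 1 (modularFormOfQSeries hF hp hinv) = p := by
  ext m
  exact (ModularFormClass.qExpansion_coeff_unique (f := modularFormOfQSeries hF hp hinv) one_pos
    one_mem_strictPeriods_SL hp m).symm

theorem hasQSeries_modularForm {k : ℤ} (f : ModularForm 𝒮ℒ k) : HasQSeries f (qExpansion 1 f) :=
  fun τ => by
    have : Fact (IsCusp OnePoint.infty 𝒮ℒ) :=
      ⟨Subgroup.isCusp_of_mem_strictPeriods one_pos one_mem_strictPeriods_SL⟩
    simpa using ModularForm.hasSum_qExpansion f one_pos one_mem_strictPeriods_SL τ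

/-! ### Level one modular forms with rational q-expansion -/

/-- The normalised Eisenstein series with constant term `1`. -/
def normEisenstein (k : ℕ) : PowerSeries ℚ :=
  PowerSeries.mk fun n => if n = 0 then 1 else
    -(2 * (k : ℚ) / bernoulli k) * (ArithmeticFunction.sigma (k - 1) n : ℚ)

theorem constantCoeff_normEisenstein (k : ℕ) :
    PowerSeries.constantCoeff (normEisenstein k) = 1 := by
  simp [normEisenstein, ← PowerSeries.coeff_zero_eq_constantCoeff_apply]

/-- Extension of scalars of power series from `ℚ` to `ℂ`. -/
abbrev toComplex : PowerSeries ℚ →+* PowerSeries ℂ := PowerSeries.map (algebraMap ℚ ℂ)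

theorem toComplex_injective : Function.Injective toComplex :=
  PowerSeries.map_injective _ (algebraMap ℚ ℂ).injective

theorem toComplex_normEisenstein {k : ℕ} (hk : 3 ≤ k) (hk2 : Even k) :
    toComplex (normEisenstein k) = qExpansion 1 (E hk) := by
  ext m
  rw [EisensteinSeries.E_qExpansion_coeff hk hk2, PowerSeries.coeff_map, normEisenstein,
    PowerSeries.coeff_mk]
  split_ifs <;> simp

/-- By Euler's formula ζ(2j) is a multiple of B_{2j}, and ζ has no zero in Re s > 1. -/
theorem bernoulli_ne_zero_of_even {k : ℕ} (hk : Even k) : bernoulli k ≠ 0 := by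
  obtain ⟨j, rfl⟩ := hk
  rw [← two_mul]
  rcases eq_or_ne j 0 with rfl | hj
  · simp
  intro h
  have h1 := riemannZeta_two_mul_nat hj
  rw [h] at h1
  have h2 : riemannZeta (2 * j) ≠ 0 := by
    apply riemannZeta_ne_zero_of_one_lt_re
    have : (1 : ℝ) ≤ j := by exact_mod_cast Nat.one_le_iff_ne_zero.2 hj
    simp
    linarith
  apply h2
  rw [h1]; simp

theorem eisenstein_eq_smul {k : ℕ} (hk0 : k ≠ 0) (hk : Even k) :
    eisenstein k = (-(bernoulli k / (2 * (k ! : ℚ)))) • normEisenstein k := by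
  ext n
  have hb := bernoulli_ne_zero_of_even hk
  obtain ⟨j, rfl⟩ := Nat.exists_eq_succ_of_ne_zero hk0
  have : (j ! : ℚ) ≠ 0 := by positivity
  have : (j + 1 : ℚ) ≠ 0 := by positivity
  simp only [eisenstein, normEisenstein, PowerSeries.coeff_mk, PowerSeries.coeff_smul]
  split_ifs
  · simp
  · simp only [Nat.succ_eq_add_one, Nat.factorial_succ, Nat.cast_mul, Nat.cast_add, Nat.cast_one,
      Nat.add_sub_cancel, smul_eq_mul] at *
    field_simp

theorem mul_mem_quasiModularForms {v w : ℕ} {f g : PowerSeries ℚ} (hf : f ∈ quasiModularForms v)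
    (hg : g ∈ quasiModularForms w) : f * g ∈ quasiModularForms (v + w) := by
  have h := Submodule.mul_mem_mul hf hg
  rw [quasiModularForms, quasiModularForms, Submodule.span_mul_span] at h
  refine Submodule.span_mono ?_ h
  rintro _ ⟨_, ⟨a, b, c, h1, rfl⟩, _, ⟨a', b', c', h2, rfl⟩, rfl⟩
  exact ⟨a + a', b + b', c + c', by omega, by simp only; ring⟩

theorem one_mem_quasiModularForms : (1 : PowerSeries ℚ) ∈ quasiModularForms 0 :=
  Submodule.subset_span ⟨0, 0, 0, rfl, by simp⟩

theorem pow_mem_quasiModularForms {v : ℕ} {f : PowerSeries ℚ} (hf : f ∈ quasiModularForms v)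
    (n : ℕ) : f ^ n ∈ quasiModularForms (n * v) := by
  induction n with
  | zero => simpa using one_mem_quasiModularForms
  | succ n ih =>
    rw [pow_succ, Nat.succ_mul]
    exact mul_mem_quasiModularForms ih hf

theorem normEisenstein_mem_of_eisenstein_mem {k w : ℕ} (hk0 : k ≠ 0) (hk : Even k)
    (h : eisenstein k ∈ quasiModularForms w) : normEisenstein k ∈ quasiModularForms w := by
  rw [eisenstein_eq_smul hk0 hk] at h
  have hc : (-(bernoulli k / (2 * (k ! : ℚ)))) ≠ 0 := by
    have := bernoulli_ne_zero_of_even hk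
    have : (k ! : ℚ) ≠ 0 := by positivity
    simp [*]
  have h2 := Submodule.smul_mem _ (-(bernoulli k / (2 * (k ! : ℚ))))⁻¹ h
  rwa [smul_smul, inv_mul_cancel₀ hc, one_smul] at h2

theorem normEisenstein_two_mem : normEisenstein 2 ∈ quasiModularForms 2 :=
  normEisenstein_mem_of_eisenstein_mem (by norm_num) even_two
    (Submodule.subset_span ⟨1, 0, 0, rfl, by simp⟩)

theorem normEisenstein_four_mem : normEisenstein 4 ∈ quasiModularForms 4 :=
  normEisenstein_mem_of_eisenstein_mem (by norm_num) ⟨2, rfl⟩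
    (Submodule.subset_span ⟨0, 1, 0, rfl, by simp⟩)

theorem normEisenstein_six_mem : normEisenstein 6 ∈ quasiModularForms 6 :=
  normEisenstein_mem_of_eisenstein_mem (by norm_num) ⟨3, rfl⟩
    (Submodule.subset_span ⟨0, 0, 1, rfl, by simp⟩)

/-- The rational `q`-series of the discriminant. -/
def discSeries : PowerSeries ℚ :=
  (1 / 1728 : ℚ) • (normEisenstein 4 ^ 3 - normEisenstein 6 ^ 2)

theorem discSeries_mem : discSeries ∈ quasiModularForms 12 :=
  Submodule.smul_mem _ _ (Submodule.sub_mem _ (pow_mem_quasiModularForms normEisenstein_four_mem 3)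
    (pow_mem_quasiModularForms normEisenstein_six_mem 2))

/-- The identity 1728 Δ = E₄³ - E₆² of functions passes to q-series by uniqueness of the
coefficients. -/
theorem toComplex_discSeries : toComplex discSeries = qExpansion 1 discriminant := by
  have h4 := hasQSeries_modularForm E₄
  have h6 := hasQSeries_modularForm E₆
  rw [← toComplex_normEisenstein (by norm_num) ⟨2, rfl⟩] at h4
  rw [← toComplex_normEisenstein (by norm_num) ⟨3, rfl⟩] at h6
  have h := (((h4.mul (h4.mul h4)).add ((h6.mul h6).smul (-1))).smul (1 / 1728 : ℂ))
  have hd : (1 / 1728 : ℂ) • ((E₄ * (E₄ * E₄ : ℍ → ℂ) : ℍ → ℂ) + (-1 : ℂ) • (E₆ * E₆ : ℍ → ℂ)) =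
      CuspForm.discriminant := by
    funext z
    have := discriminant_eq_E₄_cube_sub_E₆_sq z
    rw [CuspForm.coe_discriminant, this]
    simp
    ring
  rw [hd] at h
  rw [← CuspForm.coe_discriminant]
  ext m
  rw [← ModularFormClass.qExpansion_coeff_unique one_pos one_mem_strictPeriods_SL h m]
  congr 1
  simp only [discSeries, toComplex]
  rw [PowerSeries.smul_eq_C_mul, PowerSeries.smul_eq_C_mul, PowerSeries.smul_eq_C_mul]
  simp
  ring

/-- The usual induction on the weight, kept rational throughout: subtract a multiple of a monomial
in E₄ and E₆ to reach a cusp form, then divide by the discriminant, which lowers the weight by 12.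
-/
theorem mem_quasiModularForms_of_toComplex_eq (k : ℕ) : ∀ (f : ModularForm 𝒮ℒ k)
    (F : PowerSeries ℚ), toComplex F = qExpansion 1 f → F ∈ quasiModularForms k := by
  induction k using Nat.strong_induction_on with
  | _ k ih =>
  intro f F hF
  have hzero : ∀ F : PowerSeries ℚ, toComplex F = 0 → F = 0 := fun F h =>
    toComplex_injective (by rw [h, map_zero])
  have hf0 : f = 0 → F ∈ quasiModularForms k := by
    rintro rfl
    rw [hzero F (by rw [hF]; exact qExpansion_zero 1)]
    exact Submodule.zero_mem _
  rcases Nat.even_or_odd k with hk | hk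
  swap
  · exact hf0 (levelOne_odd_weight_eq_zero (by exact_mod_cast hk) f)
  rcases eq_or_ne k 2 with rfl | hk2
  · exact hf0 (rank_zero_iff_forall_zero.1 levelOne_weight_two_rank_zero f)
  -- For k = 4i + 2 one factor E₆ is split off; i ≥ 1 because weight 2 has been excluded.
  obtain ⟨a, b, hab⟩ : ∃ a b, k = a * 4 + b * 6 := by
    obtain ⟨j, rfl⟩ := hk
    rcases Nat.even_or_odd j with ⟨i, rfl⟩ | ⟨i, rfl⟩
    · exact ⟨i, 0, by omega⟩
    · exact ⟨i - 1, 1, by omega⟩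
  set P : PowerSeries ℚ := normEisenstein 4 ^ a * normEisenstein 6 ^ b
  have hP : P ∈ quasiModularForms k := by
    rw [hab]
    exact mul_mem_quasiModularForms (pow_mem_quasiModularForms normEisenstein_four_mem a)
      (pow_mem_quasiModularForms normEisenstein_six_mem b)
  let g : ModularForm 𝒮ℒ k := ModularForm.mcast (by rw [hab]; push_cast; ring)
    ((E₄.pow a).mul (E₆.pow b))
  have hg : qExpansion 1 g = toComplex P := by
    simp only [g, ModularForm.qExpansion_mcast, P, map_mul, map_pow]
    rw [ModularForm.qExpansion_mul one_pos one_mem_strictPeriods_SL,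
      ModularForm.qExpansion_pow one_pos one_mem_strictPeriods_SL,
      ModularForm.qExpansion_pow one_pos one_mem_strictPeriods_SL,
      toComplex_normEisenstein (by norm_num) ⟨2, rfl⟩,
      toComplex_normEisenstein (by norm_num) ⟨3, rfl⟩]
  set c := PowerSeries.coeff 0 F
  have hP0 : PowerSeries.coeff 0 P = 1 := by
    simp [P, normEisenstein]
  let f' : ModularForm 𝒮ℒ k := f - (c : ℂ) • g
  have hf' : toComplex (F - c • P) = qExpansion 1 f' := by
    have : (f' : ℍ → ℂ) = f - ((c : ℂ) • g : ModularForm 𝒮ℒ k) := rfl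
    rw [this, ModularForm.qExpansion_sub one_pos one_mem_strictPeriods_SL,
      show (((c : ℂ) • g : ModularForm 𝒮ℒ k) : ℍ → ℂ) = (c : ℂ) • (g : ℍ → ℂ) from rfl,
      ModularForm.qExpansion_smul one_pos one_mem_strictPeriods_SL, hg, ← hF, map_sub,
      PowerSeries.smul_eq_C_mul, PowerSeries.smul_eq_C_mul, map_mul]
    simp
  have hc0 : PowerSeries.coeff 0 (F - c • P) = 0 := by
    rw [map_sub, PowerSeries.coeff_smul, hP0]; simp [c]
  have hcusp : (qExpansion 1 f').coeff 0 = 0 := by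
    rw [← hf', PowerSeries.coeff_map, hc0, map_zero]
  suffices h : F - c • P ∈ quasiModularForms k by
    have := Submodule.add_mem _ h (Submodule.smul_mem _ c hP)
    simpa using this
  rcases lt_or_ge k 12 with hk12 | hk12
  · have h0 : qExpansion 1 f' = 0 := by
      rw [qExpansion_eq_qExpansion_discriminant_mul f' hcusp]
      have : f'.toCuspForm hcusp = 0 := rank_zero_iff_forall_zero.1
        (CuspForm.rank_eq_zero_of_weight_lt_twelve (by exact_mod_cast hk12)) _
      rw [this, map_zero]
      simp [qExpansion_zero]
    rw [hzero _ (hf'.trans h0)]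
    exact Submodule.zero_mem _
  · let h : ModularForm 𝒮ℒ ((k - 12 : ℕ) : ℤ) := ModularForm.mcast (by push_cast [hk12]; ring)
      (CuspForm.discriminantEquiv (f'.toCuspForm hcusp))
    have hq : toComplex (F - c • P) = toComplex discSeries * qExpansion 1 h := by
      rw [hf', qExpansion_eq_qExpansion_discriminant_mul f' hcusp, toComplex_discSeries]
      rfl
    -- The discriminant is q times a unit of ℚ⟦q⟧, so division by it does not leave the rational
    -- power series.
    obtain ⟨u, hu⟩ : PowerSeries.X ∣ discSeries := by
      rw [PowerSeries.X_dvd_iff]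
      simp [discSeries, PowerSeries.smul_eq_C_mul, constantCoeff_normEisenstein]
    obtain ⟨v, hv⟩ : PowerSeries.X ∣ F - c • P := by
      rw [PowerSeries.X_dvd_iff, ← PowerSeries.coeff_zero_eq_constantCoeff_apply, hc0]
    have hu0 : PowerSeries.constantCoeff u ≠ 0 := by
      intro h0
      have h1 : PowerSeries.coeff 1 (qExpansion 1 discriminant) = 1 :=
        discriminant_qExpansion_coeff_one
      rw [← toComplex_discSeries, hu, PowerSeries.coeff_map, PowerSeries.coeff_succ_X_mul,
        PowerSeries.coeff_zero_eq_constantCoeff_apply, h0] at h1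
      simp at h1
    have huv : toComplex (u⁻¹ * v) = qExpansion 1 h := by
      rw [hu, hv, map_mul, map_mul, mul_assoc] at hq
      have hX : toComplex (PowerSeries.X : PowerSeries ℚ) ≠ 0 := by
        simp [PowerSeries.X_ne_zero]
      have := mul_left_cancel₀ hX hq
      rw [map_mul, this, ← mul_assoc, ← map_mul, PowerSeries.inv_mul_cancel _ hu0, map_one, one_mul]
    have hmem := ih (k - 12) (by omega) h _ huv
    have : F - c • P = discSeries * (u⁻¹ * v) := by
      rw [hu, hv]
      calc _ = PowerSeries.X * (u * u⁻¹) * v := by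
            rw [PowerSeries.mul_inv_cancel _ hu0, mul_one]
        _ = _ := by ring
    rw [this]
    have := mul_mem_quasiModularForms discSeries_mem hmem
    rwa [show 12 + (k - 12) = k by omega] at this

theorem eisenstein_mem_quasiModularForms {k : ℕ} (hk0 : k ≠ 0) (hk : Even k) :
    eisenstein k ∈ quasiModularForms k := by
  rcases eq_or_ne k 2 with rfl | hk2
  · exact Submodule.subset_span ⟨1, 0, 0, rfl, by simp⟩
  have hk3 : 3 ≤ k := by
    obtain ⟨j, rfl⟩ := hk
    omega
  rw [eisenstein_eq_smul hk0 hk]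
  exact Submodule.smul_mem _ _
    (mem_quasiModularForms_of_toComplex_eq k (E hk3) _ (toComplex_normEisenstein hk3 hk))

/-! ### Closure of quasi-modular forms under q d/dq -/

theorem hasQSeries_E2 : HasQSeries E2 (toComplex (normEisenstein 2)) := fun τ => by
  have h := hasSum_qExpansion_E2 (z := τ)
  refine Eq.mp (congrArg (fun c => HasSum c (E2 τ)) (funext fun m => ?_)) h
  congr 1
  · rw [PowerSeries.coeff_map, normEisenstein, PowerSeries.coeff_mk]
    split_ifs
    · simp
    · rw [bernoulli_two]; norm_num
  · simp [Function.Periodic.qParam]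

theorem theta_add {A : Type*} [CommRing A] (f g : PowerSeries A) :
    theta (f + g) = theta f + theta g := by
  ext n; simp [theta, mul_add]

theorem theta_smul {A : Type*} [CommRing A] (c : A) (f : PowerSeries A) :
    theta (c • f) = c • theta f := by
  ext n; simp [theta, mul_left_comm]

theorem theta_mul {A : Type*} [CommRing A] (f g : PowerSeries A) :
    theta (f * g) = theta f * g + f * theta g := by
  ext n
  simp only [theta, PowerSeries.coeff_mk, PowerSeries.coeff_mul, map_add, Finset.mul_sum,
    ← Finset.sum_add_distrib]
  refine Finset.sum_congr rfl fun p hp => ?_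
  rw [← Finset.HasAntidiagonal.mem_antidiagonal.1 hp]
  push_cast; ring

theorem toComplex_theta (f : PowerSeries ℚ) : toComplex (theta f) = theta (toComplex f) := by
  ext n; simp [theta]

theorem toComplex_smul (c : ℚ) (f : PowerSeries ℚ) :
    toComplex (c • f) = (c : ℂ) • toComplex f := by
  ext n; simp

/-- The derivative of the quasimodular correction term of `E2`. -/
theorem normalizedDeriv_D2 (γ : SL(2, ℤ)) (z : ℍ) :
    D (D2 γ) z = - (γ 1 0 / denom γ z : ℂ) ^ 2 := by
  have hz := denom_ne_zero γ z
  have h1 : HasDerivAt (fun w : ℂ => 2 * Real.pi * I * γ 1 0 * denom γ w ^ (-1 : ℤ))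
      (2 * Real.pi * I * γ 1 0 * (((-1 : ℤ) : ℂ) * (γ 1 0 : ℂ) * denom γ z ^ (-1 - 1 : ℤ))) (z : ℂ) := by
    have := (hasDerivAt_denom_zpow (γ : GL (Fin 2) ℝ) (-1) z).const_mul
      (2 * Real.pi * I * γ 1 0 : ℂ)
    simpa using this
  have h2 : (D2 γ ∘ ofComplex) =ᶠ[nhds (z : ℂ)]
      fun w : ℂ => 2 * Real.pi * I * γ 1 0 * denom γ w ^ (-1 : ℤ) := by
    filter_upwards [isOpen_upperHalfPlaneSet.mem_nhds z.im_pos] with w hw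
    rw [Function.comp_apply, ofComplex_apply_of_im_pos hw]
    simp [D2, div_eq_mul_inv]
  rw [normalizedDerivOfComplex, h2.deriv_eq, h1.deriv]
  have : (2 * Real.pi * I : ℂ) ≠ 0 := two_pi_I_ne_zero
  rw [show (-1 - 1 : ℤ) = -2 by norm_num, zpow_neg, div_pow]
  push_cast
  field_simp

/-- Up to a constant, `D2 γ` is the difference of E₂ and its slash transform, both of which are
holomorphic. -/
theorem mdifferentiable_D2 (γ : SL(2, ℤ)) : MDiff (D2 γ) := by
  have h : D2 γ = (2 * riemannZeta 2) • (E2 - E2 ∣[(2 : ℤ)] γ) := by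
    have h2 : (2 * riemannZeta 2 : ℂ) ≠ 0 := by
      simp [riemannZeta_ne_zero_of_one_lt_re]
    rw [E2_slash_action, sub_sub_cancel, smul_smul, mul_one_div_cancel h2, one_smul]
  rw [h]
  exact (E2_mdifferentiable.sub (E2_mdifferentiable.slash 2 γ)).const_smul _

/-- `D E2 - E2 ^ 2 / 12` is invariant in weight `4`. -/
theorem ramanujan_E2_invariant (γ : SL(2, ℤ)) :
    (D E2 + (-(1 / 12) : ℂ) • (E2 * E2)) ∣[(4 : ℤ)] γ = D E2 + (-(1 / 12) : ℂ) • (E2 * E2) := by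
  have h1 := normalizedDerivOfComplex_SL_slash (k := 2) E2_mdifferentiable (γ := γ)
  have h2 := mul_slash_SL2 2 2 γ E2 E2
  rw [E2_slash_action] at h1 h2
  have h3 : D (E2 - (1 / (2 * riemannZeta 2)) • D2 γ) =
      D E2 - (1 / (2 * riemannZeta 2)) • D (D2 γ) := by
    rw [normalizedDerivOfComplex_sub _ _ E2_mdifferentiable
      ((mdifferentiable_D2 γ).const_smul _), normalizedDerivOfComplex_smul _ _ (mdifferentiable_D2 γ)]
  rw [h3] at h1
  rw [SlashAction.add_slash, ModularForm.SL_smul_slash]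
  rw [show (2 + 2 : ℤ) = 4 by norm_num] at h1 h2
  rw [h2]
  funext z
  have h4 := congrFun h1 z
  have hpi : (Real.pi : ℂ) ≠ 0 := by exact_mod_cast Real.pi_ne_zero
  have hz := denom_ne_zero γ z
  simp only [Pi.sub_apply, Pi.smul_apply, smul_eq_mul, normalizedDeriv_D2] at h4
  simp only [Pi.add_apply, Pi.smul_apply, Pi.mul_apply, Pi.sub_apply, smul_eq_mul]
  have h5 : (D E2 ∣[(4 : ℤ)] γ) z = _ := (sub_eq_iff_eq_add.1 h4.symm)
  rw [h5]
  -- With ζ(2) = π²/6 the terms linear in E₂ and those free of E₂ cancel, thanks to the factor 1/12;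
  -- beyond clearing denominators only `I ^ 2 = -1` is needed.
  simp only [D2, riemannZeta_two]
  generalize E2 z = e
  generalize D E2 z = f
  generalize denom γ z = u at hz
  have hI := I_sq
  field_simp
  linear_combination (24 * Real.pi * u * (γ 1 0 : ℂ) * e - 72 * (γ 1 0 : ℂ) ^ 2 * I) * hI

theorem mem_quasiModularForms_of_hasQSeries {F : ℍ → ℂ} {f : PowerSeries ℚ} {k : ℕ}
    (hF : MDiff F) (hf : HasQSeries F (toComplex f)) (hinv : ∀ γ : SL(2, ℤ), F ∣[(k : ℤ)] γ = F) :
    f ∈ quasiModularForms k :=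
  mem_quasiModularForms_of_toComplex_eq k (modularFormOfQSeries hF hf hinv) f
    (qExpansion_modularFormOfQSeries hF hf hinv).symm

/-- Ramanujan: D E₂ - E₂²/12 is a modular form of weight 4, and E₂² is quasi-modular of weight 4. -/
theorem theta_normEisenstein_two_mem : theta (normEisenstein 2) ∈ quasiModularForms 4 := by
  have hq := hasQSeries_E2.deriv.add ((hasQSeries_E2.mul hasQSeries_E2).smul (-(1 / 12)))
  have he : theta (toComplex (normEisenstein 2)) +
      (-(1 / 12) : ℂ) • (toComplex (normEisenstein 2) * toComplex (normEisenstein 2)) =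
      toComplex (theta (normEisenstein 2) + (-(1 / 12) : ℚ) • normEisenstein 2 ^ 2) := by
    rw [map_add, toComplex_theta, toComplex_smul, map_pow, sq]
    norm_num
  rw [he] at hq
  have hm := mem_quasiModularForms_of_hasQSeries (k := 4)
    ((normalizedDerivOfComplex_mdifferentiable E2_mdifferentiable).add
      ((E2_mdifferentiable.mul E2_mdifferentiable).const_smul _)) hq ramanujan_E2_invariant
  have := Submodule.add_mem _ hm (Submodule.smul_mem _ (1 / 12 : ℚ)
    (pow_mem_quasiModularForms normEisenstein_two_mem 2))
  rw [add_assoc, ← add_smul] at this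
  simpa using this

/-- The Serre derivative D E_k - (k/12) E₂ E_k is a modular form of weight k + 2, and the correction
term is a product of quasi-modular forms. -/
theorem theta_normEisenstein_mem {k : ℕ} (hk : 3 ≤ k) (hk2 : Even k) :
    theta (normEisenstein k) ∈ quasiModularForms (k + 2) := by
  have hE := hasQSeries_modularForm (E hk)
  rw [← toComplex_normEisenstein hk hk2] at hE
  have hq := hE.deriv.add ((hasQSeries_E2.mul hE).smul (-(k * 12⁻¹)))
  have he : theta (toComplex (normEisenstein k)) +
      (-(k * 12⁻¹) : ℂ) • (toComplex (normEisenstein 2) * toComplex (normEisenstein k)) =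
      toComplex (theta (normEisenstein k) +
        (-(k * 12⁻¹) : ℚ) • (normEisenstein 2 * normEisenstein k)) := by
    rw [map_add, toComplex_theta, toComplex_smul, map_mul]
    norm_num
  rw [he] at hq
  have hs : (D (E hk) + (-(k * 12⁻¹) : ℂ) • (E2 * E hk) : ℍ → ℂ) =
      serreDerivative (k : ℤ) (E hk) := by
    funext z
    simp [serreDerivative]
    ring
  rw [hs] at hq
  have hm := mem_quasiModularForms_of_hasQSeries (k := k + 2)
    (serreDerivative_mdifferentiable _ (ModularFormClass.holo (E hk))) hq (fun γ => by
      have := serreDerivative_slash_invariant (k := k) (ModularFormClass.holo (E hk)) (γ := γ)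
        (SlashInvariantFormClass.slash_action_eq (E hk) (γ : GL (Fin 2) ℝ) ⟨γ, rfl⟩)
      simpa using this)
  have h1 := mul_mem_quasiModularForms (v := 2) (w := k) normEisenstein_two_mem
    (normEisenstein_mem_of_eisenstein_mem (by omega) hk2
      (eisenstein_mem_quasiModularForms (by omega) hk2))
  rw [show 2 + k = k + 2 by ring] at h1
  have := Submodule.add_mem _ hm (Submodule.smul_mem _ (k * 12⁻¹ : ℚ) h1)
  rw [add_assoc, ← add_smul] at this
  simpa using this

theorem theta_eisenstein_mem {k : ℕ} (hk : k ≠ 0) (hk2 : Even k) :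
    theta (eisenstein k) ∈ quasiModularForms (k + 2) := by
  rw [eisenstein_eq_smul hk hk2, theta_smul]
  apply Submodule.smul_mem
  rcases eq_or_ne k 2 with rfl | h2
  · exact theta_normEisenstein_two_mem
  · obtain ⟨j, rfl⟩ := hk2
    exact theta_normEisenstein_mem (by omega) ⟨j, rfl⟩

theorem theta_pow_mem {v : ℕ} {f : PowerSeries ℚ} (hf : f ∈ quasiModularForms v)
    (hf' : theta f ∈ quasiModularForms (v + 2)) (n : ℕ) :
    theta (f ^ n) ∈ quasiModularForms (n * v + 2) := by
  induction n with
  | zero =>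
    have : theta (1 : PowerSeries ℚ) = 0 := by
      ext n
      by_cases h : n = 0 <;> simp [theta, PowerSeries.coeff_one, h]
    simp [this]
  | succ n ih =>
    rw [pow_succ, theta_mul]
    refine Submodule.add_mem _ ?_ ?_
    · have := mul_mem_quasiModularForms ih hf
      rwa [show n * v + 2 + v = (n + 1) * v + 2 by ring] at this
    · have := mul_mem_quasiModularForms (pow_mem_quasiModularForms hf n) hf'
      rwa [show n * v + (v + 2) = (n + 1) * v + 2 by ring] at this

/-- Quasimodular forms are closed under `q d/dq`, which raises the weight by two. -/
theorem theta_mem_quasiModularForms {w : ℕ} {f : PowerSeries ℚ} (hf : f ∈ quasiModularForms w) :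
    theta f ∈ quasiModularForms (w + 2) := by
  have hm {k : ℕ} (hk : k ≠ 0) (hk2 : Even k) (n : ℕ) :=
    theta_pow_mem (eisenstein_mem_quasiModularForms hk hk2) (theta_eisenstein_mem hk hk2) n
  have hm' {k : ℕ} (hk : k ≠ 0) (hk2 : Even k) (n : ℕ) :=
    pow_mem_quasiModularForms (eisenstein_mem_quasiModularForms hk hk2) n
  have e2 : Even 2 := even_two
  have e4 : Even 4 := ⟨2, rfl⟩
  have e6 : Even 6 := ⟨3, rfl⟩
  rw [quasiModularForms] at hf
  induction hf using Submodule.span_induction with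
  | mem f hf =>
    obtain ⟨a, b, c, h, rfl⟩ := hf
    rw [theta_mul, theta_mul, add_mul]
    refine Submodule.add_mem _ (Submodule.add_mem _ ?_ ?_) ?_
    · have := mul_mem_quasiModularForms (mul_mem_quasiModularForms (hm two_ne_zero e2 a)
        (hm' four_ne_zero e4 b)) (hm' (by norm_num) e6 c)
      rwa [show a * 2 + 2 + b * 4 + c * 6 = w + 2 by omega] at this
    · have := mul_mem_quasiModularForms (mul_mem_quasiModularForms (hm' two_ne_zero e2 a)
        (hm four_ne_zero e4 b)) (hm' (by norm_num) e6 c)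
      rwa [show a * 2 + (b * 4 + 2) + c * 6 = w + 2 by omega] at this
    · have := mul_mem_quasiModularForms (mul_mem_quasiModularForms (hm' two_ne_zero e2 a)
        (hm' four_ne_zero e4 b)) (hm (by norm_num) e6 c)
      rwa [show a * 2 + b * 4 + (c * 6 + 2) = w + 2 by omega] at this
  | zero =>
    have : theta (0 : PowerSeries ℚ) = 0 := by ext n; simp [theta]
    simp [this]
  | add f g _ _ hf hg => rw [theta_add]; exact Submodule.add_mem _ hf hg
  | smul c f _ hf => rw [theta_smul]; exact Submodule.smul_mem _ _ hf

theorem iterate_theta_mem_quasiModularForms {w : ℕ} {f : PowerSeries ℚ}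
    (hf : f ∈ quasiModularForms w) (n : ℕ) : theta^[n] f ∈ quasiModularForms (w + 2 * n) := by
  induction n with
  | zero => simpa using hf
  | succ n ih =>
    rw [Function.iterate_succ_apply']
    exact theta_mem_quasiModularForms ih

/-! ### Lambert series as derivatives of Eisenstein series -/

theorem coeff_iterate_theta (f : PowerSeries ℚ) (n m : ℕ) :
    PowerSeries.coeff m (theta^[n] f) = (m : ℚ) ^ n * PowerSeries.coeff m f := by
  induction n with
  | zero => simp
  | succ n ih =>
    rw [Function.iterate_succ_apply', theta, PowerSeries.coeff_mk, ih]
    ring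

/-- The series `∑_{l, m ≥ 1} m^d l^(k-1) / (k-1)! q^(l m)`. -/
def lambertSeries (k d : ℕ) : PowerSeries ℚ :=
  PowerSeries.mk fun n => ∑ p ∈ n.divisorsAntidiagonal,
    (p.1 : ℚ) ^ d * (p.2 : ℚ) ^ (k - 1) / ((k - 1)! : ℚ)

/-- The constant term which completes `lambertSeries` to a quasimodular form. -/
def lambertConst (k d : ℕ) : ℚ :=
  if d = 0 then -(bernoulli k / (2 * (k ! : ℚ)))
  else if k = 1 then d ! * -(bernoulli (d + 1) / (2 * ((d + 1)! : ℚ))) else 0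

/-- On the divisor pairs n = m l the smaller of the exponents d and k - 1 can be moved to n, which
amounts to applying q d/dq that many times to an Eisenstein series. The parity of k + d makes the
weight of that series even. -/
theorem lambertSeries_add_const_mem {k d : ℕ} (hk : 1 ≤ k) (hkd : Even (k + d)) :
    lambertSeries k d + PowerSeries.C (lambertConst k d) ∈ quasiModularForms (k + d) := by
  have sigma_eq (a n : ℕ) : (ArithmeticFunction.sigma a n : ℚ) =
      ∑ p ∈ n.divisorsAntidiagonal, (p.2 : ℚ) ^ a := by
    rw [ArithmeticFunction.sigma_apply, Nat.cast_sum,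
      Nat.sum_divisorsAntidiagonal' (fun _ x => (x : ℚ) ^ a)]
    push_cast; rfl
  have sigma_eq' (a n : ℕ) : (ArithmeticFunction.sigma a n : ℚ) =
      ∑ p ∈ n.divisorsAntidiagonal, (p.1 : ℚ) ^ a := by
    rw [ArithmeticFunction.sigma_apply, Nat.cast_sum,
      Nat.sum_divisorsAntidiagonal (fun x _ => (x : ℚ) ^ a)]
    push_cast; rfl
  rcases lt_or_ge d k with hdk | hdk
  -- Here m^d l^(k-1) = (ml)^d l^(k-d-1): the d-th derivative of G_{k-d}.
  · have hev : Even (k - d) := by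
      rw [Nat.even_sub hdk.le]; rwa [Nat.even_add] at hkd
    have hne : k - d ≠ 0 := by omega
    have hmem := Submodule.smul_mem _ (((k - d - 1)! : ℚ) / ((k - 1)! : ℚ))
      (iterate_theta_mem_quasiModularForms (eisenstein_mem_quasiModularForms hne hev) d)
    rw [show k - d + 2 * d = k + d by omega] at hmem
    convert hmem using 1
    ext n
    have h1 : ((k - 1)! : ℚ) ≠ 0 := by positivity
    have h2 : ((k - d - 1)! : ℚ) ≠ 0 := by positivity
    rw [map_add, PowerSeries.coeff_smul, coeff_iterate_theta, lambertSeries, eisenstein,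
      PowerSeries.coeff_mk, PowerSeries.coeff_mk, PowerSeries.coeff_C]
    rcases eq_or_ne n 0 with rfl | hn
    -- The constant term of the Eisenstein series survives only if no derivative is taken.
    · rcases eq_or_ne d 0 with rfl | hd
      · simp [lambertConst, h1]
      · simp [lambertConst, hd, show k ≠ 1 by omega]
    · rw [if_neg hn, if_neg hn, add_zero, sigma_eq, smul_eq_mul, Finset.sum_div, Finset.mul_sum,
        Finset.mul_sum]
      refine Finset.sum_congr rfl fun p hp => ?_
      rw [← (Nat.mem_divisorsAntidiagonal.1 hp).1]
      have h3 : (p.2 : ℚ) ^ (k - 1) = (p.2 : ℚ) ^ d * (p.2 : ℚ) ^ (k - d - 1) := by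
        rw [← pow_add]; congr 1; omega
      rw [h3]
      push_cast
      rw [mul_pow]
      field_simp
  -- Here m^d l^(k-1) = (ml)^(k-1) m^(d-k+1): the (k-1)-st derivative of G_{d-k+2}, with a constant
  -- term only for k = 1.
  · have hev : Even (d - (k - 1) + 1) := by
      rw [show d - (k - 1) + 1 = k + d - 2 * (k - 1) by omega]
      rw [Nat.even_sub (by omega)]
      simp [hkd]
    have hmem := Submodule.smul_mem _ (((d - (k - 1))! : ℚ) / ((k - 1)! : ℚ))
      (iterate_theta_mem_quasiModularForms (eisenstein_mem_quasiModularForms (by omega) hev) (k - 1))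
    rw [show d - (k - 1) + 1 + 2 * (k - 1) = k + d by omega] at hmem
    convert hmem using 1
    ext n
    have h1 : ((k - 1)! : ℚ) ≠ 0 := by positivity
    have h2 : ((d - (k - 1))! : ℚ) ≠ 0 := by positivity
    rw [map_add, PowerSeries.coeff_smul, coeff_iterate_theta, lambertSeries, eisenstein,
      PowerSeries.coeff_mk, PowerSeries.coeff_mk, PowerSeries.coeff_C]
    rcases eq_or_ne n 0 with rfl | hn
    · have hd : d ≠ 0 := by omega
      rcases eq_or_ne k 1 with rfl | hk1
      · simp [lambertConst, hd]
      · simp [lambertConst, hd, hk1, show k - 1 ≠ 0 by omega]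
    · rw [if_neg hn, if_neg hn, add_zero, sigma_eq', smul_eq_mul, Finset.sum_div, Finset.mul_sum,
        Finset.mul_sum, Nat.add_sub_cancel]
      refine Finset.sum_congr rfl fun p hp => ?_
      rw [← (Nat.mem_divisorsAntidiagonal.1 hp).1]
      have h3 : (p.1 : ℚ) ^ d = (p.1 : ℚ) ^ (k - 1) * (p.1 : ℚ) ^ (d - (k - 1)) := by
        rw [← pow_add]; congr 1; omega
      rw [h3]
      push_cast
      rw [mul_pow]
      field_simp

end
end CombEis

namespace CombEis
noncomputable section

/-! ### Logarithmic derivatives of power series -/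

/-- `F` has constant term one and logarithmic derivative `T F' / F = C`. -/
def HasLogDeriv {S : Type*} [CommRing S] (F C : PowerSeries S) : Prop :=
  PowerSeries.constantCoeff F = 1 ∧ theta F = F * C

section LogDeriv

variable {S : Type*} [CommRing S]

theorem HasLogDeriv.one : HasLogDeriv (1 : PowerSeries S) 0 := by
  refine ⟨by simp, ?_⟩
  ext n
  by_cases h : n = 0 <;> simp [theta, PowerSeries.coeff_one, h]

theorem HasLogDeriv.mul {F G C D : PowerSeries S} (hF : HasLogDeriv F C) (hG : HasLogDeriv G D) :
    HasLogDeriv (F * G) (C + D) := by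
  refine ⟨by rw [map_mul, hF.1, hG.1, one_mul], ?_⟩
  rw [theta_mul, hF.2, hG.2]
  ring

theorem HasLogDeriv.prod {ι : Type*} (s : Finset ι) {F C : ι → PowerSeries S}
    (h : ∀ i ∈ s, HasLogDeriv (F i) (C i)) : HasLogDeriv (∏ i ∈ s, F i) (∑ i ∈ s, C i) := by
  classical
  induction s using Finset.induction_on with
  | empty => simpa using HasLogDeriv.one
  | insert a s ha ih =>
    rw [Finset.prod_insert ha, Finset.sum_insert ha]
    exact (h a (Finset.mem_insert_self a s)).mul
      (ih fun i hi => h i (Finset.mem_insert_of_mem hi))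

theorem HasLogDeriv.map {R : Type*} [CommRing R] (f : S →+* R) {F C : PowerSeries S}
    (h : HasLogDeriv F C) : HasLogDeriv (PowerSeries.map f F) (PowerSeries.map f C) := by
  refine ⟨by simp [← PowerSeries.coeff_zero_eq_constantCoeff_apply, h.1], ?_⟩
  rw [← map_mul, ← h.2]
  ext n
  simp [theta]

theorem HasLogDeriv.coeff_eq {F C : PowerSeries S} (h : HasLogDeriv F C) (n : ℕ) :
    (n : S) * PowerSeries.coeff n F =
      ∑ p ∈ Finset.HasAntidiagonal.antidiagonal n,
        PowerSeries.coeff p.1 F * PowerSeries.coeff p.2 C := by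
  rw [← PowerSeries.coeff_mul, ← h.2, theta, PowerSeries.coeff_mk]

/-- Series whose logarithmic derivatives agree modulo an ideal agree modulo that ideal. -/
theorem HasLogDeriv.sub_mem [Algebra ℚ S] (I : Ideal S) {F G C D : PowerSeries S}
    (hF : HasLogDeriv F C) (hG : HasLogDeriv G D)
    (hC : PowerSeries.constantCoeff C = 0) (hD : PowerSeries.constantCoeff D = 0)
    (h : ∀ n, PowerSeries.coeff n C - PowerSeries.coeff n D ∈ I) (n : ℕ) :
    PowerSeries.coeff n F - PowerSeries.coeff n G ∈ I := by
  induction n using Nat.strong_induction_on with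
  | _ n ih =>
  rcases eq_or_ne n 0 with rfl | hn
  · rw [PowerSeries.coeff_zero_eq_constantCoeff_apply,
      PowerSeries.coeff_zero_eq_constantCoeff_apply,
      hF.1, hG.1, sub_self]
    exact I.zero_mem
  have key : (n : S) * (PowerSeries.coeff n F - PowerSeries.coeff n G) ∈ I := by
    rw [mul_sub, hF.coeff_eq, hG.coeff_eq, ← Finset.sum_sub_distrib]
    refine I.sum_mem fun p hp => ?_
    rcases eq_or_ne p.2 0 with h2 | h2
    · rw [h2, PowerSeries.coeff_zero_eq_constantCoeff_apply,
        PowerSeries.coeff_zero_eq_constantCoeff_apply, hC, hD]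
      simp
    · have hlt : p.1 < n := by
        have := Finset.HasAntidiagonal.mem_antidiagonal.1 hp
        omega
      have := I.add_mem (I.mul_mem_right (PowerSeries.coeff p.2 C) (ih p.1 hlt))
        (I.mul_mem_left (PowerSeries.coeff p.1 G) (h p.2))
      convert this using 1
      ring
  have h1 := I.mul_mem_left (algebraMap ℚ S ((n : ℚ)⁻¹)) key
  rwa [← mul_assoc, ← map_natCast (algebraMap ℚ S) n, ← map_mul,
    inv_mul_cancel₀ (by exact_mod_cast hn), map_one, one_mul] at h1

theorem HasLogDeriv.unique [Algebra ℚ S] {F G C : PowerSeries S}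
    (hF : HasLogDeriv F C) (hG : HasLogDeriv G C) (hC : PowerSeries.constantCoeff C = 0) :
    F = G := by
  ext n
  have := HasLogDeriv.sub_mem ⊥ hF hG hC hC (fun n => by simp) n
  rwa [Ideal.mem_bot, sub_eq_zero] at this

/-- The coefficients of the solution of `T F' = F C`. -/
def logDerivCoeff [Algebra ℚ S] (C : PowerSeries S) : ℕ → S
  | 0 => 1
  | n + 1 => algebraMap ℚ S ((n + 1 : ℚ)⁻¹) *
      ∑ i : Fin (n + 1), logDerivCoeff C i * PowerSeries.coeff (n + 1 - i) C

/-- Comparing coefficients of T^n in T F' = F C determines n times the n-th coefficient of F from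
the earlier ones, since `C` has no constant term. -/
theorem exists_hasLogDeriv [Algebra ℚ S] (C : PowerSeries S)
    (hC : PowerSeries.constantCoeff C = 0) : ∃ F, HasLogDeriv F C := by
  refine ⟨PowerSeries.mk (logDerivCoeff C), ?_, ?_⟩
  · rw [← PowerSeries.coeff_zero_eq_constantCoeff_apply, PowerSeries.coeff_mk, logDerivCoeff]
  · ext n
    rw [theta, PowerSeries.coeff_mk, PowerSeries.coeff_mul,
      Finset.Nat.sum_antidiagonal_eq_sum_range_succ_mk]
    rcases n with _ | n
    · simp [hC]
    · rw [Finset.sum_range_succ, PowerSeries.coeff_mk, logDerivCoeff, Finset.sum_range]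
      have : ((n + 1 : ℕ) : S) = algebraMap ℚ S (n + 1 : ℚ) := by simp
      rw [this, ← mul_assoc, ← map_mul, mul_inv_cancel₀ (by positivity), map_one, one_mul]
      simp [hC]

/-- The series `∑_{n ≥ 1} (-1)^(n-1) c n T^n`. -/
def altSeries (c : ℕ → S) : PowerSeries S :=
  PowerSeries.mk fun n => if n = 0 then 0 else (-1) ^ (n - 1) * c n

theorem constantCoeff_altSeries (c : ℕ → S) : PowerSeries.constantCoeff (altSeries c) = 0 := by
  simp [altSeries, ← PowerSeries.coeff_zero_eq_constantCoeff_apply]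

theorem altSeries_add (c c' : ℕ → S) : altSeries c + altSeries c' = altSeries (c + c') := by
  ext n
  by_cases h : n = 0 <;> simp [altSeries, h, mul_add]

theorem altSeries_sum {ι : Type*} (s : Finset ι) (c : ι → ℕ → S) :
    ∑ i ∈ s, altSeries (c i) = altSeries (∑ i ∈ s, c i) := by
  ext n
  by_cases h : n = 0 <;> simp [altSeries, h, Finset.mul_sum]

theorem map_altSeries {R : Type*} [CommRing R] (f : S →+* R) (c : ℕ → S) :
    PowerSeries.map f (altSeries c) = altSeries fun n => f (c n) := by
  ext n
  by_cases h : n = 0 <;> simp [altSeries, h]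

end LogDeriv

/-! ### Sums over words -/

section Words

variable {L S : Type*} [CommRing S]

/-- The sum of `f w ∏ ρ (w i)` over all words `w` of length `n` in the letters in `s`. -/
def wordSum (s : Finset L) (ρ : L → S) : ℕ → (List L → S) → S
  | 0, f => f []
  | n + 1, f => ∑ a ∈ s, ρ a * wordSum s ρ n fun w => f (a :: w)

/-- The generating series of the sums over the words of fixed length. -/
def wordSeries (s : Finset L) (ρ : L → S) (f : List L → S) : PowerSeries S :=
  PowerSeries.mk fun n => wordSum s ρ n f

/-- The convolution product for the deconcatenation of words. -/
def deconc (f g : List L → S) (w : List L) : S :=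
  ∑ j ∈ Finset.range (w.length + 1), f (w.take j) * g (w.drop j)

variable (s : Finset L) (ρ : L → S)

theorem wordSum_add (n : ℕ) (f g : List L → S) :
    wordSum s ρ n (fun w => f w + g w) = wordSum s ρ n f + wordSum s ρ n g := by
  induction n generalizing f g with
  | zero => rfl
  | succ n ih => simp only [wordSum, ih, mul_add, Finset.sum_add_distrib]

theorem wordSum_mul_left (n : ℕ) (c : S) (f : List L → S) :
    wordSum s ρ n (fun w => c * f w) = c * wordSum s ρ n f := by
  induction n generalizing f with
  | zero => rfl
  | succ n ih => simp only [wordSum, ih, Finset.mul_sum, mul_left_comm]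

theorem wordSum_congr (n : ℕ) {f g : List L → S} (h : ∀ w, w.length = n → f w = g w) :
    wordSum s ρ n f = wordSum s ρ n g := by
  induction n generalizing f g with
  | zero => exact h [] rfl
  | succ n ih =>
    simp only [wordSum]
    exact Finset.sum_congr rfl fun a _ => by rw [ih fun w hw => h (a :: w) (by simp [hw])]

theorem deconc_cons (f g : List L → S) (a : L) (w : List L) :
    deconc f g (a :: w) = f [] * g (a :: w) + deconc (fun v => f (a :: v)) g w := by
  rw [deconc, List.length_cons, Finset.sum_range_succ', add_comm]
  simp [deconc]

/-- The weights are multiplicative, so cutting each word of length n into a prefix and a suffix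
gives a Cauchy product. -/
theorem wordSeries_deconc (f g : List L → S) :
    wordSeries s ρ (deconc f g) = wordSeries s ρ f * wordSeries s ρ g := by
  ext n
  rw [PowerSeries.coeff_mul, Finset.Nat.sum_antidiagonal_eq_sum_range_succ_mk]
  simp only [wordSeries, PowerSeries.coeff_mk]
  induction n generalizing f with
  | zero => simp [wordSum, deconc]
  | succ n ih =>
    rw [Finset.sum_range_succ']
    simp only [wordSum, deconc_cons, wordSum_add, wordSum_mul_left, mul_add, ih,
      Finset.sum_add_distrib, Nat.sub_zero, Nat.add_sub_add_right]
    rw [add_comm, Finset.sum_congr rfl fun a _ => Finset.mul_sum _ _ _, Finset.sum_comm]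
    congr 1
    · exact Finset.sum_congr rfl fun j _ => by
        rw [Finset.sum_mul]; exact Finset.sum_congr rfl fun a _ => by ring
    · rw [Finset.mul_sum]
      exact Finset.sum_congr rfl fun a _ => by ring

/-- `letterSum s ρ n g` is the sum of `ρ a_0 ⋯ ρ a_n g (a_0 + ⋯ + a_n)`. -/
def letterSum [Add L] : ℕ → (L → S) → S
  | 0, g => ∑ a ∈ s, ρ a * g a
  | n + 1, g => ∑ b ∈ s, ρ b * letterSum n fun a => g (a + b)

theorem letterSum_add [Add L] (n : ℕ) (f g : L → S) :
    letterSum s ρ n (fun a => f a + g a) = letterSum s ρ n f + letterSum s ρ n g := by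
  induction n generalizing f g with
  | zero => simp only [letterSum, mul_add, Finset.sum_add_distrib]
  | succ n ih => simp only [letterSum, ih, mul_add, Finset.sum_add_distrib]

theorem letterSum_mul_left [Add L] (n : ℕ) (c : S) (f : L → S) :
    letterSum s ρ n (fun a => c * f a) = c * letterSum s ρ n f := by
  induction n generalizing f with
  | zero => simp only [letterSum, Finset.mul_sum, mul_left_comm]
  | succ n ih => simp only [letterSum, ih, Finset.mul_sum, mul_left_comm]

theorem letterSum_sum [Add L] {ι : Type*} (t : Finset ι) (n : ℕ) (c : ι → S) (f : ι → L → S) :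
    letterSum s ρ n (fun a => ∑ i ∈ t, c i * f i a) = ∑ i ∈ t, c i * letterSum s ρ n (f i) := by
  classical
  induction t using Finset.induction_on with
  | empty => simpa using letterSum_mul_left s ρ n 0 (fun _ => 0)
  | insert i t hi ih =>
    simp only [Finset.sum_insert hi, letterSum_add, letterSum_mul_left, ih]

/-- The sum over all insertions of a letter into words of length `n`. -/
def insertSum (l : (L → S) → S) : ℕ → (List L → S) → S
  | 0, f => l fun c => f [c]
  | n + 1, f => l (fun c => wordSum s ρ (n + 1) fun w => f (c :: w)) +
      ∑ a ∈ s, ρ a * insertSum l n fun w => f (a :: w)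

/-- The sum over all ways of adding a letter to one of the letters of words of length `n`. -/
def mergeSum [Add L] (l : (L → S) → S) : ℕ → (List L → S) → S
  | 0, _ => 0
  | n + 1, f => l (fun c => ∑ b ∈ s, ρ b * wordSum s ρ n fun w => f ((c + b) :: w)) +
      ∑ b ∈ s, ρ b * mergeSum l n fun w => f (b :: w)

/-- A word of length n + 1 arises once for each position at which the inserted letter may stand. -/
theorem insertSum_letterSum_zero [Add L] (n : ℕ) (f : List L → S) :
    insertSum s ρ (letterSum s ρ 0) n f = (n + 1) * wordSum s ρ (n + 1) f := by
  induction n generalizing f with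
  | zero => simp [insertSum, letterSum, wordSum]
  | succ n ih =>
    rw [insertSum, letterSum, wordSum]
    simp only [ih, Finset.mul_sum, ← Finset.sum_add_distrib]
    exact Finset.sum_congr rfl fun a _ => by push_cast; ring

/-- Adding a_0 + ⋯ + a_m to a letter b of a word is the same as inserting a_0 + ⋯ + a_m + b into the
word without b. This is what makes the sums in Newton's identities telescope. -/
theorem mergeSum_letterSum [Add L] (m n : ℕ) (f : List L → S) :
    mergeSum s ρ (letterSum s ρ m) (n + 1) f = insertSum s ρ (letterSum s ρ (m + 1)) n f := by
  induction n generalizing f with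
  | zero =>
    rw [mergeSum, letterSum_sum, insertSum]
    simp [letterSum, mergeSum, wordSum]
  | succ n ih =>
    rw [mergeSum, letterSum_sum, insertSum]
    simp only [ih]
    rfl

variable [Algebra ℚ S]

theorem linearCombination_shuffle_nil (dia : L → L → (L →₀ ℚ)) (f : List L → S) (a : L) :
    Finsupp.linearCombination ℚ f (quasiShuffle dia [a] []) = f [a] := by
  simp [quasiShuffle]

theorem linearCombination_shuffle_cons (f : List L → S) (a b : L) (w : List L) :
    Finsupp.linearCombination ℚ f (quasiShuffle (fun _ _ => 0) [a] (b :: w)) =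
      f (a :: b :: w) +
        Finsupp.linearCombination ℚ (fun v => f (b :: v)) (quasiShuffle (fun _ _ => 0) [a] w) := by
  rw [quasiShuffle]
  simp [quasiShuffle, Finsupp.linearCombination_mapDomain]
  rfl

theorem linearCombination_stuffle_cons [Add L] (f : List L → S) (a b : L) (w : List L) :
    Finsupp.linearCombination ℚ f
        (quasiShuffle (fun i j => Finsupp.single (i + j) 1) [a] (b :: w)) =
      f (a :: b :: w) + Finsupp.linearCombination ℚ (fun v => f (b :: v))
        (quasiShuffle (fun i j => Finsupp.single (i + j) 1) [a] w) + f ((a + b) :: w) := by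
  rw [quasiShuffle]
  simp [quasiShuffle, Finsupp.linearCombination_mapDomain]
  rfl

/-- Shuffling a single letter into a word runs over its insertions; the stuffle product below adds
the mergers with one of the letters. -/
theorem letterSum_shuffle [Add L] (n : ℕ) (m : ℕ) (f : List L → S) :
    letterSum s ρ m (fun a => wordSum s ρ n fun w =>
      Finsupp.linearCombination ℚ f (quasiShuffle (fun _ _ => 0) [a] w)) =
      insertSum s ρ (letterSum s ρ m) n f := by
  induction n generalizing f with
  | zero => simp only [wordSum, linearCombination_shuffle_nil, insertSum]
  | succ n ih =>
    simp only [wordSum, linearCombination_shuffle_cons, wordSum_add, mul_add,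
      Finset.sum_add_distrib, letterSum_add, insertSum]
    rw [letterSum_sum s ρ s m ρ fun b a => wordSum s ρ n fun w =>
      Finsupp.linearCombination ℚ (fun v => f (b :: v)) (quasiShuffle (fun _ _ => 0) [a] w)]
    simp only [ih]

theorem letterSum_stuffle [Add L] (n : ℕ) (m : ℕ) (f : List L → S) :
    letterSum s ρ m (fun a => wordSum s ρ n fun w => Finsupp.linearCombination ℚ f
      (quasiShuffle (fun i j => Finsupp.single (i + j) 1) [a] w)) =
      insertSum s ρ (letterSum s ρ m) n f + mergeSum s ρ (letterSum s ρ m) n f := by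
  induction n generalizing f with
  | zero => simp only [wordSum, linearCombination_shuffle_nil, insertSum, mergeSum, add_zero]
  | succ n ih =>
    simp only [wordSum, linearCombination_stuffle_cons, wordSum_add, mul_add,
      Finset.sum_add_distrib, letterSum_add, insertSum, mergeSum]
    rw [letterSum_sum s ρ s m ρ fun b a => wordSum s ρ n fun w =>
      Finsupp.linearCombination ℚ (fun v => f (b :: v))
        (quasiShuffle (fun i j => Finsupp.single (i + j) 1) [a] w)]
    simp only [ih, mul_add, Finset.sum_add_distrib]
    ring

/-- Newton's identities for a character of the shuffle algebra. -/
theorem hasLogDeriv_wordSeries_shuffle [Add L] (f : List L → S) (h0 : f [] = 1)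
    (h : ∀ a w, Finsupp.linearCombination ℚ f (quasiShuffle (fun _ _ => 0) [a] w) = f [a] * f w) :
    HasLogDeriv (wordSeries s ρ f)
      (altSeries fun n => if n = 1 then ∑ a ∈ s, ρ a * f [a] else 0) := by
  refine ⟨by simp [wordSeries, wordSum, h0, ← PowerSeries.coeff_zero_eq_constantCoeff_apply], ?_⟩
  have hC : (altSeries fun n => if n = 1 then ∑ a ∈ s, ρ a * f [a] else 0) =
      PowerSeries.X * PowerSeries.C (∑ a ∈ s, ρ a * f [a]) := by
    ext n
    rcases n with _ | _ | n <;> simp [altSeries, PowerSeries.coeff_succ_X_mul, PowerSeries.coeff_C]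
  rw [hC, mul_left_comm]
  ext n
  rcases n with _ | n
  · simp [theta]
  rw [PowerSeries.coeff_succ_X_mul, PowerSeries.coeff_mul_C, theta, PowerSeries.coeff_mk,
    wordSeries, PowerSeries.coeff_mk, PowerSeries.coeff_mk]
  have h1 := letterSum_shuffle s ρ n 0 f
  rw [insertSum_letterSum_zero] at h1
  simp only [h, wordSum_mul_left, letterSum] at h1
  push_cast
  rw [← h1, Finset.mul_sum]
  exact Finset.sum_congr rfl fun a _ => by ring

/-- Newton's identities for a character of the stuffle algebra. -/
theorem hasLogDeriv_wordSeries_stuffle [Add L] (f : List L → S) (h0 : f [] = 1)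
    (h : ∀ a w, Finsupp.linearCombination ℚ f
      (quasiShuffle (fun i j => Finsupp.single (i + j) 1) [a] w) = f [a] * f w) :
    HasLogDeriv (wordSeries s ρ f)
      (altSeries fun n => letterSum s ρ (n - 1) fun a => f [a]) := by
  refine ⟨by simp [wordSeries, wordSum, h0, ← PowerSeries.coeff_zero_eq_constantCoeff_apply], ?_⟩
  have h1 (m n : ℕ) : letterSum s ρ m (fun a => f [a]) * wordSum s ρ n f =
      insertSum s ρ (letterSum s ρ m) n f + mergeSum s ρ (letterSum s ρ m) n f := by
    rw [← letterSum_stuffle]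
    simp only [h, wordSum_mul_left]
    rw [mul_comm, ← letterSum_mul_left]
    simp only [mul_comm]
  -- By `h1` each product is an insertion term plus a merging term, and by `mergeSum_letterSum` the
  -- merging term cancels the insertion term of the next summand. The case m = 0 is Newton's
  -- identity.
  have h2 (n : ℕ) : ∀ m, ∑ j ∈ Finset.range (n + 1), (-1) ^ j *
      letterSum s ρ (j + m) (fun a => f [a]) * wordSum s ρ (n - j) f =
      insertSum s ρ (letterSum s ρ m) n f := by
    induction n with
    | zero =>
      intro m
      have := h1 m 0
      simpa [mergeSum] using this
    | succ n ih =>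
      intro m
      rw [Finset.sum_range_succ']
      have := ih (m + 1)
      rw [← mergeSum_letterSum] at this
      have h3 : ∑ j ∈ Finset.range (n + 1), (-1) ^ (j + 1) *
          letterSum s ρ (j + 1 + m) (fun a => f [a]) * wordSum s ρ (n + 1 - (j + 1)) f =
          - mergeSum s ρ (letterSum s ρ m) (n + 1) f := by
        rw [← this, ← Finset.sum_neg_distrib]
        refine Finset.sum_congr rfl fun j _ => ?_
        rw [Nat.add_sub_add_right, show j + 1 + m = j + (m + 1) by ring]
        ring
      rw [h3]
      have := h1 m (n + 1)
      simp only [pow_zero, one_mul, zero_add, Nat.sub_zero]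
      rw [this]; ring
  ext n
  rcases n with _ | n
  · simp [theta, constantCoeff_altSeries]
  rw [PowerSeries.coeff_mul, Finset.Nat.sum_antidiagonal_eq_sum_range_succ_mk,
    Finset.sum_range_succ, theta, PowerSeries.coeff_mk]
  have h3 := h2 n 0
  rw [insertSum_letterSum_zero] at h3
  simp only [wordSeries, PowerSeries.coeff_mk, altSeries]
  push_cast
  rw [← h3, ← Finset.sum_range_reflect, Nat.sub_self, if_pos rfl, mul_zero, add_zero]
  refine Finset.sum_congr rfl fun j hj => ?_
  have hj' := Finset.mem_range.1 hj
  rw [if_neg (by omega), show n + 1 - j - 1 = n + 1 - 1 - j by omega, add_zero,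
    show n - (n + 1 - 1 - j) = j by omega]
  ring

end Words

/-! ### A binomial evaluation of Todd type -/

theorem constantCoeff_rescale_exp (c : ℂ) :
    PowerSeries.constantCoeff (PowerSeries.rescale c (PowerSeries.exp ℂ)) = 1 := by
  rw [← PowerSeries.coeff_zero_eq_constantCoeff_apply, PowerSeries.coeff_rescale]
  simp

theorem theta_pow {A : Type*} [CommRing A] (f : PowerSeries A) (n : ℕ) :
    theta (f ^ n) = n * f ^ (n - 1) * theta f := by
  induction n with
  | zero => simpa using (HasLogDeriv.one (S := A)).2
  | succ n ih =>
    rw [pow_succ, theta_mul, ih]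
    rcases n with _ | n
    · simp
    · simp only [Nat.add_sub_cancel, pow_succ]
      push_cast
      ring

theorem theta_exp : theta (PowerSeries.exp ℂ) = PowerSeries.X * PowerSeries.exp ℂ := by
  ext n
  rcases n with _ | n
  · simp [theta]
  · rw [PowerSeries.coeff_succ_X_mul]
    simp [theta, Nat.factorial_succ]
    field_simp

theorem theta_X {A : Type*} [CommRing A] : theta (PowerSeries.X : PowerSeries A) =
    PowerSeries.X := by
  ext n
  by_cases h : n = 1 <;> simp [theta, PowerSeries.coeff_X, h]

theorem theta_one {A : Type*} [CommRing A] : theta (1 : PowerSeries A) = 0 := by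
  simpa using (HasLogDeriv.one (S := A)).2

theorem theta_sub {A : Type*} [CommRing A] (f g : PowerSeries A) :
    theta (f - g) = theta f - theta g := by
  ext n; simp [theta, mul_sub]

theorem exp_sub_one_ne_zero : PowerSeries.exp ℂ - 1 ≠ 0 := by
  intro h
  have := congrArg (PowerSeries.coeff 1) h
  simp [PowerSeries.coeff_one] at this

theorem bernoulli'PowerSeries_eq :
    bernoulli'PowerSeries ℂ = bernoulliPowerSeries ℂ * PowerSeries.exp ℂ := by
  refine mul_right_cancel₀ exp_sub_one_ne_zero ?_
  rw [bernoulli'PowerSeries_mul_exp_sub_one, mul_right_comm, bernoulliPowerSeries_mul_exp_sub_one]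

theorem theta_bernoulliPowerSeries :
    theta (bernoulliPowerSeries ℂ) =
      bernoulliPowerSeries ℂ - bernoulliPowerSeries ℂ ^ 2 * PowerSeries.exp ℂ := by
  have h := bernoulliPowerSeries_mul_exp_sub_one ℂ
  have h1 := congrArg theta h
  rw [theta_mul, theta_sub, theta_one, theta_exp, theta_X, sub_zero] at h1
  refine mul_left_cancel₀ (PowerSeries.X_ne_zero (R := ℂ)) ?_
  linear_combination bernoulliPowerSeries ℂ * h1 - theta (bernoulliPowerSeries ℂ) * h

/-- This is the residue of e^{(N+1)Z}/(e^Z - 1)^(m+1). With b(Z) = Z/(e^Z - 1), the relation Z =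
b(Z)(e^Z - 1) turns the step in N into Pascal's rule. For N = 0 and m > 0 the coefficient vanishes,
which is read off from Z d/dZ of a power of b(Z): this operator multiplies the coefficient of Z^m by
m. -/
theorem coeff_bernoulliPowerSeries_pow_mul_exp_pow (m N : ℕ) :
    PowerSeries.coeff m (bernoulliPowerSeries ℂ ^ (m + 1) * PowerSeries.exp ℂ ^ (N + 1)) =
      N.choose m := by
  induction N generalizing m with
  | zero =>
    rcases m with _ | m
    · simp [bernoulliPowerSeries]
    · have h := congrArg (PowerSeries.coeff (m + 1)) (theta_pow (bernoulliPowerSeries ℂ) (m + 1))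
      rw [theta_bernoulliPowerSeries, theta, PowerSeries.coeff_mk, Nat.add_sub_cancel,
        show ((m + 1 : ℕ) : PowerSeries ℂ) = PowerSeries.C ((m + 1 : ℕ) : ℂ) by simp, mul_assoc,
        PowerSeries.coeff_C_mul, mul_sub, map_sub] at h
      have h2 := mul_left_cancel₀ (by exact_mod_cast Nat.succ_ne_zero m) h
      rw [← pow_succ, eq_comm, sub_eq_self, ← mul_assoc, ← pow_add] at h2
      simpa using h2
  | succ N ih =>
    rcases m with _ | m
    · simp [bernoulliPowerSeries]
    · have h : bernoulliPowerSeries ℂ ^ (m + 1 + 1) * PowerSeries.exp ℂ ^ (N + 1 + 1) =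
          bernoulliPowerSeries ℂ ^ (m + 1 + 1) * PowerSeries.exp ℂ ^ (N + 1) +
          PowerSeries.X * (bernoulliPowerSeries ℂ ^ (m + 1) * PowerSeries.exp ℂ ^ (N + 1)) := by
        rw [← bernoulliPowerSeries_mul_exp_sub_one]
        ring
      rw [h, map_add, ih, PowerSeries.coeff_succ_X_mul, ih, Nat.choose_succ_succ]
      push_cast
      ring

/-! ### Taylor expansion of a power series -/

/-- The expansion of `f (X + c Y)` as a power series in `Y`. -/
def taylorSeries (c : ℂ) (f : PowerSeries ℂ) : PowerSeries (PowerSeries ℂ) :=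
  PowerSeries.mk fun j =>
    PowerSeries.C (c ^ j / (j ! : ℂ)) * (PowerSeries.derivative ℂ)^[j] f

theorem theta_taylorSeries (c : ℂ) (f : PowerSeries ℂ) :
    theta (taylorSeries c f) =
      PowerSeries.X * (PowerSeries.C (PowerSeries.C c) *
        taylorSeries c (PowerSeries.derivative ℂ f)) := by
  ext1 n
  rcases n with _ | n
  · simp [theta]
  · rw [PowerSeries.coeff_succ_X_mul, PowerSeries.coeff_C_mul, theta, PowerSeries.coeff_mk,
      taylorSeries, taylorSeries, PowerSeries.coeff_mk, PowerSeries.coeff_mk,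
      Function.iterate_succ_apply, ← mul_assoc, ← mul_assoc, ← map_mul,
      ← map_natCast PowerSeries.C, ← map_mul]
    congr 2
    rw [Nat.factorial_succ]
    push_cast
    field_simp
    ring

/-- Y d/dY acts on the expansion of f(X + cY) through f', so the Leibniz rule for f' gives the
coefficient of Y^(n+1) from those of Y^n. -/
theorem taylorSeries_mul (c : ℂ) (f g : PowerSeries ℂ) :
    taylorSeries c (f * g) = taylorSeries c f * taylorSeries c g := by
  ext1 n
  induction n generalizing f g with
  | zero => simp [taylorSeries]
  | succ n ih =>
    have h (F : PowerSeries (PowerSeries ℂ)) : ((n + 1 : ℕ) : PowerSeries ℂ) *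
        PowerSeries.coeff (n + 1) F = PowerSeries.coeff (n + 1) (theta F) := by
      rw [theta, PowerSeries.coeff_mk]
    have hn : ((n + 1 : ℕ) : PowerSeries ℂ) ≠ 0 := by
      rw [← map_natCast PowerSeries.C, ne_eq, map_eq_zero_iff _ PowerSeries.C_injective]
      exact_mod_cast Nat.succ_ne_zero n
    refine mul_left_cancel₀ hn ?_
    rw [h, h, theta_mul, theta_taylorSeries, theta_taylorSeries, theta_taylorSeries,
      PowerSeries.coeff_succ_X_mul, PowerSeries.coeff_C_mul, Derivation.leibniz]
    have h2 : taylorSeries c (f • PowerSeries.derivative ℂ g + g • PowerSeries.derivative ℂ f) =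
        taylorSeries c (f * PowerSeries.derivative ℂ g) +
          taylorSeries c (g * PowerSeries.derivative ℂ f) := by
      ext1 n
      rw [taylorSeries, map_add, taylorSeries, taylorSeries, PowerSeries.coeff_mk,
        PowerSeries.coeff_mk, PowerSeries.coeff_mk, smul_eq_mul, smul_eq_mul, iterate_map_add,
        mul_add]
    rw [h2, map_add, ih, ih, ← map_add, ← PowerSeries.coeff_C_mul,
      ← PowerSeries.coeff_succ_X_mul]
    congr 1
    ring

theorem taylorSeries_X (c : ℂ) :
    taylorSeries c PowerSeries.X =
      PowerSeries.C PowerSeries.X + PowerSeries.C (PowerSeries.C c) * PowerSeries.X := by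
  ext1 n
  rcases n with _ | _ | n
  · simp [taylorSeries]
  · simp [taylorSeries, PowerSeries.coeff_C]
  · have : (PowerSeries.derivative ℂ)^[n] (0 : PowerSeries ℂ) = 0 := iterate_map_zero _ _
    simp [taylorSeries, Function.iterate_succ_apply, this]

/-- The series `(1 - e^{-X}) / X`. -/
def expQuot : PowerSeries ℂ := PowerSeries.mk fun n => (-1) ^ n / ((n + 1)! : ℂ)

/-- The series `e^{-X}`. -/
def expNeg : PowerSeries ℂ := PowerSeries.rescale (-1) (PowerSeries.exp ℂ)

theorem exp_mul_expNeg : PowerSeries.exp ℂ * expNeg = 1 := by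
  have := PowerSeries.exp_mul_exp_neg_eq_one (A := ℂ)
  exact this

theorem X_mul_expQuot : PowerSeries.X * expQuot = 1 - expNeg := by
  ext n
  rcases n with _ | n
  · simp [expNeg, constantCoeff_rescale_exp]
  · rw [PowerSeries.coeff_succ_X_mul]
    simp [expQuot, expNeg, PowerSeries.coeff_one, pow_succ, div_eq_mul_inv]

theorem bernoulli'PowerSeries_mul_expQuot : bernoulli'PowerSeries ℂ * expQuot = 1 := by
  refine mul_left_cancel₀ (PowerSeries.X_ne_zero (R := ℂ)) ?_
  have h := bernoulli'PowerSeries_mul_exp_sub_one ℂ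
  linear_combination bernoulli'PowerSeries ℂ * X_mul_expQuot + expNeg * h +
    (PowerSeries.X - bernoulli'PowerSeries ℂ) * exp_mul_expNeg

theorem derivative_expNeg : PowerSeries.derivative ℂ expNeg = -expNeg := by
  ext n
  simp [PowerSeries.coeff_derivative, expNeg, Nat.factorial_succ, pow_succ]
  field_simp

/-- The logarithmic derivative of `(1 - e^{-X}) / X`. -/
def expQuotLog : PowerSeries ℂ := PowerSeries.derivative ℂ expQuot * bernoulli'PowerSeries ℂ

theorem expQuot_mul_expQuotLog : expQuot * expQuotLog = PowerSeries.derivative ℂ expQuot := by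
  rw [expQuotLog, mul_left_comm, mul_comm expQuot, bernoulli'PowerSeries_mul_expQuot, mul_one]

theorem X_mul_expQuotLog :
    PowerSeries.X * expQuotLog = bernoulli'PowerSeries ℂ - 1 - PowerSeries.X := by
  have h := congrArg (PowerSeries.derivative ℂ) X_mul_expQuot
  rw [Derivation.leibniz, map_sub, PowerSeries.derivative_X, derivative_expNeg] at h
  simp only [smul_eq_mul, mul_one, Derivation.map_one_eq_zero] at h
  rw [expQuotLog]
  linear_combination bernoulli'PowerSeries ℂ * h -
    (1 + PowerSeries.X) * bernoulli'PowerSeries_mul_expQuot +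
    bernoulli'PowerSeries ℂ * X_mul_expQuot

/-- The sign (-1)^i costs nothing for i ≥ 1, because B_{i+1} = 0 when i is even; for i = 0 the value
1/2 - 1 = -1/2 fits the same formula. -/
theorem coeff_expQuotLog (i : ℕ) :
    PowerSeries.coeff i expQuotLog =
      (-1) ^ i * ((-(bernoulli' (i + 1) / ((i + 1)! : ℚ)) : ℚ) : ℂ) := by
  rw [← PowerSeries.coeff_succ_X_mul, X_mul_expQuotLog]
  rcases i with _ | i
  · simp [bernoulli'PowerSeries, PowerSeries.coeff_one]
    norm_num
  · simp only [bernoulli'PowerSeries, map_sub, PowerSeries.coeff_mk, PowerSeries.coeff_one,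
      PowerSeries.coeff_X]
    rcases Nat.even_or_odd i with h | h
    · rw [pow_succ, h.neg_one_pow]
      simp
    · rw [bernoulli'_eq_zero_of_odd (by grind) (by grind)]
      simp

/-- The prefactor X/(1 - e^{-X}) does not involve Y and normalises the value at Y = 0 to 1. -/
theorem hasLogDeriv_taylorSeries_expQuot (c : ℂ) :
    HasLogDeriv (PowerSeries.C (bernoulli'PowerSeries ℂ) * taylorSeries c expQuot)
      (PowerSeries.X * (PowerSeries.C (PowerSeries.C c) * taylorSeries c expQuotLog)) := by
  constructor
  · simp [taylorSeries,
      bernoulli'PowerSeries_mul_expQuot]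
  · have h : theta (PowerSeries.C (bernoulli'PowerSeries ℂ)) = 0 := by
      ext1 n
      by_cases hn : n = 0 <;> simp [theta, PowerSeries.coeff_C, hn]
    rw [theta_mul, h, zero_mul, zero_add, theta_taylorSeries, ← expQuot_mul_expQuotLog,
      taylorSeries_mul]
    ring

theorem taylorSeries_expNeg (c : ℂ) :
    taylorSeries c expNeg = PowerSeries.C expNeg *
      PowerSeries.map PowerSeries.C (PowerSeries.rescale (-c) (PowerSeries.exp ℂ)) := by
  have h (j : ℕ) : (PowerSeries.derivative ℂ)^[j] expNeg = PowerSeries.C ((-1) ^ j) * expNeg := by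
    induction j with
    | zero => simp
    | succ j ih =>
      rw [Function.iterate_succ_apply, derivative_expNeg, iterate_map_neg, ih, pow_succ]
      simp
  ext1 n
  rw [taylorSeries, PowerSeries.coeff_mk, h, PowerSeries.coeff_C_mul, PowerSeries.coeff_map,
    PowerSeries.coeff_rescale, ← mul_assoc, ← map_mul, mul_comm expNeg]
  congr 2
  rw [neg_pow c]
  simp [div_eq_mul_inv]
  ring

/-- The identity x · (1 - e^{-x})/x = 1 - e^{-x} at x = X + cY. -/
theorem taylorSeries_expQuot_mul (c : ℂ) :
    (PowerSeries.C PowerSeries.X + PowerSeries.C (PowerSeries.C c) * PowerSeries.X) *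
      taylorSeries c expQuot = 1 - PowerSeries.map PowerSeries.C
        (PowerSeries.rescale (-c) (PowerSeries.exp ℂ)) * PowerSeries.C expNeg := by
  have h1 : taylorSeries c (1 : PowerSeries ℂ) = 1 := by
    ext1 n
    rcases n with _ | n
    · simp [taylorSeries]
    · have : (PowerSeries.derivative ℂ)^[n] (0 : PowerSeries ℂ) = 0 := iterate_map_zero _ _
      simp [taylorSeries, PowerSeries.coeff_one, this]
  have h2 : taylorSeries c (1 - expNeg) = 1 - taylorSeries c expNeg := by
    rw [← h1]
    ext1 n
    simp only [taylorSeries, PowerSeries.coeff_mk, map_sub, iterate_map_sub, mul_sub]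
  rw [← taylorSeries_X, ← taylorSeries_mul, X_mul_expQuot, h2, taylorSeries_expNeg, mul_comm]

/-! ### Products over roots of unity -/

section Roots

variable {k : ℕ} (hk : k ≠ 0) {ζ : ℂ}

theorem sum_pow_primitiveRoot (hζ : IsPrimitiveRoot ζ k) (n : ℕ) :
    ∑ i ∈ Finset.range k, (ζ ^ i) ^ n = if k ∣ n then (k : ℂ) else 0 := by
  simp only [← pow_mul, mul_comm _ n]
  simp only [pow_mul]
  split_ifs with h
  · rw [(hζ.pow_eq_one_iff_dvd n).2 h]
    simp
  · have h1 : ζ ^ n - 1 ≠ 0 := fun h1 => h ((hζ.pow_eq_one_iff_dvd n).1 (sub_eq_zero.1 h1))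
    refine mul_right_cancel₀ h1 ?_
    rw [geom_sum_mul, ← pow_mul, mul_comm n, pow_mul, hζ.pow_eq_one, one_pow, sub_self, zero_mul]

variable {R : Type*} [CommRing R]

/-- The substitution `T ↦ -Y^k`. -/
def negExpand (hk : k ≠ 0) : PowerSeries R →+* PowerSeries R :=
  (PowerSeries.expand k hk : PowerSeries R →ₐ[R] PowerSeries R).toRingHom.comp
    (PowerSeries.rescale (-1))

theorem coeff_negExpand (F : PowerSeries R) (n : ℕ) :
    PowerSeries.coeff n (negExpand hk F) =
      if k ∣ n then (-1) ^ (n / k) * PowerSeries.coeff (n / k) F else 0 := by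
  simp [negExpand, PowerSeries.coeff_expand]

theorem negExpand_injective : Function.Injective (negExpand hk (R := R)) := by
  intro F G h
  ext n
  have := congrArg (PowerSeries.coeff (k * n)) h
  rw [coeff_negExpand, coeff_negExpand, if_pos (dvd_mul_right k n), if_pos (dvd_mul_right k n),
    Nat.mul_div_cancel_left _ (Nat.pos_of_ne_zero hk)] at this
  have h2 : ((-1 : R) ^ n) * (-1) ^ n = 1 := by rw [← mul_pow]; simp
  calc _ = (-1) ^ n * ((-1) ^ n * PowerSeries.coeff n F) := by rw [← mul_assoc, h2, one_mul]
    _ = _ := by rw [this, ← mul_assoc, h2, one_mul]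

theorem theta_negExpand (F : PowerSeries R) :
    theta (negExpand hk F) = (k : PowerSeries R) * negExpand hk (theta F) := by
  ext n
  rw [← map_natCast PowerSeries.C k, PowerSeries.coeff_C_mul, coeff_negExpand, theta,
    PowerSeries.coeff_mk, coeff_negExpand, theta, PowerSeries.coeff_mk]
  split_ifs with h
  · obtain ⟨m, rfl⟩ := h
    rw [Nat.mul_div_cancel_left _ (Nat.pos_of_ne_zero hk)]
    push_cast
    ring
  · simp

/-- The signs (-1)^(n-1) and (-1)^n combine to -1, which is why the substitution is -Y^k rather than
Y^k. -/
theorem negExpand_altSeries (g : ℕ → R) :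
    negExpand hk (altSeries g) = PowerSeries.mk fun n =>
      if n = 0 then 0 else if k ∣ n then -g (n / k) else 0 := by
  ext n
  rw [coeff_negExpand, altSeries, PowerSeries.coeff_mk, PowerSeries.coeff_mk]
  by_cases h : k ∣ n
  · obtain ⟨m, rfl⟩ := h
    rw [if_pos (dvd_mul_right k m), Nat.mul_div_cancel_left _ (Nat.pos_of_ne_zero hk)]
    rcases m with _ | m
    · simp
    · rw [if_neg (by simp), if_neg (by simp [hk]), if_pos (dvd_mul_right k _), Nat.add_sub_cancel,
        ← mul_assoc, ← pow_add, show m + 1 + m = 2 * m + 1 by ring, pow_succ, pow_mul]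
      simp
  · simp [h]

variable [Algebra ℂ R]

/-- The logarithmic derivative of a product over the `k`-th roots of unity. -/
theorem hasLogDeriv_prod_roots (hζ : IsPrimitiveRoot ζ k) (s : ℂ) (A : ℂ → PowerSeries R)
    (a g : ℕ → R)
    (hA : ∀ c, HasLogDeriv (A c)
      (PowerSeries.mk fun n => if n = 0 then 0 else algebraMap ℂ R (c ^ n) * a n))
    (hg : ∀ n, n ≠ 0 → g n = -(algebraMap ℂ R (s ^ (k * n)) * a (k * n))) :
    HasLogDeriv (∏ i ∈ Finset.range k, A (s * ζ ^ i))
      ((k : PowerSeries R) * negExpand hk (altSeries g)) := by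
  convert! HasLogDeriv.prod (Finset.range k) fun i _ => hA (s * ζ ^ i) using 1
  ext n
  rw [negExpand_altSeries, map_sum, ← map_natCast PowerSeries.C k, PowerSeries.coeff_C_mul]
  simp only [PowerSeries.coeff_mk]
  by_cases hn : n = 0
  · simp [hn]
  · simp only [if_neg hn, mul_pow, map_mul]
    rw [← Finset.sum_mul, ← Finset.mul_sum, ← map_sum, sum_pow_primitiveRoot hζ]
    split_ifs with h
    · obtain ⟨m, rfl⟩ := h
      rw [Nat.mul_div_cancel_left _ (Nat.pos_of_ne_zero hk), hg m (by rintro rfl; simp at hn)]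
      simp
      ring
    · simp

/-- A series is determined by its logarithmic derivative; the factor k is the chain rule for T =
-Y^k. -/
theorem negExpand_eq_of_hasLogDeriv {V P : PowerSeries R} {g : ℕ → R}
    (hV : HasLogDeriv V (altSeries g))
    (hP : HasLogDeriv P ((k : PowerSeries R) * negExpand hk (altSeries g))) :
    negExpand hk V = P := by
  let _ : Algebra ℚ R := Algebra.compHom R (algebraMap ℚ ℂ)
  refine HasLogDeriv.unique (C := (k : PowerSeries R) * negExpand hk (altSeries g)) ⟨?_, ?_⟩ hP ?_
  · rw [← PowerSeries.coeff_zero_eq_constantCoeff_apply, coeff_negExpand]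
    simp [hV.1]
  · rw [theta_negExpand, hV.2, map_mul]
    ring
  · rw [map_mul, negExpand_altSeries, ← PowerSeries.coeff_zero_eq_constantCoeff_apply,
      ← PowerSeries.coeff_zero_eq_constantCoeff_apply, PowerSeries.coeff_mk]
    simp

/-- The way back from Y to T: the substitution is injective and k is invertible. -/
theorem hasLogDeriv_of_negExpand {U P : PowerSeries R} {g : ℕ → R}
    (hU : negExpand hk U = P)
    (hP : HasLogDeriv P ((k : PowerSeries R) * negExpand hk (altSeries g))) :
    HasLogDeriv U (altSeries g) := by
  subst hU
  constructor
  · have := hP.1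
    rw [← PowerSeries.coeff_zero_eq_constantCoeff_apply, coeff_negExpand] at this
    simpa using this
  · apply negExpand_injective hk
    have := hP.2
    rw [theta_negExpand, mul_left_comm, ← map_mul] at this
    have hk' : PowerSeries.C (algebraMap ℂ R ((k : ℂ)⁻¹)) * (k : PowerSeries R) = 1 := by
      rw [← map_natCast PowerSeries.C k, ← map_natCast (algebraMap ℂ R), ← map_mul, ← map_mul,
        inv_mul_cancel₀ (by exact_mod_cast hk)]
      simp
    have h2 := congrArg (PowerSeries.C (algebraMap ℂ R ((k : ℂ)⁻¹)) * ·) this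
    simpa only [← mul_assoc, hk', one_mul] using h2

end Roots

/-! ### The two products -/

/-- The series `∑_{l ≥ 1} l^p / p! t^l`. -/
def powerSumSeries (K : Type*) [Field K] (p : ℕ) : PowerSeries K :=
  PowerSeries.mk fun l => if l = 0 then 0 else (l : K) ^ p / (p ! : K)

/-- The series `e^{cY}` with coefficients in `K⟦X⟧`. -/
def expY {K : Type*} [Field K] [CharZero K] [Algebra ℚ K] (c : K) :
    PowerSeries (PowerSeries K) :=
  PowerSeries.map PowerSeries.C (PowerSeries.rescale c (PowerSeries.exp K))

theorem coeff_expY {K : Type*} [Field K] [CharZero K] [Algebra ℚ K] (c : K) (n : ℕ) :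
    PowerSeries.coeff n (expY c) = PowerSeries.C (c ^ n / (n ! : K)) := by
  simp [expY, div_eq_mul_inv]

theorem theta_expY {K : Type*} [Field K] [CharZero K] [Algebra ℚ K] (c : K) :
    theta (expY c) = PowerSeries.C (PowerSeries.C c) * PowerSeries.X * expY c := by
  ext1 n
  rcases n with _ | n
  · simp [theta]
  · rw [mul_assoc, PowerSeries.coeff_C_mul, PowerSeries.coeff_succ_X_mul, theta,
      PowerSeries.coeff_mk, coeff_expY, coeff_expY, ← map_natCast PowerSeries.C, ← map_mul,
      ← map_mul, Nat.factorial_succ]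
    congr 1
    push_cast
    field_simp
    ring

/-- The series `∑_{l ≥ 1} t^l e^{lcY}`. -/
def expYSum {K : Type*} [Field K] (c : K) : PowerSeries (PowerSeries K) :=
  PowerSeries.mk fun p => PowerSeries.C (c ^ p) * powerSumSeries K p

theorem one_sub_expY_mul_expYSum {K : Type*} [Field K] [CharZero K] [Algebra ℚ K] (c : K) :
    (1 - expY c * PowerSeries.C PowerSeries.X) * expYSum c =
      expY c * PowerSeries.C PowerSeries.X := by
  -- Multiplication by t e^{cY} shifts l to l + 1 in the geometric series, by the binomial theorem
  -- for (1 + l)^p, and so loses the term l = 1.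
  have h : expY c * PowerSeries.C PowerSeries.X * expYSum c =
      expYSum c - expY c * PowerSeries.C PowerSeries.X := by
    ext p l
    rw [mul_right_comm, PowerSeries.coeff_mul_C, map_sub,
      PowerSeries.coeff_mul_C, coeff_expY, expYSum, PowerSeries.coeff_mk]
    rcases l with _ | l
    · simp [powerSumSeries]
    rw [PowerSeries.coeff_succ_mul_X, map_sub, PowerSeries.coeff_succ_mul_X,
      PowerSeries.coeff_mul, map_sum, PowerSeries.coeff_C_mul]
    simp only [coeff_expY, PowerSeries.coeff_mk, PowerSeries.coeff_C_mul, powerSumSeries]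
    rw [Finset.sum_congr rfl (g := fun x => c ^ p * (if l = 0 then 0 else
      ((l : K) ^ x.2 / (x.2 ! : K)) / (x.1 ! : K)))]
    · rcases l with _ | l
      · simp [div_eq_mul_inv]
      · rw [← Finset.mul_sum]
        simp only [Nat.succ_ne_zero, if_false, PowerSeries.coeff_C]
        rw [sub_zero]
        congr 1
        have hp : (p ! : K) ≠ 0 := by exact_mod_cast p.factorial_ne_zero
        rw [eq_div_iff hp, Finset.sum_mul]
        rw [show ((l + 1 + 1 : ℕ) : K) = 1 + (l + 1 : ℕ) by push_cast; ring,
          Finset.Nat.sum_antidiagonal_eq_sum_range_succ_mk, add_pow]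
        refine Finset.sum_congr rfl fun x hx => ?_
        have hx' : x ≤ p := by simpa [Nat.lt_succ_iff] using hx
        rw [Nat.cast_choose K hx']
        field_simp
        simp
    · intro x hx
      rw [← Finset.HasAntidiagonal.mem_antidiagonal.1 hx, pow_add]
      split_ifs <;> ring
  rw [sub_mul, one_mul, h, sub_sub_cancel]

/-- The factor 1/(1 - t) makes the value at Y = 0 equal to 1; the rest is d/dY of log(1 - t e^{cY}).
-/
theorem hasLogDeriv_one_sub_expY (c : ℂ) :
    HasLogDeriv ((1 - expY c * PowerSeries.C PowerSeries.X) *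
        PowerSeries.C (PowerSeries.invOneSubPow ℂ 1 : (PowerSeries ℂ)ˣ).val)
      (PowerSeries.mk fun n => if n = 0 then 0 else
        PowerSeries.C (c ^ n) * -powerSumSeries ℂ (n - 1)) := by
  have hC (a : PowerSeries ℂ) : theta (PowerSeries.C a) = 0 := by
    ext1 n
    by_cases hn : n = 0 <;> simp [theta, PowerSeries.coeff_C, hn]
  constructor
  · rw [map_mul, map_sub, map_mul, ← PowerSeries.coeff_zero_eq_constantCoeff_apply (expY c),
      coeff_expY]
    have := (PowerSeries.invOneSubPow ℂ 1).inv_val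
    rw [PowerSeries.invOneSubPow_inv_eq_one_sub_pow] at this
    simpa using this
  · have h1 : (PowerSeries.mk fun n => if n = 0 then 0 else
        PowerSeries.C (c ^ n) * -powerSumSeries ℂ (n - 1)) =
        -(PowerSeries.C (PowerSeries.C c) * PowerSeries.X * expYSum c) := by
      ext1 n
      rcases n with _ | n
      · simp
      · rw [PowerSeries.coeff_mk, map_neg, mul_assoc, PowerSeries.coeff_C_mul,
          PowerSeries.coeff_succ_X_mul, expYSum, PowerSeries.coeff_mk, pow_succ', map_mul]
        simp
        ring
    rw [h1, theta_mul, hC, mul_zero, add_zero, theta_sub, theta_one, theta_mul, hC, theta_expY]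
    linear_combination -(PowerSeries.C (PowerSeries.C c)) * PowerSeries.X *
      PowerSeries.C (PowerSeries.invOneSubPow ℂ 1 : (PowerSeries ℂ)ˣ).val *
      -(one_sub_expY_mul_expYSum c)

/-- The coefficients of the logarithmic derivative of `∏ (Z - ζ^i Y) (1 - e^{-Z}) / …`, a series in
`Z`: the `n`-th Taylor coefficient of `1/x - 1/(1-e^{-x})` at `-Z`, restricted to multiples of
`k`. -/
def toddCoeff (k n : ℕ) : PowerSeries ℚ :=
  PowerSeries.mk fun j => (-1) ^ j * ((n * k - 1 + j).choose j : ℚ) *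
    -(bernoulli' (n * k - 1 + j + 1) / ((n * k - 1 + j + 1)! : ℚ))

/-- The generating series `1 + ∑_r T^{r+1} ∑_{l ≥ 1} t^l [Z^{k-1}] (e^{lZ} V_r)`. -/
def residueSeries (k : ℕ) (V : PowerSeries (PowerSeries ℚ)) : PowerSeries (PowerSeries ℚ) :=
  PowerSeries.mk fun r => if r = 0 then 1 else PowerSeries.mk fun l => if l = 0 then 0 else
    PowerSeries.coeff (k - 1)
      (PowerSeries.exp ℚ ^ l * PowerSeries.coeff (r - 1) V)

theorem prod_sub_roots {k : ℕ} (hk : k ≠ 0) {ζ : ℂ} (hζ : IsPrimitiveRoot ζ k) :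
    ∏ i ∈ Finset.range k, (PowerSeries.C PowerSeries.X +
      PowerSeries.C (PowerSeries.C (-1 * ζ ^ i)) * PowerSeries.X) =
      (PowerSeries.C PowerSeries.X ^ k - PowerSeries.X ^ k : PowerSeries (PowerSeries ℂ)) := by
  have h1 : IsPrimitiveRoot ((PowerSeries.C (R := PowerSeries ℂ)) (PowerSeries.C ζ)) k :=
    (hζ.map_of_injective PowerSeries.C_injective).map_of_injective PowerSeries.C_injective
  have h2 := congrArg (Polynomial.eval (PowerSeries.C PowerSeries.X))
    (X_pow_sub_C_eq_prod h1 (Nat.pos_of_ne_zero hk)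
      (α := (PowerSeries.X : PowerSeries (PowerSeries ℂ))) rfl)
  rw [Polynomial.eval_prod] at h2
  simp only [Polynomial.eval_sub, Polynomial.eval_pow, Polynomial.eval_X, Polynomial.eval_C] at h2
  rw [h2]
  refine Finset.prod_congr rfl fun i _ => ?_
  simp only [map_mul, map_pow, map_neg, map_one]
  ring

/-- Each Y-coefficient is a polynomial of degree at most k in `a` whose coefficients do not depend
on `a`. The same numbers `δ` thus serve for a = e^{-Z}, on the Todd side, and for a = t, on the
residue side. -/
theorem exists_coeff_prod_one_sub_expY (k : ℕ) (ζ : ℂ) :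
    ∃ δ : ℕ → ℕ → ℂ, ∀ (a : PowerSeries ℂ) (p : ℕ),
      PowerSeries.coeff p (∏ i ∈ Finset.range k, (1 - expY (ζ ^ i) * PowerSeries.C a)) =
        ∑ j ∈ Finset.range (k + 1), PowerSeries.C (δ p j) * a ^ j := by
  induction k with
  | zero =>
    refine ⟨fun p _ => if p = 0 then 1 else 0, fun a p => ?_⟩
    by_cases hp : p = 0 <;> simp [PowerSeries.coeff_one, hp]
  | succ k ih =>
    obtain ⟨δ, hδ⟩ := ih
    refine ⟨fun p j => (if j = k + 1 then 0 else δ p j) - if j = 0 then 0 else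
      ∑ x ∈ Finset.HasAntidiagonal.antidiagonal p,
        δ x.1 (j - 1) * ((ζ ^ k) ^ x.2 / (x.2 ! : ℂ)), fun a p => ?_⟩
    rw [Finset.prod_range_succ, mul_sub, mul_one, map_sub, hδ, ← mul_assoc,
      PowerSeries.coeff_mul_C, PowerSeries.coeff_mul]
    simp only [map_sub, sub_mul, Finset.sum_sub_distrib]
    congr 1
    · rw [Finset.sum_range_succ _ (k + 1)]
      simp only [if_true, map_zero, zero_mul, add_zero]
      refine Finset.sum_congr rfl fun j hj => ?_
      rw [if_neg (by have := Finset.mem_range.1 hj; omega)]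
    · rw [Finset.sum_range_succ' _ (k + 1)]
      simp only [if_true, map_zero, zero_mul, add_zero, Nat.succ_ne_zero, if_false,
        Nat.add_sub_cancel, hδ, coeff_expY, map_sum, map_mul, Finset.sum_mul]
      rw [Finset.sum_comm]
      refine Finset.sum_congr rfl fun j _ => Finset.sum_congr rfl fun x _ => ?_
      ring

/-- `toddCoeff` collects the Taylor coefficients of order nk - 1 of the logarithmic derivative of (1
- e^{-x})/x, and the sum over the k-th roots of unity selects precisely these. -/
theorem negExpand_toddSeries {k : ℕ} (hk : k ≠ 0) {ζ : ℂ} (hζ : IsPrimitiveRoot ζ k)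
    {V : PowerSeries (PowerSeries ℂ)}
    (hV : HasLogDeriv V
      (altSeries fun n => PowerSeries.map (algebraMap ℚ ℂ) (toddCoeff k n))) :
    negExpand hk V = ∏ i ∈ Finset.range k,
      (PowerSeries.C (bernoulli'PowerSeries ℂ) * taylorSeries (-1 * ζ ^ i) expQuot) := by
  refine negExpand_eq_of_hasLogDeriv hk hV (hasLogDeriv_prod_roots hk hζ (-1)
    (fun c => PowerSeries.C (bernoulli'PowerSeries ℂ) * taylorSeries c expQuot)
    (fun n => PowerSeries.C (1 / ((n - 1)! : ℂ)) * (PowerSeries.derivative ℂ)^[n - 1] expQuotLog)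
    _ (fun c => ?_) fun n hn => ?_)
  · convert! hasLogDeriv_taylorSeries_expQuot c using 1
    ext1 n
    rcases n with _ | n
    · simp
    · rw [PowerSeries.coeff_mk, if_neg (by simp), PowerSeries.coeff_succ_X_mul,
        PowerSeries.coeff_C_mul, taylorSeries, PowerSeries.coeff_mk, PowerSeries.algebraMap_apply,
        ← mul_assoc, ← mul_assoc, Nat.add_sub_cancel]
      simp only [Algebra.algebraMap_self, RingHom.id_apply, ← map_mul]
      congr 2
      ring
  · obtain ⟨p, hp⟩ : ∃ p, k * n = p + 1 := Nat.exists_eq_succ_of_ne_zero (by simp [hk, hn])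
    ext j
    rw [toddCoeff, mul_comm n k, hp, Nat.add_sub_cancel, PowerSeries.coeff_map,
      PowerSeries.coeff_mk, map_neg, PowerSeries.algebraMap_apply, ← mul_assoc, ← map_mul,
      PowerSeries.coeff_C_mul, PowerSeries.coeff_iterate_derivative, coeff_expQuotLog,
      Nat.ascFactorial_eq_factorial_mul_choose, add_comm p j, Nat.choose_symm_add]
    have hp' : (p ! : ℂ) ≠ 0 := by exact_mod_cast p.factorial_ne_zero
    have h1 : ((-1 : ℂ) ^ p) * (-1) ^ p = 1 := by rw [← mul_pow]; simp
    simp only [eq_ratCast, Algebra.algebraMap_self, RingHom.id_apply]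
    push_cast
    rw [pow_succ, pow_add]
    field_simp
    linear_combination ((j + p).choose p : ℂ) * (bernoulli' (j + p + 1) : ℂ) *
      ((j + p + 1)! : ℂ)⁻¹ * h1

/-- Each linear factor Z - ζ^i Y of Z^k - Y^k clears one denominator. -/
theorem negExpand_toddSeries_mul {k : ℕ} (hk : k ≠ 0) {ζ : ℂ} (hζ : IsPrimitiveRoot ζ k)
    {V : PowerSeries (PowerSeries ℂ)}
    (hV : HasLogDeriv V
      (altSeries fun n => PowerSeries.map (algebraMap ℚ ℂ) (toddCoeff k n))) :
    (PowerSeries.C PowerSeries.X ^ k - PowerSeries.X ^ k) * negExpand hk V =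
      PowerSeries.C (bernoulli'PowerSeries ℂ) ^ k *
        ∏ i ∈ Finset.range k, (1 - expY (ζ ^ i) * PowerSeries.C expNeg) := by
  rw [negExpand_toddSeries hk hζ hV, ← prod_sub_roots hk hζ, ← Finset.prod_mul_distrib]
  have : PowerSeries.C (bernoulli'PowerSeries ℂ) ^ k =
      ∏ _i ∈ Finset.range k, (PowerSeries.C (bernoulli'PowerSeries ℂ) :
        PowerSeries (PowerSeries ℂ)) := by simp
  rw [this, ← Finset.prod_mul_distrib]
  refine Finset.prod_congr rfl fun i _ => ?_
  have := taylorSeries_expQuot_mul (-1 * ζ ^ i)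
  rw [show -(-1 * ζ ^ i) = ζ ^ i by ring] at this
  rw [expY, ← this]
  ring

/-- Apply [Z^(k-1)] [Y^p] to e^{lZ} times `negExpand_toddSeries_mul`. On the left Z^k contributes
nothing and -Y^k shifts p by k; on the right every term is a residue evaluated by
`coeff_bernoulliPowerSeries_pow_mul_exp_pow`. -/
theorem sum_coeff_prod_one_sub_expY {k : ℕ} (hk : k ≠ 0) {ζ : ℂ} (hζ : IsPrimitiveRoot ζ k)
    {V : PowerSeries (PowerSeries ℂ)}
    (hV : HasLogDeriv V
      (altSeries fun n => PowerSeries.map (algebraMap ℚ ℂ) (toddCoeff k n)))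
    {δ : ℕ → ℕ → ℂ} (hδ : ∀ (a : PowerSeries ℂ) (p : ℕ),
      PowerSeries.coeff p (∏ i ∈ Finset.range k, (1 - expY (ζ ^ i) * PowerSeries.C a)) =
        ∑ j ∈ Finset.range (k + 1), PowerSeries.C (δ p j) * a ^ j) {l : ℕ} (hl : l ≠ 0) (p : ℕ) :
    ∑ j ∈ Finset.range (k + 1), δ p j * ((l + k - 1 - j).choose (k - 1) : ℂ) =
      if k ≤ p then -PowerSeries.coeff (k - 1)
        (PowerSeries.exp ℂ ^ l * PowerSeries.coeff (p - k) (negExpand hk V)) else 0 := by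
  have h := congrArg (fun F => PowerSeries.coeff (k - 1) (PowerSeries.coeff p
    (PowerSeries.C (PowerSeries.exp ℂ ^ l) * F))) (negExpand_toddSeries_mul hk hζ hV)
  simp only [PowerSeries.coeff_C_mul, ← map_pow, hδ] at h
  rw [sub_mul, map_sub, PowerSeries.coeff_C_mul, mul_sub, map_sub, mul_left_comm,
    PowerSeries.coeff_X_pow_mul', if_neg (by omega), PowerSeries.coeff_X_pow_mul', zero_sub] at h
  rw [Finset.mul_sum, Finset.mul_sum, map_sum] at h
  have h2 : ∀ j ∈ Finset.range (k + 1), PowerSeries.coeff (k - 1) (PowerSeries.exp ℂ ^ l *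
      (bernoulli'PowerSeries ℂ ^ k * (PowerSeries.C (δ p j) * expNeg ^ j))) =
      δ p j * ((l + k - 1 - j).choose (k - 1) : ℂ) := by
    intro j hj
    have hj' : j ≤ k := by simpa [Nat.lt_succ_iff] using hj
    have h3 : PowerSeries.exp ℂ ^ l *
        (bernoulli'PowerSeries ℂ ^ k * (PowerSeries.C (δ p j) * expNeg ^ j)) =
        PowerSeries.C (δ p j) * (bernoulliPowerSeries ℂ ^ (k - 1 + 1) *
          PowerSeries.exp ℂ ^ (l + k - 1 - j + 1)) := by
      rw [bernoulli'PowerSeries_eq, Nat.sub_add_cancel (Nat.one_le_iff_ne_zero.2 hk), mul_pow]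
      have h4 : PowerSeries.exp ℂ ^ l * PowerSeries.exp ℂ ^ k =
          PowerSeries.exp ℂ ^ (l + k - 1 - j + 1) * PowerSeries.exp ℂ ^ j := by
        rw [← pow_add, ← pow_add]
        congr 1
        omega
      have h5 : PowerSeries.exp ℂ ^ j * expNeg ^ j = 1 := by
        rw [← mul_pow, exp_mul_expNeg, one_pow]
      linear_combination bernoulliPowerSeries ℂ ^ k * PowerSeries.C (δ p j) * expNeg ^ j * h4 +
        PowerSeries.C (δ p j) * bernoulliPowerSeries ℂ ^ k *
          PowerSeries.exp ℂ ^ (l + k - 1 - j + 1) * h5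
    rw [h3, PowerSeries.coeff_C_mul, coeff_bernoulliPowerSeries_pow_mul_exp_pow]
  rw [Finset.sum_congr rfl h2] at h
  rw [← h]
  split_ifs <;> simp

/-- The binomial coefficients of `sum_coeff_prod_one_sub_expY` are those of t^j/(1 - t)^k, so the
sum over j reassembles the product with t in place of e^{-Z}. -/
theorem negExpand_residueSeries {k : ℕ} (hk : k ≠ 0) {ζ : ℂ} (hζ : IsPrimitiveRoot ζ k)
    {V : PowerSeries (PowerSeries ℚ)}
    (hV : HasLogDeriv V (altSeries (toddCoeff k))) :
    negExpand hk (PowerSeries.map (PowerSeries.map (algebraMap ℚ ℂ)) (residueSeries k V)) =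
      ∏ i ∈ Finset.range k, ((1 - expY (1 * ζ ^ i) * PowerSeries.C PowerSeries.X) *
        PowerSeries.C (PowerSeries.invOneSubPow ℂ 1 : (PowerSeries ℂ)ˣ).val) := by
  obtain ⟨δ, hδ⟩ := exists_coeff_prod_one_sub_expY k ζ
  have hV' := hV.map (PowerSeries.map (algebraMap ℚ ℂ))
  rw [map_altSeries] at hV'
  have hone : PowerSeries.coeff 0 (∏ i ∈ Finset.range k,
      ((1 - expY (1 * ζ ^ i) * PowerSeries.C PowerSeries.X) *
        PowerSeries.C (PowerSeries.invOneSubPow ℂ 1 : (PowerSeries ℂ)ˣ).val)) = 1 := by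
    rw [PowerSeries.coeff_zero_eq_constantCoeff_apply]
    exact (HasLogDeriv.prod (Finset.range k) fun i _ => hasLogDeriv_one_sub_expY (1 * ζ ^ i)).1
  ext p l
  by_cases hp : p = 0
  · subst hp
    rw [hone, coeff_negExpand]
    simp [residueSeries]
  have hinv : (PowerSeries.invOneSubPow ℂ 1 : (PowerSeries ℂ)ˣ).val ^ k =
      PowerSeries.mk fun n => ((k - 1 + n).choose (k - 1) : ℂ) := by
    have := PowerSeries.mk_one_pow_eq_mk_choose_add ℂ (k - 1)
    rw [Nat.sub_add_cancel (Nat.one_le_iff_ne_zero.2 hk)] at this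
    rw [← this]
    congr 1
    ext n
    simp [PowerSeries.invOneSubPow]
  rw [Finset.prod_mul_distrib, Finset.prod_const, Finset.card_range, ← map_pow,
    PowerSeries.coeff_mul_C, hinv]
  simp only [one_mul]
  rw [hδ, Finset.sum_mul, map_sum]
  simp only [mul_assoc, PowerSeries.coeff_C_mul, PowerSeries.coeff_X_pow_mul',
    PowerSeries.coeff_mk]
  by_cases hl : l = 0
  · subst hl
    -- At a = 0 the product is 1, so `δ p 0` vanishes for p > 0.
    have h0 := congrArg (PowerSeries.coeff 0) (hδ 0 p)
    simp only [map_zero, mul_zero, sub_zero, Finset.prod_const_one, PowerSeries.coeff_one, hp,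
      if_false, map_sum, PowerSeries.coeff_C_mul] at h0
    rw [Finset.sum_range_succ', Finset.sum_eq_zero (fun j _ => by simp)] at h0
    rw [Finset.sum_range_succ', Finset.sum_eq_zero (fun j _ => by simp)]
    have h1 : δ p 0 = 0 := by simpa using h0.symm
    simp only [h1, zero_mul, add_zero]
    rw [coeff_negExpand]
    split_ifs with h
    · obtain ⟨r, rfl⟩ := h
      have hr : r ≠ 0 := by rintro rfl; simp at hp
      rw [Nat.mul_div_cancel_left _ (Nat.pos_of_ne_zero hk), ← map_one PowerSeries.C, ← map_neg,
        ← map_pow, PowerSeries.coeff_C_mul, PowerSeries.coeff_map, PowerSeries.coeff_map,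
        residueSeries, PowerSeries.coeff_mk, if_neg hr, PowerSeries.coeff_mk, if_pos rfl, map_zero,
        mul_zero]
    · simp
  · have h1 := sum_coeff_prod_one_sub_expY hk hζ hV' hδ hl p
    -- For j > l the binomial coefficient is zero; the subtraction is not truncated, since l ≥ 1 and
    -- j ≤ k.
    have h2 : ∀ j ∈ Finset.range (k + 1), δ p j * (if j ≤ l then
        (((k - 1 + (l - j)).choose (k - 1) : ℕ) : ℂ) else 0) =
        δ p j * ((l + k - 1 - j).choose (k - 1) : ℂ) := by
      intro j hj
      have hj' := Finset.mem_range.1 hj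
      split_ifs with hjl
      · rw [show k - 1 + (l - j) = l + k - 1 - j by omega]
      · rw [Nat.choose_eq_zero_of_lt (by omega)]
        simp
    rw [Finset.sum_congr rfl h2, h1, coeff_negExpand]
    by_cases h : k ∣ p
    · obtain ⟨r, rfl⟩ := h
      obtain ⟨r, rfl⟩ : ∃ s, r = s + 1 :=
        Nat.exists_eq_succ_of_ne_zero (by rintro rfl; simp at hp)
      rw [Nat.mul_div_cancel_left _ (Nat.pos_of_ne_zero hk), if_pos (dvd_mul_right k _),
        if_pos (Nat.le_mul_of_pos_right k (Nat.succ_pos r)), mul_add, mul_one,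
        Nat.add_sub_cancel, coeff_negExpand, if_pos (dvd_mul_right k _),
        Nat.mul_div_cancel_left _ (Nat.pos_of_ne_zero hk), PowerSeries.coeff_map,
        PowerSeries.coeff_map, residueSeries, PowerSeries.coeff_mk, if_neg (Nat.succ_ne_zero r),
        Nat.add_sub_cancel]
      have h3 : PowerSeries.coeff (k - 1) (PowerSeries.exp ℂ ^ l *
          PowerSeries.map (algebraMap ℚ ℂ) (PowerSeries.coeff r V)) =
          algebraMap ℚ ℂ (PowerSeries.coeff (k - 1)
            (PowerSeries.exp ℚ ^ l * PowerSeries.coeff r V)) := by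
        conv_rhs => rw [← PowerSeries.coeff_map, map_mul, map_pow, PowerSeries.map_exp]
      rcases Nat.even_or_odd r with h | h
      · rw [h.neg_one_pow, h.add_one.neg_one_pow, one_mul, h3]
        simp [hl]
      · rw [h.neg_one_pow, h.add_one.neg_one_pow, one_mul, neg_one_mul, mul_neg, map_neg, h3]
        simp [hl]
    · rw [if_neg h]
      split_ifs with hkp
      · rw [coeff_negExpand, if_neg (fun h' => h ((Nat.dvd_sub_iff_left hkp dvd_rfl).1 h'))]
        simp
      · simp

/-- The core evaluation: the residue series of the Todd series. -/
theorem hasLogDeriv_residueSeries {k : ℕ} (hk : k ≠ 0) {V : PowerSeries (PowerSeries ℚ)}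
    (hV : HasLogDeriv V (altSeries (toddCoeff k))) :
    HasLogDeriv (residueSeries k V) (altSeries fun n => powerSumSeries ℚ (n * k - 1)) := by
  have hζ := Complex.isPrimitiveRoot_exp k hk
  have h1 := hasLogDeriv_of_negExpand hk (negExpand_residueSeries hk hζ hV)
    (g := fun n => powerSumSeries ℂ (n * k - 1))
    (hasLogDeriv_prod_roots hk hζ 1 _ (fun n => -powerSumSeries ℂ (n - 1)) _
      (fun c => hasLogDeriv_one_sub_expY c) fun n _ => by simp [mul_comm])
  have h2 : (fun n => powerSumSeries ℂ (n * k - 1)) =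
      fun n => PowerSeries.map (algebraMap ℚ ℂ) (powerSumSeries ℚ (n * k - 1)) := by
    funext n
    ext l
    simp [powerSumSeries, apply_ite (algebraMap ℚ ℂ)]
  rw [h2, ← map_altSeries] at h1
  have hinj : Function.Injective (PowerSeries.map (algebraMap ℚ ℂ)) :=
    PowerSeries.map_injective _ (algebraMap ℚ ℂ).injective
  constructor
  · apply hinj
    have := h1.1
    rw [← PowerSeries.coeff_zero_eq_constantCoeff_apply, PowerSeries.coeff_map] at this
    rw [map_one, ← this, PowerSeries.coeff_zero_eq_constantCoeff_apply]
  · apply PowerSeries.map_injective _ hinj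
    rw [map_mul, ← h1.2]
    ext n
    simp [theta]

/-! ### Sums of letters with binomial weights -/

/-- The weight `c * binom (a-1) (k-1) * (-Z)^(a-k)`. -/
def binomWeight (k : ℕ+) (c : ℚ) (a : ℕ+) : PowerSeries ℚ :=
  PowerSeries.C (c * ((a - 1 : ℕ).choose (k - 1) : ℚ) * (-1) ^ ((a : ℕ) - k)) *
    PowerSeries.X ^ ((a : ℕ) - k)

/-- The coefficient of x^j in (1 - x)^(-a) (1 - x)^(-b) = (1 - x)^(-a-b). -/
theorem sum_choose_mul_choose {a b : ℕ} (ha : 0 < a) (hb : 0 < b) (j : ℕ) :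
    ∑ i ∈ Finset.range (j + 1), ((a - 1 + i).choose (a - 1) : ℚ) *
      ((b - 1 + (j - i)).choose (b - 1) : ℚ) = ((a + b - 1 + j).choose (a + b - 1) : ℚ) := by
  have h := congrArg (fun u : (PowerSeries ℚ)ˣ => PowerSeries.coeff j u.val)
    (PowerSeries.invOneSubPow_add (S := ℚ) a b)
  simp only [Units.val_mul] at h
  rw [PowerSeries.invOneSubPow_val_eq_mk_sub_one_add_choose_of_pos _ _ ha,
    PowerSeries.invOneSubPow_val_eq_mk_sub_one_add_choose_of_pos _ _ hb,
    PowerSeries.invOneSubPow_val_eq_mk_sub_one_add_choose_of_pos _ _ (by omega),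
    PowerSeries.coeff_mul, Finset.Nat.sum_antidiagonal_eq_sum_range_succ_mk] at h
  simpa using h.symm

/-- Letters below k have weight zero, and a letter k + i carries Z^i; only the letters k, …, k + j
reach the coefficient of Z^j. -/
theorem sum_coeff_binomWeight_mul (k : ℕ+) (c : ℚ) (s : Finset ℕ+) {j : ℕ}
    (hs : ∀ a : ℕ+, (k : ℕ) ≤ a → (a : ℕ) ≤ k + j → a ∈ s) (F : ℕ+ → PowerSeries ℚ) :
    PowerSeries.coeff j (∑ a ∈ s, binomWeight k c a * F a) =
      ∑ i ∈ Finset.range (j + 1), c * ((k - 1 + i : ℕ).choose (k - 1) : ℚ) * (-1) ^ i *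
        PowerSeries.coeff (j - i) (F (k + i : ℕ).toPNat') := by
  classical
  have hpos (i : ℕ) : (((k + i : ℕ).toPNat' : ℕ+) : ℕ) = k + i := by
    rw [Nat.toPNat'_coe, if_pos (by have := k.pos; omega)]
  have hinj : Function.Injective fun i : ℕ => (k + i : ℕ).toPNat' := fun i i' h => by
    have := congrArg PNat.val h
    simp only [hpos] at this
    omega
  have hsub : (Finset.range (j + 1)).image (fun i : ℕ => (k + i : ℕ).toPNat') ⊆ s := by
    intro a ha
    obtain ⟨i, hi, rfl⟩ := Finset.mem_image.1 ha
    have := Finset.mem_range.1 hi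
    exact hs _ (by rw [hpos]; omega) (by rw [hpos]; omega)
  rw [map_sum, ← Finset.sum_subset hsub, Finset.sum_image fun _ _ _ _ h => hinj h]
  · refine Finset.sum_congr rfl fun i hi => ?_
    have := Finset.mem_range.1 hi
    rw [binomWeight, hpos, mul_assoc, PowerSeries.coeff_C_mul, PowerSeries.coeff_X_pow_mul',
      Nat.add_sub_cancel_left, if_pos (by omega),
      show (k : ℕ) + i - 1 = k - 1 + i by have := k.pos; omega]
  · intro a _ ha
    rw [binomWeight, mul_assoc, PowerSeries.coeff_C_mul, PowerSeries.coeff_X_pow_mul']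
    by_cases hka : (k : ℕ) ≤ a
    · rw [if_neg, mul_zero]
      intro h
      refine ha (Finset.mem_image.2 ⟨a - k, Finset.mem_range.2 (by omega), ?_⟩)
      apply PNat.eq
      rw [hpos]
      omega
    · rw [Nat.choose_eq_zero_of_lt (by have := a.pos; omega)]
      simp

/-- The letters k + i_0, …, k + i_n with ∑ i = j all produce the same value of `g`, and their
binomial weights add up by `sum_choose_mul_choose`. Since j < k, letters below 2k suffice. -/
theorem coeff_letterSum_binomWeight (k : ℕ+) (c : ℚ) (s : Finset ℕ+)
    (hs : ∀ a : ℕ+, (k : ℕ) ≤ a → (a : ℕ) < 2 * k → a ∈ s) (n : ℕ) (g : ℕ+ → ℚ) {j : ℕ}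
    (hj : j < k) :
    PowerSeries.coeff j (letterSum s (binomWeight k c) n fun a => PowerSeries.C (g a)) =
      c ^ (n + 1) * (-1) ^ j * (((n + 1) * k - 1 + j).choose ((n + 1) * k - 1) : ℚ) *
        g ((n + 1) * k + j).toPNat' := by
  have hs' : ∀ a : ℕ+, (k : ℕ) ≤ a → (a : ℕ) ≤ k + j → a ∈ s := fun a h1 h2 =>
    hs a h1 (by omega)
  induction n generalizing g j with
  | zero =>
    rw [letterSum, sum_coeff_binomWeight_mul k c s hs', Finset.sum_eq_single j]
    · rw [Nat.sub_self, PowerSeries.coeff_C, if_pos rfl]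
      simp only [zero_add, one_mul, pow_one]
      ring
    · intro i hi hij
      have := Finset.mem_range.1 hi
      rw [PowerSeries.coeff_C, if_neg (by omega), mul_zero]
    · simp
  | succ n ih =>
    rw [letterSum, sum_coeff_binomWeight_mul k c s hs']
    have hk := k.pos
    have h1 : ∀ i ∈ Finset.range (j + 1), c * ((k - 1 + i : ℕ).choose (k - 1) : ℚ) * (-1) ^ i *
        PowerSeries.coeff (j - i) (letterSum s (binomWeight k c) n
          fun a => PowerSeries.C (g (a + (k + i : ℕ).toPNat'))) =
        (c ^ (n + 1 + 1) * (-1) ^ j * g ((n + 1 + 1) * k + j).toPNat') *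
        (((k - 1 + i : ℕ).choose (k - 1) : ℚ) *
          (((n + 1) * k - 1 + (j - i) : ℕ).choose ((n + 1) * k - 1) : ℚ)) := by
      intro i hi
      have hi' := Finset.mem_range.1 hi
      rw [ih (fun a => g (a + (k + i : ℕ).toPNat')) (by omega) (fun a h1 h2 => hs a h1 (by omega))]
      have h2 : ((n + 1) * (k : ℕ) + (j - i)).toPNat' + (k + i : ℕ).toPNat' =
          ((n + 1 + 1) * (k : ℕ) + j).toPNat' := by
        apply PNat.eq
        rw [PNat.add_coe, Nat.toPNat'_coe, Nat.toPNat'_coe, Nat.toPNat'_coe, if_pos (by positivity),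
          if_pos (by positivity), if_pos (by positivity), add_one_mul (n + 1)]
        omega
      have h3 : (-1 : ℚ) ^ j = (-1) ^ i * (-1) ^ (j - i) := by
        rw [← pow_add]
        congr 1
        omega
      rw [h2, h3]
      ring
    rw [Finset.sum_congr rfl h1, ← Finset.mul_sum,
      sum_choose_mul_choose hk (by positivity), add_one_mul (n + 1) (k : ℕ), add_comm (k : ℕ)]
    ring

/-! ### Coefficients of substitutions -/

section Subst

variable {σ τ A S : Type*} [CommRing A] [CommRing S] [Algebra A S]

theorem coeff_subst_mul {a : τ → MvPowerSeries σ S} (ha : MvPowerSeries.HasSubst a)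
    (f : MvPowerSeries τ A) (G : MvPowerSeries σ S) (e : σ →₀ ℕ) :
    MvPowerSeries.coeff e (MvPowerSeries.subst a f * G) =
      ∑ᶠ d : τ →₀ ℕ, MvPowerSeries.coeff d f •
        MvPowerSeries.coeff e ((d.prod fun t n => a t ^ n) * G) := by
  classical
  simp only [MvPowerSeries.coeff_mul, MvPowerSeries.coeff_subst ha, Finset.smul_sum]
  rw [finsum_sum_comm]
  · refine Finset.sum_congr rfl fun p _ => ?_
    rw [finsum_mul']
    · simp only [smul_mul_assoc]
    · exact MvPowerSeries.coeff_subst_finite ha f p.1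
  · intro p _
    refine (MvPowerSeries.coeff_subst_finite ha f p.1).subset fun d hd => ?_
    simp only [Function.mem_support] at hd ⊢
    intro h
    rw [← smul_mul_assoc, h, zero_mul] at hd
    exact hd rfl

/-- The universal case of two variables is the binomial theorem; substitution of `x` and `y` gives
the rest. -/
theorem subst_exp_add [Algebra ℚ S] {x y : MvPowerSeries σ S}
    (hx : MvPowerSeries.constantCoeff x = 0) (hy : MvPowerSeries.constantCoeff y = 0) :
    PowerSeries.subst (x + y) (PowerSeries.exp ℚ) =
      PowerSeries.subst x (PowerSeries.exp ℚ) * PowerSeries.subst y (PowerSeries.exp ℚ) := by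
  have h : PowerSeries.subst (MvPowerSeries.X 0 + MvPowerSeries.X 1 : MvPowerSeries (Fin 2) ℚ)
      (PowerSeries.exp ℚ) = PowerSeries.subst (MvPowerSeries.X 0) (PowerSeries.exp ℚ) *
        PowerSeries.subst (MvPowerSeries.X 1) (PowerSeries.exp ℚ) := by
    ext e
    rw [PowerSeries.coeff_subst_X_zero_add_X_one, PowerSeries.coeff_subst_X_zero_subst_mul_X_one]
    simp only [PowerSeries.coeff_exp, Algebra.algebraMap_self, RingHom.id_apply]
    rw [Nat.cast_choose ℚ (Nat.le_add_right _ _), Nat.add_sub_cancel_left]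
    have := Nat.factorial_ne_zero (e 0 + e 1)
    field_simp
  have ha : MvPowerSeries.HasSubst ![x, y] :=
    MvPowerSeries.hasSubst_of_constantCoeff_zero fun i => by fin_cases i <;> simp [hx, hy]
  have h2 := congrArg (MvPowerSeries.subst ![x, y]) h
  have h3 (z : MvPowerSeries (Fin 2) ℚ) (hz : MvPowerSeries.constantCoeff z = 0) :
      MvPowerSeries.subst ![x, y] (PowerSeries.subst z (PowerSeries.exp ℚ)) =
        PowerSeries.subst (MvPowerSeries.subst ![x, y] z) (PowerSeries.exp ℚ) :=
    MvPowerSeries.subst_comp_subst_apply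
      (PowerSeries.HasSubst.const (PowerSeries.HasSubst.of_constantCoeff_zero hz)) ha _
  rw [MvPowerSeries.subst_mul ha, h3 _ (by simp), h3 _ (by simp), h3 _ (by simp),
    MvPowerSeries.subst_add ha, MvPowerSeries.subst_X ha, MvPowerSeries.subst_X ha] at h2
  simpa using h2

theorem subst_exp_sum [Algebra ℚ S] {ι : Type*} (s : Finset ι) {x : ι → MvPowerSeries σ S}
    (hx : ∀ i, MvPowerSeries.constantCoeff (x i) = 0) :
    PowerSeries.subst (∑ i ∈ s, x i) (PowerSeries.exp ℚ) =
      ∏ i ∈ s, PowerSeries.subst (x i) (PowerSeries.exp ℚ) := by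
  classical
  induction s using Finset.induction_on with
  | empty =>
    have h0 : PowerSeries.HasSubst (0 : MvPowerSeries σ S) :=
      PowerSeries.HasSubst.of_constantCoeff_zero (by simp)
    ext e
    rw [Finset.sum_empty, Finset.prod_empty, PowerSeries.coeff_subst h0,
      finsum_eq_single _ 0 fun n hn => by simp [hn]]
    simp
  | insert i s hi ih =>
    rw [Finset.sum_insert hi, Finset.prod_insert hi, subst_exp_add (hx i), ih]
    rw [map_sum]
    exact Finset.sum_eq_zero fun i _ => hx i

end Subst

/-! ### Products of power series in disjoint sets of variables -/

section Disjoint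

variable {σ S : Type*} [CommRing S]

/-- The series `F` involves only the variables in `A`. -/
def SupportedOn (F : MvPowerSeries σ S) (A : Set σ) : Prop :=
  ∀ e : σ →₀ ℕ, MvPowerSeries.coeff e F ≠ 0 → (e.support : Set σ) ⊆ A

theorem SupportedOn.mul {F G : MvPowerSeries σ S} {A B : Set σ} (hF : SupportedOn F A)
    (hG : SupportedOn G B) : SupportedOn (F * G) (A ∪ B) := by
  classical
  intro e he
  rw [MvPowerSeries.coeff_mul] at he
  obtain ⟨p, hp, hne⟩ := Finset.exists_ne_zero_of_sum_ne_zero he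
  rw [← Finset.HasAntidiagonal.mem_antidiagonal.1 hp]
  intro v hv
  rcases Finset.mem_union.1 (Finsupp.support_add hv) with h | h
  · exact Or.inl (hF _ (left_ne_zero_of_mul hne) h)
  · exact Or.inr (hG _ (right_ne_zero_of_mul hne) h)

/-- An exponent splits in only one way into a part on `A` and a part on the disjoint set `B`. -/
theorem SupportedOn.coeff_mul {F G : MvPowerSeries σ S} {A B : Set σ} (hF : SupportedOn F A)
    (hG : SupportedOn G B) (hAB : Disjoint A B) {a b : σ →₀ ℕ} (ha : (a.support : Set σ) ⊆ A)
    (hb : (b.support : Set σ) ⊆ B) :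
    MvPowerSeries.coeff (a + b) (F * G) = MvPowerSeries.coeff a F * MvPowerSeries.coeff b G := by
  classical
  rw [MvPowerSeries.coeff_mul, Finset.sum_eq_single (a, b)]
  · intro p hp hne
    by_contra h
    have h1 := hF _ (left_ne_zero_of_mul h)
    have h2 := hG _ (right_ne_zero_of_mul h)
    have h0 {c : σ →₀ ℕ} {C D : Set σ} (hc : (c.support : Set σ) ⊆ C) (hCD : Disjoint C D) {v : σ}
        (hv : v ∈ D) : c v = 0 := by
      by_contra hcv
      exact Set.disjoint_left.1 hCD (hc (Finset.mem_coe.2 (Finsupp.mem_support_iff.2 hcv))) hv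
    have hpq := Finset.HasAntidiagonal.mem_antidiagonal.1 hp
    refine hne (Prod.ext ?_ ?_)
    · ext v
      have hv := DFunLike.congr_fun hpq v
      simp only [Finsupp.add_apply] at hv
      by_cases hvA : v ∈ A
      · rw [h0 h2 hAB.symm hvA, h0 hb hAB.symm hvA] at hv
        simpa using hv
      · have h3 {c : σ →₀ ℕ} (hc : (c.support : Set σ) ⊆ A) : c v = 0 := by
          by_contra hcv
          exact hvA (hc (Finset.mem_coe.2 (Finsupp.mem_support_iff.2 hcv)))
        rw [h3 h1, h3 ha]
    · ext v
      have hv := DFunLike.congr_fun hpq v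
      simp only [Finsupp.add_apply] at hv
      by_cases hvB : v ∈ B
      · rw [h0 h1 hAB hvB, h0 ha hAB hvB] at hv
        simpa using hv
      · have h3 {c : σ →₀ ℕ} (hc : (c.support : Set σ) ⊆ B) : c v = 0 := by
          by_contra hcv
          exact hvB (hc (Finset.mem_coe.2 (Finsupp.mem_support_iff.2 hcv)))
        rw [h3 h2, h3 hb]
  · intro h
    simp at h

theorem SupportedOn.coeff_prod {ι : Type*} (s : Finset ι) {F : ι → MvPowerSeries σ S}
    {A : ι → Set σ} {a : ι → σ →₀ ℕ} (hF : ∀ i, SupportedOn (F i) (A i))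
    (hA : Pairwise fun i j => Disjoint (A i) (A j)) (ha : ∀ i, ((a i).support : Set σ) ⊆ A i) :
    MvPowerSeries.coeff (∑ i ∈ s, a i) (∏ i ∈ s, F i) =
      ∏ i ∈ s, MvPowerSeries.coeff (a i) (F i) := by
  classical
  suffices h : SupportedOn (∏ i ∈ s, F i) (⋃ i ∈ s, A i) ∧
      ((∑ i ∈ s, a i).support : Set σ) ⊆ (⋃ i ∈ s, A i) ∧
      MvPowerSeries.coeff (∑ i ∈ s, a i) (∏ i ∈ s, F i) =
        ∏ i ∈ s, MvPowerSeries.coeff (a i) (F i) from h.2.2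
  induction s using Finset.induction_on with
  | empty =>
    refine ⟨fun e he => ?_, by simp, by simp⟩
    rw [Finset.prod_empty, MvPowerSeries.coeff_one] at he
    have : e = 0 := by
      by_contra h
      simp [h] at he
    simp [this]
  | insert i s hi ih =>
    obtain ⟨h1, h2, h3⟩ := ih
    rw [Finset.prod_insert hi, Finset.sum_insert hi, Finset.set_biUnion_insert]
    refine ⟨(hF i).mul h1, fun v hv => ?_, ?_⟩
    · rcases Finset.mem_union.1 (Finsupp.support_add hv) with h | h
      · exact Or.inl (ha i h)
      · exact Or.inr (h2 h)
    · rw [(hF i).coeff_mul h1 ?_ (ha i) h2, h3, Finset.prod_insert hi]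
      rw [Set.disjoint_iUnion₂_right]
      exact fun j hj => hA (by rintro rfl; exact hi hj)

variable {τ A : Type*} [CommRing A] [Algebra A S] {v : τ → σ}

theorem hasSubst_X_comp [Finite τ] (v : τ → σ) :
    MvPowerSeries.HasSubst fun t => (MvPowerSeries.X (v t) : MvPowerSeries σ S) :=
  MvPowerSeries.hasSubst_of_constantCoeff_zero fun _ => MvPowerSeries.constantCoeff_X _

theorem coeff_prod_X_comp (v : τ → σ) (d : τ →₀ ℕ) (e : σ →₀ ℕ) [Decidable (e = d.mapDomain v)] :
    MvPowerSeries.coeff e (d.prod fun t n => (MvPowerSeries.X (v t) : MvPowerSeries σ S) ^ n) =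
      if e = d.mapDomain v then 1 else 0 := by
  classical
  have h : (d.prod fun t n => (MvPowerSeries.X (v t) : MvPowerSeries σ S) ^ n) =
      MvPowerSeries.monomial (d.mapDomain v) 1 := by
    rw [MvPowerSeries.monomial_one_eq, Finsupp.prod_mapDomain_index (by simp)
      (fun _ _ _ => pow_add _ _ _)]
  rw [h, MvPowerSeries.coeff_monomial]
  congr

theorem coeff_subst_X_comp [Finite τ] (hv : Function.Injective v) (f : MvPowerSeries τ A)
    (d : τ →₀ ℕ) :
    MvPowerSeries.coeff (d.mapDomain v)
      (MvPowerSeries.subst (fun t => (MvPowerSeries.X (v t) : MvPowerSeries σ S)) f) =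
      algebraMap A S (MvPowerSeries.coeff d f) := by
  classical
  rw [MvPowerSeries.coeff_subst (hasSubst_X_comp v), finsum_eq_single _ d]
  · rw [coeff_prod_X_comp, if_pos rfl, Algebra.algebraMap_eq_smul_one]
  · intro d' hd'
    rw [coeff_prod_X_comp, if_neg fun h => hd' (Finsupp.mapDomain_injective hv h).symm, smul_zero]

theorem supportedOn_subst_X_comp [Finite τ] (v : τ → σ) (f : MvPowerSeries τ A) :
    SupportedOn (MvPowerSeries.subst (fun t => (MvPowerSeries.X (v t) : MvPowerSeries σ S)) f)
      (Set.range v) := by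
  classical
  intro e he
  rw [MvPowerSeries.coeff_subst (hasSubst_X_comp v)] at he
  obtain ⟨d, hd⟩ : ∃ d, MvPowerSeries.coeff d f • MvPowerSeries.coeff e
      (d.prod fun t n => (MvPowerSeries.X (v t) : MvPowerSeries σ S) ^ n) ≠ 0 := by
    by_contra! h
    exact he (finsum_eq_zero_of_forall_eq_zero h)
  rw [coeff_prod_X_comp] at hd
  split_ifs at hd with h
  · intro x hx
    rw [h] at hx
    obtain ⟨t, _, rfl⟩ := Finset.mem_image.1 (Finsupp.mapDomain_support hx)
    exact ⟨t, rfl⟩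
  · simp at hd

end Disjoint

/-! ### One distinguished variable -/

section Distinguished

variable {σ S : Type*} [CommRing S]

/-- The coefficient of `e` in `F(x_j = 0, Z = x_j)`, for a series `F` over `S⟦Z⟧`. -/
def extractFun (j : σ) (F : MvPowerSeries σ (PowerSeries S)) : MvPowerSeries σ S := fun e =>
  PowerSeries.coeff (e j) (MvPowerSeries.coeff (e.erase j) F)

theorem coeff_extractFun (j : σ) (F : MvPowerSeries σ (PowerSeries S)) (e : σ →₀ ℕ) :
    MvPowerSeries.coeff e (extractFun j F) =
      PowerSeries.coeff (e j) (MvPowerSeries.coeff (e.erase j) F) := rfl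

theorem extractFun_mul (j : σ) (F G : MvPowerSeries σ (PowerSeries S)) :
    extractFun j (F * G) = extractFun j F * extractFun j G := by
  classical
  ext e
  rw [coeff_extractFun, MvPowerSeries.coeff_mul, MvPowerSeries.coeff_mul, map_sum]
  simp only [PowerSeries.coeff_mul, coeff_extractFun]
  rw [← Finset.sum_product']
  refine Finset.sum_bij'
    (fun x _ => (x.1.1 + Finsupp.single j x.2.1, x.1.2 + Finsupp.single j x.2.2))
    (fun x _ => ((x.1.erase j, x.2.erase j), (x.1 j, x.2 j))) ?_ ?_ ?_ ?_ ?_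
  · intro x hx
    obtain ⟨h1, h2⟩ := Finset.mem_product.1 hx
    rw [Finset.HasAntidiagonal.mem_antidiagonal] at h1 h2 ⊢
    calc _ = (x.1.1 + x.1.2) + Finsupp.single j (x.2.1 + x.2.2) := by
          rw [Finsupp.single_add, add_add_add_comm]
      _ = e := by rw [h1, h2, Finsupp.erase_add_single]
  · intro x hx
    rw [Finset.HasAntidiagonal.mem_antidiagonal] at hx
    rw [Finset.mem_product, Finset.HasAntidiagonal.mem_antidiagonal,
      Finset.HasAntidiagonal.mem_antidiagonal]
    exact ⟨by rw [← hx, Finsupp.erase_add], by rw [← hx, Finsupp.add_apply]⟩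
  · intro x hx
    obtain ⟨h1, h2⟩ := Finset.mem_product.1 hx
    rw [Finset.HasAntidiagonal.mem_antidiagonal] at h1
    have h3 : x.1.1 j + x.1.2 j = 0 := by rw [← Finsupp.add_apply, h1, Finsupp.erase_same]
    have h4 (a : σ →₀ ℕ) (n : ℕ) (ha : a j = 0) : (a + Finsupp.single j n).erase j = a := by
      rw [Finsupp.erase_add, Finsupp.erase_single, add_zero, Finsupp.erase_of_notMem_support]
      simpa using ha
    have ha : x.1.1 j = 0 := by omega
    have hb : x.1.2 j = 0 := by omega
    simp only [h4 _ _ ha, h4 _ _ hb]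
    simp [ha, hb]
  · intro x hx
    simp [Finsupp.erase_add_single]
  · intro x hx
    obtain ⟨h1, h2⟩ := Finset.mem_product.1 hx
    rw [Finset.HasAntidiagonal.mem_antidiagonal] at h1
    have h3 : x.1.1 j + x.1.2 j = 0 := by rw [← Finsupp.add_apply, h1, Finsupp.erase_same]
    have h4 (a : σ →₀ ℕ) (n : ℕ) (ha : a j = 0) : (a + Finsupp.single j n).erase j = a := by
      rw [Finsupp.erase_add, Finsupp.erase_single, add_zero, Finsupp.erase_of_notMem_support]
      simpa using ha
    have ha : x.1.1 j = 0 := by omega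
    have hb : x.1.2 j = 0 := by omega
    simp only [h4 _ _ ha, h4 _ _ hb]
    simp [ha, hb]

/-- The ring homomorphism that sets the variable `x_j` to zero and then renames the variable `Z` of
the coefficients to `x_j`. -/
def extract (j : σ) : MvPowerSeries σ (PowerSeries S) →+* MvPowerSeries σ S where
  toFun := extractFun j
  map_zero' := by ext e; simp [coeff_extractFun]
  map_add' F G := by ext e; simp [coeff_extractFun]
  map_mul' := extractFun_mul j
  map_one' := by
    classical
    ext e
    rw [coeff_extractFun, MvPowerSeries.coeff_one, MvPowerSeries.coeff_one]
    by_cases h : e = 0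
    · simp [h]
    · rw [if_neg h]
      split_ifs with h1
      · rw [PowerSeries.coeff_one, if_neg]
        intro h2
        apply h
        rw [← Finsupp.erase_add_single j e, h1, h2]
        simp
      · simp

theorem coeff_extract (j : σ) (F : MvPowerSeries σ (PowerSeries S)) (e : σ →₀ ℕ) :
    MvPowerSeries.coeff e (extract j F) =
      PowerSeries.coeff (e j) (MvPowerSeries.coeff (e.erase j) F) := rfl

theorem extract_C {A : Type*} [CommRing A] [Algebra A S] (j : σ) (u : PowerSeries A) :
    extract j (MvPowerSeries.C (PowerSeries.map (algebraMap A S) u)) =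
      PowerSeries.subst (MvPowerSeries.X j : MvPowerSeries σ S) u := by
  classical
  ext e
  rw [coeff_extract, MvPowerSeries.coeff_C, PowerSeries.coeff_subst (PowerSeries.HasSubst.X j),
    finsum_eq_single _ (e j)]
  · rw [MvPowerSeries.coeff_X_pow]
    have : e.erase j = 0 ↔ e = Finsupp.single j (e j) := by
      constructor
      · intro h
        conv_lhs => rw [← Finsupp.erase_add_single j e, h, zero_add]
      · intro h
        rw [h, Finsupp.erase_single]
    by_cases h : e.erase j = 0
    · rw [if_pos h, if_pos (this.1 h), PowerSeries.coeff_map, Algebra.algebraMap_eq_smul_one]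
    · rw [if_neg h, if_neg (fun h' => h (this.2 h')), map_zero, smul_zero]
  · intro n hn
    rw [MvPowerSeries.coeff_X_pow, if_neg, smul_zero]
    rintro rfl
    simp at hn

/-- Series in the other variables whose coefficients are free of Z are left unchanged by `extract
j`. -/
theorem extract_subst_X {A : Type*} [CommRing A] [Algebra A S] {j v : σ} (hv : v ≠ j)
    (u : PowerSeries A) :
    extract j (PowerSeries.subst (MvPowerSeries.X v : MvPowerSeries σ (PowerSeries S))
      (PowerSeries.map ((PowerSeries.C (R := S)).comp (algebraMap A S)) u)) =
      PowerSeries.subst (MvPowerSeries.X v : MvPowerSeries σ S) u := by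
  classical
  ext e
  rw [coeff_extract, PowerSeries.coeff_subst_single,
    PowerSeries.coeff_subst (PowerSeries.HasSubst.X v), finsum_eq_single _ (e v)]
  · rw [MvPowerSeries.coeff_X_pow, Finsupp.erase_ne hv]
    by_cases h : e = Finsupp.single v (e v)
    · have hj : e j = 0 := by
        rw [h, Finsupp.single_apply, if_neg hv]
      have he : e.erase j = e := by
        rw [Finsupp.erase_of_notMem_support]; simpa using hj
      rw [he, if_pos h, if_pos h, hj, PowerSeries.coeff_map, Algebra.smul_def, mul_one]
      simp
    · rw [if_neg h, smul_zero]
      split_ifs with h1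
      · have hj : e j ≠ 0 := by
          intro hj
          apply h
          rwa [Finsupp.erase_of_notMem_support (by simpa using hj)] at h1
        rw [PowerSeries.coeff_map]
        simp [PowerSeries.coeff_C, hj]
      · simp
  · intro n hn
    rw [MvPowerSeries.coeff_X_pow, if_neg, smul_zero]
    rintro rfl
    simp at hn

theorem coeff_prod_subst_X [Fintype σ] (g : σ → PowerSeries S) (e : σ →₀ ℕ) :
    MvPowerSeries.coeff e (∏ v, PowerSeries.subst (MvPowerSeries.X v : MvPowerSeries σ S) (g v)) =
      ∏ v, PowerSeries.coeff (e v) (g v) := by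
  classical
  have h := SupportedOn.coeff_prod Finset.univ
    (F := fun v => PowerSeries.subst (MvPowerSeries.X v : MvPowerSeries σ S) (g v))
    (A := fun v => {v}) (a := fun v => Finsupp.single v (e v)) ?_ ?_ ?_
  · rw [Finsupp.univ_sum_single] at h
    rw [h]
    refine Finset.prod_congr rfl fun v _ => ?_
    rw [PowerSeries.coeff_subst_single]
    simp
  · intro v e' he'
    rw [PowerSeries.coeff_subst_single] at he'
    split_ifs at he' with h
    · rw [h]
      rw [← Finset.coe_singleton, Finset.coe_subset]
      exact Finsupp.support_single_subset
    · simp at he'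
  · intro v w hvw
    simpa using hvw
  · intro v
    rw [← Finset.coe_singleton, Finset.coe_subset]
    exact Finsupp.support_single_subset

end Distinguished

/-! ### Coefficients of bimoulds -/

section Exponents

/-- The exponent of `∏ X_i^{k_i - 1} Y_i^{d_i}`. -/
def biExp {n : ℕ} (g : Fin n → ℕ+ × ℕ) : Fin n ⊕ Fin n →₀ ℕ :=
  Finsupp.equivFunOnFinite.symm (Sum.elim (fun i => (g i).1.natPred) fun i => (g i).2)

@[simp]
theorem biExp_inl {n : ℕ} (g : Fin n → ℕ+ × ℕ) (i : Fin n) :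
    biExp g (Sum.inl i) = (g i).1.natPred := rfl

@[simp]
theorem biExp_inr {n : ℕ} (g : Fin n → ℕ+ × ℕ) (i : Fin n) : biExp g (Sum.inr i) = (g i).2 := rfl

theorem biExp_bijective (n : ℕ) :
    Function.Bijective (biExp : (Fin n → ℕ+ × ℕ) → Fin n ⊕ Fin n →₀ ℕ) := by
  constructor
  · intro g g' h
    funext i
    have h1 := DFunLike.congr_fun h (Sum.inl i)
    have h2 := DFunLike.congr_fun h (Sum.inr i)
    rw [biExp_inl, biExp_inl] at h1
    exact Prod.ext (PNat.natPred_injective h1) h2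
  · intro e
    refine ⟨fun i => ((e (Sum.inl i)).succPNat, e (Sum.inr i)), ?_⟩
    ext (i | i)
    · simp
    · simp

theorem biExp_eq_sum {n : ℕ} (g : Fin n → ℕ+ × ℕ) :
    biExp g = ∑ i, (Finsupp.single (Sum.inl i) (g i).1.natPred +
      Finsupp.single (Sum.inr i) (g i).2) := by
  rw [Finset.sum_add_distrib]
  conv_lhs => rw [← Finsupp.univ_sum_single (biExp g), Fintype.sum_sum_type]
  rfl

theorem mapDomain_biExp {n r : ℕ} (ι : Fin n → Fin r) (g : Fin n → ℕ+ × ℕ) :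
    (biExp g).mapDomain (Sum.map ι ι) = ∑ i, (Finsupp.single (Sum.inl (ι i)) (g i).1.natPred +
      Finsupp.single (Sum.inr (ι i)) (g i).2) := by
  rw [biExp_eq_sum, Finsupp.mapDomain_finsetSum]
  simp only [Finsupp.mapDomain_add, Finsupp.mapDomain_single, Sum.map_inl, Sum.map_inr]

end Exponents

section Bicoeff

variable {A : Type*} [CommRing A]

/-- The coefficient of `∏ X_i^{k_i - 1} Y_i^{d_i}` of a bimould. -/
def Bimould.bicoeff (B : Bimould A) (w : List (ℕ+ × ℕ)) : A :=
  MvPowerSeries.coeff (biExp w.get) (B w.length)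

theorem Bimould.coeff_eq (B : Bimould A) (w : List (ℕ+ × ℕ)) :
    B.coeff w = (∏ i : Fin w.length, ((w.get i).2 ! : A)) * B.bicoeff w := rfl

theorem Bimould.bicoeff_of_length (B : Bimould A) {w : List (ℕ+ × ℕ)} {n : ℕ}
    (h : w.length = n) :
    B.bicoeff w = MvPowerSeries.coeff (biExp fun i => w.get (i.cast h.symm)) (B n) := by
  subst h; rfl

theorem Bimould.bicoeff_ofFn (B : Bimould A) {n : ℕ} (g : Fin n → ℕ+ × ℕ) :
    B.bicoeff (List.ofFn g) = MvPowerSeries.coeff (biExp g) (B n) := by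
  rw [B.bicoeff_of_length (List.length_ofFn (f := g))]
  congr 2
  congr 1
  funext i
  simp

theorem Mould.coeff_of_length (Z : Mould A) {w : List ℕ+} {n : ℕ} (h : w.length = n) :
    Z.coeff w = MvPowerSeries.coeff
      (Finsupp.equivFunOnFinite.symm fun i => (w.get (i.cast h.symm)).natPred) (Z n) := by
  subst h; rfl

variable {S σ : Type*} [CommRing S] [Algebra A S]

theorem Bimould.eval_of_length (B : Bimould A)
    {l : List (MvPowerSeries σ S × MvPowerSeries σ S)} {n : ℕ} (h : l.length = n) :
    B.eval l = MvPowerSeries.subst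
      (Sum.elim (fun i : Fin n => (l.get (i.cast h.symm)).1)
        fun i : Fin n => (l.get (i.cast h.symm)).2) (B n) := by
  subst h; rfl

theorem Mould.eval_of_length (Z : Mould A) {l : List (MvPowerSeries σ S)} {n : ℕ}
    (h : l.length = n) :
    Z.eval l = MvPowerSeries.subst (fun i : Fin n => l.get (i.cast h.symm)) (Z n) := by
  subst h; rfl

theorem Bimould.eval_variables (B : Bimould A) {r n : ℕ}
    {l : List (MvPowerSeries (Fin r ⊕ Fin r) S × MvPowerSeries (Fin r ⊕ Fin r) S)}
    (h : l.length = n) (ι : Fin n → Fin r)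
    (hl : ∀ i : Fin n, l.get (i.cast h.symm) =
      (MvPowerSeries.X (Sum.inl (ι i)), MvPowerSeries.X (Sum.inr (ι i)))) :
    B.eval l = MvPowerSeries.subst (fun t => MvPowerSeries.X (Sum.map ι ι t)) (B n) := by
  rw [B.eval_of_length h]
  congr 1
  funext t
  rcases t with t | t <;> simp only [Sum.elim_inl, Sum.elim_inr, hl, Sum.map_inl, Sum.map_inr]

end Bicoeff

section WordSum

variable {L S : Type*} [CommRing S]

theorem wordSum_eq_sum (s : Finset L) (ρ : L → S) (n : ℕ) (f : List L → S) :
    wordSum s ρ n f = ∑ g ∈ Fintype.piFinset fun _ : Fin n => s,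
      (∏ i, ρ (g i)) * f (List.ofFn g) := by
  induction n generalizing f with
  | zero => simp [wordSum]
  | succ n ih =>
    simp only [wordSum, ih, Finset.mul_sum]
    rw [← Finset.sum_product']
    refine Finset.sum_bij' (fun x _ => Fin.cons x.1 x.2) (fun g _ => (g 0, Fin.tail g))
      ?_ ?_ ?_ ?_ ?_
    · intro x hx
      obtain ⟨h1, h2⟩ := Finset.mem_product.1 hx
      rw [Fintype.mem_piFinset] at h2 ⊢
      intro i
      refine Fin.cases ?_ (fun i => ?_) i
      · simpa using h1
      · simpa using h2 i
    · intro g hg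
      rw [Fintype.mem_piFinset] at hg
      exact Finset.mem_product.2 ⟨hg 0, Fintype.mem_piFinset.2 fun i => hg i.succ⟩
    · intro x _
      simp
    · intro g _
      simp
    · intro x _
      rw [Fin.prod_univ_succ, List.ofFn_succ]
      simp [mul_assoc]

/-- A function supported on words in the letters with `p` is summed over the smaller alphabet. It
reduces words in pairs (a, δ) to words in the letters that X^Z, Y^Z or a constant bimould can see.
-/
theorem wordSum_map {s : Finset L} {ρ : L → S} {L' : Type*} {p : L → Prop} [DecidablePred p]
    {π : L → L'} {t : Finset L'} {ρ' : L' → S}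
    (h : ∀ g : L' → S, ∑ a ∈ s, (if p a then ρ a * g (π a) else 0) = ∑ b ∈ t, ρ' b * g b)
    (n : ℕ) (f : List L' → S) :
    wordSum s ρ n (fun w => if ∀ a ∈ w, p a then f (w.map π) else 0) = wordSum t ρ' n f := by
  induction n generalizing f with
  | zero => simp [wordSum]
  | succ n ih =>
    simp only [wordSum]
    rw [← h fun b => wordSum t ρ' n fun w => f (b :: w)]
    refine Finset.sum_congr rfl fun a _ => ?_
    by_cases ha : p a
    · simp only [List.forall_mem_cons, ha, true_and, if_true, List.map_cons]
      rw [ih fun w => f (π a :: w)]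
    · simp only [List.forall_mem_cons, ha, false_and, if_false]
      have := wordSum_mul_left s ρ n 0 fun _ => (0 : S)
      simp only [zero_mul] at this
      rw [this, mul_zero]

end WordSum

section Evaluation

variable {A S R σ : Type*} [CommRing A] [CommRing S] [CommRing R] [Algebra A S] [Algebra A R]

/-- The coefficients of `B(x_1, …, x_n; y_1, …, y_n) G`, in terms of those of the products of `G`
and the monomials in the `x_i` and `y_i`. -/
theorem Bimould.coeff_eval_mul (B : Bimould A)
    {l : List (MvPowerSeries σ S × MvPowerSeries σ S)} {n : ℕ} (hn : l.length = n)
    (hl : ∀ p ∈ l, MvPowerSeries.constantCoeff p.1 = 0 ∧ MvPowerSeries.constantCoeff p.2 = 0)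
    (G : MvPowerSeries σ S) (e : σ →₀ ℕ) (s : Finset (ℕ+ × ℕ)) (ρ : ℕ+ × ℕ → R) (Λ : R →ₗ[A] S)
    (hΛ : ∀ a ∉ s, ∀ x, Λ (ρ a * x) = 0)
    (h : ∀ g : Fin n → ℕ+ × ℕ, MvPowerSeries.coeff e
      ((∏ i, ((l.get (i.cast hn.symm)).1 ^ (g i).1.natPred *
        (l.get (i.cast hn.symm)).2 ^ (g i).2)) * G) = Λ (∏ i, ρ (g i))) :
    MvPowerSeries.coeff e (B.eval l * G) =
      Λ (wordSum s ρ n fun w => algebraMap A R (B.bicoeff w)) := by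
  classical
  subst hn
  have ha : MvPowerSeries.HasSubst (Sum.elim (fun i : Fin l.length => (l.get i).1)
      fun i : Fin l.length => (l.get i).2) :=
    MvPowerSeries.hasSubst_of_constantCoeff_zero fun t => by
      rcases t with t | t
      · exact (hl _ (l.get_mem t)).1
      · exact (hl _ (l.get_mem t)).2
  rw [Bimould.eval, coeff_subst_mul ha]
  have h1 (g : Fin l.length → ℕ+ × ℕ) : MvPowerSeries.coeff (biExp g) (B l.length) •
      MvPowerSeries.coeff e (((biExp g).prod fun t n =>
        (Sum.elim (fun i : Fin l.length => (l.get i).1)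
          (fun i : Fin l.length => (l.get i).2) t) ^ n) * G) =
      B.bicoeff (List.ofFn g) • Λ (∏ i, ρ (g i)) := by
    rw [B.bicoeff_ofFn, ← h g, Finsupp.prod_fintype _ _ (by simp), Fintype.prod_sum_type,
      Finset.prod_mul_distrib]
    rfl
  rw [← finsum_comp _ (biExp_bijective l.length)]
  simp only [h1]
  rw [finsum_eq_sum_of_support_subset (s := Fintype.piFinset fun _ => s), wordSum_eq_sum, map_sum]
  · refine Finset.sum_congr rfl fun g _ => ?_
    rw [← map_smul, Algebra.smul_def, mul_comm]
  · intro g hg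
    rw [Finset.mem_coe, Fintype.mem_piFinset]
    intro i
    by_contra hi
    apply hg
    dsimp only
    rw [← Finset.mul_prod_erase _ _ (Finset.mem_univ i), hΛ _ hi, smul_zero]

end Evaluation

section Products

variable {A : Type*} [CommRing A]

theorem support_mapDomain_subset {σ τ : Type*} (v : τ → σ) (d : τ →₀ ℕ) :
    ((d.mapDomain v).support : Set σ) ⊆ Set.range v := by
  classical
  intro x hx
  obtain ⟨t, _, rfl⟩ := Finset.mem_image.1 (Finsupp.mapDomain_support hx)
  exact ⟨t, rfl⟩

theorem disjoint_range_sumMap {m n r : ℕ} {ι : Fin m → Fin r} {ι' : Fin n → Fin r}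
    (h : ∀ i j, ι i ≠ ι' j) :
    Disjoint (Set.range (Sum.map ι ι)) (Set.range (Sum.map ι' ι')) := by
  rw [Set.disjoint_left]
  rintro _ ⟨a, rfl⟩ ⟨b, hb⟩
  rcases a with a | a <;> rcases b with b | b <;> simp at hb
  · exact h a b hb.symm
  · exact h a b hb.symm

/-- The coefficients of a product of bimoulds in disjoint sets of variables. -/
theorem coeff_prod_eval {I : Type*} [Fintype I] {r : ℕ} {c : I → ℕ}
    (ε : (Σ i, Fin (c i)) ≃ Fin r) (B : I → Bimould A) (g : Fin r → ℕ+ × ℕ) :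
    MvPowerSeries.coeff (biExp g) (∏ i, (B i).eval (List.ofFn fun a : Fin (c i) =>
      ((MvPowerSeries.X (Sum.inl (ε ⟨i, a⟩)), MvPowerSeries.X (Sum.inr (ε ⟨i, a⟩))) :
        MvPowerSeries (Fin r ⊕ Fin r) A × MvPowerSeries (Fin r ⊕ Fin r) A))) =
      ∏ i, MvPowerSeries.coeff (biExp fun a => g (ε ⟨i, a⟩)) (B i (c i)) := by
  have h1 : biExp g = ∑ i, (biExp fun a => g (ε ⟨i, a⟩)).mapDomain
      (Sum.map (fun a => ε ⟨i, a⟩) fun a => ε ⟨i, a⟩) := by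
    simp only [mapDomain_biExp]
    rw [biExp_eq_sum, ← ε.sum_comp, Fintype.sum_sigma]
  have h2 (i : I) : (B i).eval (List.ofFn fun a : Fin (c i) =>
      ((MvPowerSeries.X (Sum.inl (ε ⟨i, a⟩)), MvPowerSeries.X (Sum.inr (ε ⟨i, a⟩))) :
        MvPowerSeries (Fin r ⊕ Fin r) A × MvPowerSeries (Fin r ⊕ Fin r) A)) =
      MvPowerSeries.subst (fun t => MvPowerSeries.X
        (Sum.map (fun a => ε ⟨i, a⟩) (fun a => ε ⟨i, a⟩) t)) (B i (c i)) :=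
    (B i).eval_variables List.length_ofFn _ fun a => by simp
  simp only [h2]
  rw [h1, SupportedOn.coeff_prod Finset.univ (fun i => supportedOn_subst_X_comp _ _)
    (fun i j hij => disjoint_range_sumMap fun a b hab => ?_)
    (fun i => support_mapDomain_subset _ _)]
  · refine Finset.prod_congr rfl fun i _ => ?_
    rw [coeff_subst_X_comp]
    · simp
    · refine Sum.map_injective.2 ⟨?_, ?_⟩ <;>
      · intro a b hab
        simpa using ε.injective hab
  · exact hij (congrArg Sigma.fst (ε.injective hab))

/-- The two factors of each summand live in disjoint sets of variables, so coefficients split along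
the word. -/
theorem Bimould.bicoeff_mul (B C : Bimould A) :
    (B.mul C).bicoeff = deconc B.bicoeff C.bicoeff := by
  funext w
  rw [Bimould.bicoeff, Bimould.mul, map_sum, deconc]
  refine Finset.sum_congr rfl fun j hj => ?_
  have hj' : j ≤ w.length := by simpa [Nat.lt_succ_iff] using hj
  let ι₁ : Fin j → Fin w.length := Fin.castLE hj'
  let ι₂ : Fin (w.length - j) → Fin w.length := fun i => ⟨j + i, by omega⟩
  have hw : biExp w.get = (biExp fun i => w.get (ι₁ i)).mapDomain (Sum.map ι₁ ι₁) +
      (biExp fun i => w.get (ι₂ i)).mapDomain (Sum.map ι₂ ι₂) := by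
    rw [mapDomain_biExp, mapDomain_biExp, biExp_eq_sum,
      ← (finSumFinEquiv.trans (finCongr (by omega : j + (w.length - j) = w.length))).sum_comp,
      Fintype.sum_sum_type]
    rfl
  have hl₁ : ((bivars A w.length).take j).length = j := by simp [bivars, hj']
  have hl₂ : ((bivars A w.length).drop j).length = w.length - j := by simp [bivars]
  rw [hw, B.eval_variables hl₁ ι₁ (fun i => by simp [bivars, ι₁]; exact ⟨rfl, rfl⟩),
    C.eval_variables hl₂ ι₂ (fun i => by simp [bivars, ι₂]; exact ⟨rfl, rfl⟩),
    (supportedOn_subst_X_comp _ _).coeff_mul (supportedOn_subst_X_comp _ _) _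
      (support_mapDomain_subset _ _) (support_mapDomain_subset _ _),
    coeff_subst_X_comp, coeff_subst_X_comp,
    B.bicoeff_of_length (show (w.take j).length = j by simp [hj']),
    C.bicoeff_of_length (show (w.drop j).length = w.length - j by simp)]
  · simp [ι₁, ι₂]
  · refine Sum.map_injective.2 ⟨?_, ?_⟩ <;>
    · intro a b hab
      simp only [ι₂, Fin.mk.injEq, Nat.add_left_cancel_iff] at hab
      exact Fin.ext hab
  · refine Sum.map_injective.2 ⟨?_, ?_⟩ <;> exact Fin.castLE_injective hj'
  · refine disjoint_range_sumMap fun a b hab => ?_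
    have := congrArg Fin.val hab
    simp [ι₁, ι₂] at this
    omega

theorem Bimould.bicoeff_const (F : PowerSeries A) (w : List (ℕ+ × ℕ)) :
    (Bimould.const F).bicoeff w =
      if ∀ a ∈ w, a = (1, 0) then PowerSeries.coeff w.length F else 0 := by
  rw [Bimould.bicoeff, Bimould.const, MvPowerSeries.coeff_C]
  refine if_congr ?_ rfl rfl
  constructor
  · intro h a ha
    obtain ⟨i, rfl⟩ := List.get_of_mem ha
    have h1 := DFunLike.congr_fun h (Sum.inl i)
    have h2 := DFunLike.congr_fun h (Sum.inr i)
    rw [biExp_inl] at h1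
    refine Prod.ext (PNat.natPred_injective ?_) h2
    rw [h1]; rfl
  · intro h
    have h0 (i : Fin w.length) : w.get i = (1, 0) := h _ (List.get_mem w i)
    ext (i | i)
    · rw [biExp_inl, h0]; rfl
    · rw [biExp_inr, h0]; rfl

theorem Mould.bicoeff_toX (Z : Mould A) (w : List (ℕ+ × ℕ)) :
    Z.toX.bicoeff w = if ∀ a ∈ w, a.2 = 0 then Z.coeff (w.map Prod.fst) else 0 := by
  have h0 : Z.toX w.length = MvPowerSeries.subst (fun t => MvPowerSeries.X (Sum.inl t))
      (Z w.length) := by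
    rw [Mould.toX, Z.eval_of_length (show _ = w.length by simp [bivars])]
    congr 1
    funext i
    simp [bivars]
    rfl
  rw [Bimould.bicoeff, h0]
  split_ifs with h
  · rw [Z.coeff_of_length (show _ = w.length by simp)]
    have : biExp w.get = (Finsupp.equivFunOnFinite.symm fun i : Fin w.length =>
        ((w.map Prod.fst).get (i.cast (by simp))).natPred).mapDomain Sum.inl := by
      ext (i | i)
      · rw [Finsupp.mapDomain_apply Sum.inl_injective]
        simp
      · rw [Finsupp.mapDomain_of_notMem_range _ _ (by simp), biExp_inr]
        exact h _ (List.get_mem w i)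
    rw [this, coeff_subst_X_comp Sum.inl_injective]
    rfl
  · by_contra hne
    apply h
    intro a ha
    obtain ⟨i, rfl⟩ := List.get_of_mem ha
    by_contra hi
    have := supportedOn_subst_X_comp _ _ _ hne
      (Finset.mem_coe.2 (Finsupp.mem_support_iff.2 (show biExp w.get (Sum.inr i) ≠ 0 from hi)))
    simp at this

theorem Mould.bicoeff_toY (Z : Mould A) (w : List (ℕ+ × ℕ)) :
    Z.toY.bicoeff w =
      if ∀ a ∈ w, a.1 = 1 then Z.coeff (w.map fun a => a.2.succPNat) else 0 := by
  have h0 : Z.toY w.length = MvPowerSeries.subst (fun t => MvPowerSeries.X (Sum.inr t))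
      (Z w.length) := by
    rw [Mould.toY, Z.eval_of_length (show _ = w.length by simp [bivars])]
    congr 1
    funext i
    simp [bivars]
    rfl
  rw [Bimould.bicoeff, h0]
  split_ifs with h
  · rw [Z.coeff_of_length (show _ = w.length by simp)]
    have : biExp w.get = (Finsupp.equivFunOnFinite.symm fun i : Fin w.length =>
        ((w.map fun a : ℕ+ × ℕ => a.2.succPNat).get (i.cast (by simp))).natPred).mapDomain
          Sum.inr := by
      ext (i | i)
      · rw [Finsupp.mapDomain_of_notMem_range _ _ (by simp), biExp_inl, h _ (List.get_mem w i)]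
        rfl
      · rw [Finsupp.mapDomain_apply Sum.inr_injective]
        simp
    rw [this, coeff_subst_X_comp Sum.inr_injective]
    rfl
  · by_contra hne
    apply h
    intro a ha
    obtain ⟨i, rfl⟩ := List.get_of_mem ha
    by_contra hi
    have hi' : biExp w.get (Sum.inl i) ≠ 0 := by
      rw [biExp_inl]
      intro h'
      exact hi (PNat.natPred_injective h')
    have := supportedOn_subst_X_comp _ _ _ hne
      (Finset.mem_coe.2 (Finsupp.mem_support_iff.2 hi'))
    simp at this

theorem Mould.coeff_minus (Z : Mould A) (w : List ℕ+) :
    Z.minus.coeff w = (w.map fun a => (-1 : A) ^ a.natPred).prod * Z.coeff w := by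
  have h0 : Z.minus w.length = MvPowerSeries.rescale (fun _ => -1) (Z w.length) := by
    rw [Mould.minus, Z.eval_of_length (show _ = w.length by simp [vars]),
      MvPowerSeries.rescale_eq_subst]
    congr 1
    funext i
    simp [vars]
    rfl
  rw [Mould.coeff, h0, MvPowerSeries.coeff_rescale, Mould.coeff,
    Finsupp.prod_fintype _ _ (by simp)]
  congr 1
  rw [← List.prod_ofFn]
  congr 1
  refine List.ext_getElem (by simp) fun i h1 h2 => ?_
  simp

end Products

/-! ### The series `L_m` -/

section SeriesL

/-- The series `e^Z q^m / (1 - e^Z q^m)` in `Z`. -/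
def lambertKernel (m : ℕ) (hm : m ≠ 0) : PowerSeries (PowerSeries ℚ) :=
  PowerSeries.mk fun n => PowerSeries.expand m hm (powerSumSeries ℚ n)

/-- This is `one_sub_expY_mul_expYSum` with c = 1, Y renamed Z and t replaced by q^m. -/
theorem one_sub_mul_lambertKernel {m : ℕ} (hm : m ≠ 0) :
    (1 - PowerSeries.exp (PowerSeries ℚ) * PowerSeries.C (PowerSeries.X ^ m)) *
      lambertKernel m hm =
        PowerSeries.exp (PowerSeries ℚ) * PowerSeries.C (PowerSeries.X ^ m) := by
  have h := congrArg (PowerSeries.map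
    (PowerSeries.expand m hm : PowerSeries ℚ →ₐ[ℚ] PowerSeries ℚ).toRingHom)
    (one_sub_expY_mul_expYSum (1 : ℚ))
  have h1 : PowerSeries.map (PowerSeries.expand m hm : PowerSeries ℚ →ₐ[ℚ] PowerSeries ℚ).toRingHom
      (expY (1 : ℚ)) = PowerSeries.exp (PowerSeries ℚ) := by
    ext1 n
    rw [PowerSeries.coeff_map, coeff_expY, PowerSeries.coeff_exp, PowerSeries.algebraMap_apply]
    simp [PowerSeries.expand_C]
  have h2 : PowerSeries.map (PowerSeries.expand m hm : PowerSeries ℚ →ₐ[ℚ] PowerSeries ℚ).toRingHom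
      (expYSum (1 : ℚ)) = lambertKernel m hm := by
    ext1 n
    simp [expYSum, lambertKernel]
  have h3 : (PowerSeries.expand m hm : PowerSeries ℚ →ₐ[ℚ] PowerSeries ℚ).toRingHom
      PowerSeries.X = PowerSeries.X ^ m := PowerSeries.expand_X m hm
  rwa [map_mul, map_sub, map_one, map_mul, h1, h2, PowerSeries.map_C, h3] at h

theorem constantCoeff_subst_exp {σ : Type*} {x : MvPowerSeries σ (PowerSeries ℚ)}
    (hx : MvPowerSeries.constantCoeff x = 0) :
    MvPowerSeries.constantCoeff (expSeries x) = 1 := by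
  rw [expSeries, PowerSeries.constantCoeff_subst (PowerSeries.HasSubst.of_constantCoeff_zero hx),
    finsum_eq_single _ 0 fun n hn => by simp [hx, hn]]
  simp

theorem seriesL_mul_inverse {σ : Type*} {m : ℕ} (hm : m ≠ 0) (j : σ) :
    expSeries (MvPowerSeries.X j) * qpow σ m *
      Ring.inverse (1 - expSeries (MvPowerSeries.X j) * qpow σ m) =
      extract j (MvPowerSeries.C (lambertKernel m hm)) := by
  have h := congrArg (fun F => extract j (MvPowerSeries.C (σ := σ) F))
    (one_sub_mul_lambertKernel hm)
  simp only [map_mul, map_sub, map_one] at h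
  have h1 : extract j (MvPowerSeries.C (PowerSeries.exp (PowerSeries ℚ))) =
      expSeries (MvPowerSeries.X j : MvPowerSeries σ (PowerSeries ℚ)) := by
    rw [expSeries, ← extract_C, PowerSeries.map_exp]
  have h2 : extract j (MvPowerSeries.C (PowerSeries.C (PowerSeries.X ^ m))) =
      qpow σ m := by
    classical
    ext e : 1
    rw [coeff_extract, qpow, MvPowerSeries.coeff_C, MvPowerSeries.coeff_C]
    by_cases he : e = 0
    · simp [he]
    · rw [if_neg he]
      split_ifs with h3
      · rw [PowerSeries.coeff_C, if_neg]
        intro h4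
        apply he
        rw [← Finsupp.erase_add_single j e, h3, h4]
        simp
      · simp
  rw [h1, h2] at h
  have hu : IsUnit (1 - expSeries (MvPowerSeries.X j) * qpow σ m) := by
    rw [MvPowerSeries.isUnit_iff_constantCoeff, map_sub, map_mul,
      constantCoeff_subst_exp (MvPowerSeries.constantCoeff_X j), qpow,
      MvPowerSeries.constantCoeff_C, PowerSeries.isUnit_iff_constantCoeff]
    simp [hm]
  calc _ = (1 - expSeries (MvPowerSeries.X j) * qpow σ m) *
        extract j (MvPowerSeries.C (lambertKernel m hm)) *
        Ring.inverse (1 - expSeries (MvPowerSeries.X j) * qpow σ m) := by rw [h]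
    _ = _ := by
      rw [mul_right_comm, Ring.mul_inverse_cancel _ hu, one_mul]

theorem subst_nsmul_X {σ S : Type*} [CommRing S] [Algebra ℚ S] (m : ℕ) (v : σ)
    (F : PowerSeries ℚ) :
    PowerSeries.subst (m • (MvPowerSeries.X v : MvPowerSeries σ S)) F =
      PowerSeries.subst (MvPowerSeries.X v : MvPowerSeries σ S) (PowerSeries.rescale (m : ℚ) F) := by
  ext e
  rw [PowerSeries.coeff_subst (PowerSeries.HasSubst.X v), PowerSeries.coeff_subst
    (PowerSeries.HasSubst.of_constantCoeff_zero (by rw [map_nsmul]; simp))]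
  refine finsum_congr fun n => ?_
  have h : (m • (MvPowerSeries.X v : MvPowerSeries σ S)) ^ n =
      ((m : ℚ) ^ n) • (MvPowerSeries.X v : MvPowerSeries σ S) ^ n := by
    rw [← Nat.cast_smul_eq_nsmul ℚ, smul_pow]
  rw [h, PowerSeries.coeff_rescale, map_rat_smul, smul_smul, mul_comm]

/-- With X_j moved into the coefficient ring as Z, the series becomes a constant times one
exponential e^{mY_i} for each variable Y_i, so that it factors over the variables. -/
theorem seriesL_eq_extract {r : ℕ} {m : ℕ} (hm : m ≠ 0) (j : Fin r) :
    seriesL m (MvPowerSeries.X (Sum.inl j)) (∑ i : Fin r, MvPowerSeries.X (Sum.inr i)) =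
      extract (Sum.inl j) (MvPowerSeries.C (lambertKernel m hm) *
        ∏ i : Fin r, PowerSeries.subst (MvPowerSeries.X (Sum.inr i))
          (PowerSeries.map ((PowerSeries.C (R := PowerSeries ℚ)).comp
            (algebraMap ℚ (PowerSeries ℚ))) (PowerSeries.rescale (m : ℚ) (PowerSeries.exp ℚ)))) := by
  have hY (i : Fin r) : MvPowerSeries.constantCoeff
      (m • (MvPowerSeries.X (Sum.inr i) : MvPowerSeries (Fin r ⊕ Fin r) (PowerSeries ℚ))) = 0 := by
    rw [map_nsmul]; simp
  rw [seriesL, expSeries, Finset.smul_sum, subst_exp_add (MvPowerSeries.constantCoeff_X _)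
    (by rw [map_sum]; exact Finset.sum_eq_zero fun i _ => hY i), subst_exp_sum _ hY, map_mul,
    ← seriesL_mul_inverse hm, map_prod]
  simp only [subst_nsmul_X]
  simp only [extract_subst_X (Sum.inr_ne_inl), expSeries]
  ring

end SeriesL

/-! ### The diagonal coefficients of `𝔏_m` -/

/-- The functional `x ↦ [Z^{k-1}] (U x)`. -/
def coeffMulMap (k : ℕ) (U : PowerSeries (PowerSeries ℚ)) : PowerSeries ℚ →ₗ[ℚ] PowerSeries ℚ where
  toFun x := PowerSeries.coeff (k - 1)
    (U * PowerSeries.map (algebraMap ℚ (PowerSeries ℚ)) x)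
  map_add' x y := by rw [map_add, mul_add, map_add]
  map_smul' c x := by
    rw [PowerSeries.smul_eq_C_mul, map_mul (PowerSeries.map _), mul_left_comm, PowerSeries.map_C,
      PowerSeries.coeff_C_mul, RingHom.id_apply, Algebra.smul_def]

theorem coeffMulMap_apply (k : ℕ) (U : PowerSeries (PowerSeries ℚ)) (x : PowerSeries ℚ) :
    coeffMulMap k U x = PowerSeries.coeff (k - 1)
      (U * PowerSeries.map (algebraMap ℚ (PowerSeries ℚ)) x) := rfl

/-- The weight of the letter `(a, δ)` in the diagonal coefficients. -/
def letterWeight (k : ℕ+) (d m : ℕ) (a : ℕ+ × ℕ) : PowerSeries ℚ :=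
  binomWeight k (if a.2 ≤ d then (m : ℚ) ^ (d - a.2) / ((d - a.2)! : ℚ) else 0) a.1

/-- The letters that contribute to the diagonal coefficients. -/
def letterBox (k : ℕ+) (d : ℕ) : Finset (ℕ+ × ℕ) :=
  (Finset.Icc 1 (2 * k - 1)) ×ˢ Finset.range (d + 1)

/-- The reversal on the right matches 𝔟̃, which reads its variables from the last one backwards. -/
theorem prod_split {M : Type*} [CommMonoid M] (a b : ℕ) (F : Fin (a + (b + 1)) → M) :
    ∏ i, F i = (∏ x : Fin a, F (Fin.castAdd (b + 1) x)) * (F (Fin.natAdd a 0) *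
      ∏ x : Fin b, F (Fin.natAdd a x.rev.succ)) := by
  rw [Fin.prod_univ_add, Fin.prod_univ_succ,
    ← Equiv.prod_comp Fin.revPerm fun x : Fin b => F (Fin.natAdd a x.succ)]
  rfl

theorem coeff_X_sub_pow (S : Type*) [CommRing S] (z : S) (n i : ℕ) :
    PowerSeries.coeff i ((PowerSeries.X - PowerSeries.C z) ^ n) =
      (-z) ^ (n - i) * (n.choose i : S) := by
  rw [← Polynomial.coeff_X_add_C_pow, ← Polynomial.coeff_coe]
  simp [sub_eq_add_neg]

/-- The origin of the weight of (a, δ): it is [X^(k-1)] (X - Z)^(a-1) times [Y^d] Y^δ e^{mY}. -/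
theorem map_letterWeight {S : Type*} [CommRing S] [Algebra ℚ S] (k : ℕ+) (d m : ℕ)
    (a : ℕ+ × ℕ) :
    PowerSeries.map (algebraMap ℚ S) (letterWeight k d m a) =
      PowerSeries.coeff (k : ℕ).pred ((PowerSeries.X - PowerSeries.C PowerSeries.X) ^ a.1.natPred) *
        PowerSeries.coeff d (PowerSeries.X ^ a.2 *
          PowerSeries.map ((PowerSeries.C (R := S)).comp (algebraMap ℚ S))
            (PowerSeries.rescale (m : ℚ) (PowerSeries.exp ℚ))) := by
  have h1 : a.1.natPred - (k : ℕ).pred = (a.1 : ℕ) - k := by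
    have h2 := a.1.natPred_add_one
    have h3 := k.pos
    rw [← h2, Nat.pred_eq_sub_one]
    omega
  rw [coeff_X_sub_pow, PowerSeries.coeff_X_pow_mul', letterWeight, binomWeight, h1, map_mul,
    PowerSeries.map_C, map_pow, PowerSeries.map_X, neg_pow]
  have h4 : ((a.1 : ℕ) - 1).choose ((k : ℕ) - 1) = a.1.natPred.choose (k : ℕ).pred := rfl
  rw [h4]
  split_ifs with h
  · rw [PowerSeries.coeff_map, PowerSeries.coeff_rescale, PowerSeries.coeff_exp,
      RingHom.comp_apply, div_eq_mul_inv]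
    simp only [map_mul, map_pow, map_natCast, map_neg, map_one, Algebra.algebraMap_self,
      RingHom.id_apply, one_div]
    ring
  · simp

/-- The weights lie in ℚ⟦Z⟧, whereas the values of `coeffMulMap` lie in ℚ⟦q⟧. A letter with a ≥ 2k
has a weight divisible by Z^k, invisible to [Z^(k-1)], and for δ > d the weight is zero; this makes
the alphabet finite. -/
theorem coeffMulMap_letterWeight (k : ℕ+) (d m : ℕ) (U : PowerSeries (PowerSeries ℚ))
    {a : ℕ+ × ℕ} (ha : a ∉ letterBox k d) (x : PowerSeries ℚ) :
    coeffMulMap k U (letterWeight k d m a * x) = 0 := by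
  rw [letterBox, Finset.mem_product, not_and_or, Finset.mem_range, Finset.mem_Icc] at ha
  rw [coeffMulMap_apply, letterWeight, binomWeight]
  rcases ha with h | h
  · have h1 : ¬ (a.1 : ℕ) ≤ 2 * k - 1 := by
      intro h2
      apply h
      refine ⟨one_le, ?_⟩
      rw [← PNat.coe_le_coe, PNat.sub_coe, if_pos]
      · simpa using h2
      · rw [← PNat.coe_lt_coe]
        have := k.pos
        rw [PNat.mul_coe]
        change 1 < 2 * (k : ℕ)
        omega
    rw [map_mul (PowerSeries.map _), map_mul (PowerSeries.map _), PowerSeries.map_C, map_pow,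
      PowerSeries.map_X, mul_assoc, mul_left_comm, PowerSeries.coeff_C_mul, mul_left_comm,
      PowerSeries.coeff_X_pow_mul', if_neg (show ¬ (a.1 : ℕ) - k ≤ k - 1 by omega), mul_zero]
  · rw [if_neg (by omega)]
    simp

theorem X_sub_X_pow_eq_extract {σ S : Type*} [CommRing S] {j v : σ} (hv : v ≠ j) (n : ℕ) :
    (MvPowerSeries.X v - MvPowerSeries.X j : MvPowerSeries σ S) ^ n =
      extract j (PowerSeries.subst (MvPowerSeries.X v)
        ((PowerSeries.X - PowerSeries.C PowerSeries.X) ^ n : PowerSeries (PowerSeries S))) := by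
  have hX := PowerSeries.HasSubst.X (S := PowerSeries S) v
  have h1 : extract j (MvPowerSeries.X v) = (MvPowerSeries.X v : MvPowerSeries σ S) := by
    have := extract_subst_X (S := S) hv (PowerSeries.X : PowerSeries S)
    rwa [PowerSeries.map_X, PowerSeries.subst_X hX,
      PowerSeries.subst_X (PowerSeries.HasSubst.X v)] at this
  have h2 : extract j (MvPowerSeries.C PowerSeries.X) =
      (MvPowerSeries.X j : MvPowerSeries σ S) := by
    have := extract_C (S := S) j (PowerSeries.X : PowerSeries S)
    rwa [PowerSeries.map_X, PowerSeries.subst_X (PowerSeries.HasSubst.X j)] at this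
  have h3 : PowerSeries.subst (MvPowerSeries.X v : MvPowerSeries σ (PowerSeries S))
      (PowerSeries.C PowerSeries.X : PowerSeries (PowerSeries S)) =
      MvPowerSeries.C PowerSeries.X := by
    classical
    ext e : 1
    rw [PowerSeries.coeff_subst_single, MvPowerSeries.coeff_C, PowerSeries.coeff_C]
    by_cases he : e = 0
    · simp [he]
    · rw [if_neg he]
      split_ifs with h4 h5
      · rw [h5] at h4
        simp [h4] at he
      · rfl
      · rfl
  rw [PowerSeries.subst_pow hX, PowerSeries.subst_sub hX, PowerSeries.subst_X hX, h3, map_pow,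
    map_sub, h1, h2]

/-- After X_j becomes Z, the expression is a product of one-variable series over ℚ⟦q⟧⟦Z⟧; its
coefficient is the product of the letter weights, and [Z^(k-1)] is taken at the end. -/
theorem coeff_monomial_mul_seriesL (k : ℕ+) (d : ℕ) {m : ℕ} (hm : m ≠ 0) {a b : ℕ}
    (g₁ : Fin a → ℕ+ × ℕ) (g₂ : Fin b → ℕ+ × ℕ) :
    MvPowerSeries.coeff (biExp fun _ : Fin (a + (b + 1)) => (k, d))
      ((∏ x : Fin a, (MvPowerSeries.X (Sum.inl (Fin.castAdd (b + 1) x)) -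
          MvPowerSeries.X (Sum.inl (Fin.natAdd a 0))) ^ (g₁ x).1.natPred *
            MvPowerSeries.X (Sum.inr (Fin.castAdd (b + 1) x)) ^ (g₁ x).2) *
        (∏ x : Fin b, (MvPowerSeries.X (Sum.inl (Fin.natAdd a x.rev.succ)) -
          MvPowerSeries.X (Sum.inl (Fin.natAdd a 0))) ^ (g₂ x).1.natPred *
            MvPowerSeries.X (Sum.inr (Fin.natAdd a x.rev.succ)) ^ (g₂ x).2) *
        seriesL m (MvPowerSeries.X (Sum.inl (Fin.natAdd a 0)))
          (∑ i : Fin (a + (b + 1)), MvPowerSeries.X (Sum.inr i))) =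
      coeffMulMap k (PowerSeries.C (algebraMap ℚ (PowerSeries ℚ) ((m : ℚ) ^ d / (d ! : ℚ))) *
          lambertKernel m hm)
        ((∏ x, letterWeight k d m (g₁ x)) * ∏ x, letterWeight k d m (g₂ x)) := by
  classical
  -- The distinguished position gets the letter (1, 0), whose monomial is 1, so that all positions
  -- can be treated alike.
  let h : Fin (a + (b + 1)) → ℕ+ × ℕ := Fin.addCases g₁ (Fin.cons (1, 0) fun x => g₂ x.rev)
  have h₁ (x : Fin a) : h (Fin.castAdd (b + 1) x) = g₁ x := by simp [h]
  have h₂ (x : Fin b) : h (Fin.natAdd a x.rev.succ) = g₂ x := by simp [h]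
  have h₀ : h (Fin.natAdd a 0) = (1, 0) := by simp [h]
  let j : Fin (a + (b + 1)) := Fin.natAdd a 0
  let E : PowerSeries (PowerSeries (PowerSeries ℚ)) :=
    PowerSeries.map ((PowerSeries.C (R := PowerSeries ℚ)).comp
      (algebraMap ℚ (PowerSeries ℚ))) (PowerSeries.rescale (m : ℚ) (PowerSeries.exp ℚ))
  let G : Fin (a + (b + 1)) ⊕ Fin (a + (b + 1)) → PowerSeries (PowerSeries (PowerSeries ℚ)) :=
    Sum.elim (fun i => (PowerSeries.X - PowerSeries.C PowerSeries.X) ^ (h i).1.natPred)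
      fun i => PowerSeries.X ^ (h i).2 * E
  have hinr (i : Fin (a + (b + 1))) (n : ℕ) :
      (MvPowerSeries.X (Sum.inr i) : MvPowerSeries (Fin (a + (b + 1)) ⊕ Fin (a + (b + 1)))
        (PowerSeries ℚ)) ^ n = extract (Sum.inl j)
          (PowerSeries.subst (MvPowerSeries.X (Sum.inr i)) (PowerSeries.X ^ n :
            PowerSeries (PowerSeries (PowerSeries ℚ)))) := by
    have := extract_subst_X (S := PowerSeries ℚ) (Sum.inr_ne_inl (a := j) (b := i))
      (PowerSeries.X ^ n : PowerSeries (PowerSeries ℚ))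
    rw [map_pow, PowerSeries.map_X] at this
    rw [this, PowerSeries.subst_pow (PowerSeries.HasSubst.X _),
      PowerSeries.subst_X (PowerSeries.HasSubst.X _)]
  have hne₁ (x : Fin a) : (Sum.inl (Fin.castAdd (b + 1) x) :
      Fin (a + (b + 1)) ⊕ Fin (a + (b + 1))) ≠ Sum.inl j := by
    intro h
    have := congrArg Fin.val (Sum.inl.inj h)
    simp [j] at this
    omega
  have hne₂ (x : Fin b) : (Sum.inl (Fin.natAdd a x.rev.succ) :
      Fin (a + (b + 1)) ⊕ Fin (a + (b + 1))) ≠ Sum.inl j := by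
    intro h
    have := congrArg Fin.val (Sum.inl.inj h)
    simp [j] at this
  have key : (∏ x : Fin a, (MvPowerSeries.X (Sum.inl (Fin.castAdd (b + 1) x)) -
          MvPowerSeries.X (Sum.inl (Fin.natAdd a 0))) ^ (g₁ x).1.natPred *
            MvPowerSeries.X (Sum.inr (Fin.castAdd (b + 1) x)) ^ (g₁ x).2) *
        (∏ x : Fin b, (MvPowerSeries.X (Sum.inl (Fin.natAdd a x.rev.succ)) -
          MvPowerSeries.X (Sum.inl (Fin.natAdd a 0))) ^ (g₂ x).1.natPred *
            MvPowerSeries.X (Sum.inr (Fin.natAdd a x.rev.succ)) ^ (g₂ x).2) *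
        seriesL m (MvPowerSeries.X (Sum.inl (Fin.natAdd a 0)))
          (∑ i : Fin (a + (b + 1)), MvPowerSeries.X (Sum.inr i)) =
      extract (Sum.inl j) (MvPowerSeries.C (lambertKernel m hm) *
        ∏ v, PowerSeries.subst (MvPowerSeries.X v) (G v)) := by
    have hG (i : Fin (a + (b + 1))) : PowerSeries.subst (MvPowerSeries.X (Sum.inr i) :
        MvPowerSeries (Fin (a + (b + 1)) ⊕ Fin (a + (b + 1))) (PowerSeries (PowerSeries ℚ)))
          (G (Sum.inr i)) =
        PowerSeries.subst (MvPowerSeries.X (Sum.inr i)) (PowerSeries.X ^ (h i).2 :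
          PowerSeries (PowerSeries (PowerSeries ℚ))) *
        PowerSeries.subst (MvPowerSeries.X (Sum.inr i)) E :=
      PowerSeries.subst_mul (PowerSeries.HasSubst.X _) _ _
    have h1 : PowerSeries.subst (MvPowerSeries.X (Sum.inl (Fin.natAdd a 0)) :
        MvPowerSeries (Fin (a + (b + 1)) ⊕ Fin (a + (b + 1))) (PowerSeries (PowerSeries ℚ)))
        (G (Sum.inl (Fin.natAdd a 0))) * PowerSeries.subst
          (MvPowerSeries.X (Sum.inr (Fin.natAdd a 0))) (PowerSeries.X ^ (h (Fin.natAdd a 0)).2 :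
          PowerSeries (PowerSeries (PowerSeries ℚ))) = 1 := by
      have hn : (1 : ℕ+).natPred = 0 := rfl
      simp only [G, Sum.elim_inl, h₀, hn, pow_zero]
      rw [← PowerSeries.coe_substAlgHom (PowerSeries.HasSubst.X _), map_one,
        ← PowerSeries.coe_substAlgHom (PowerSeries.HasSubst.X _), map_one, mul_one]
    rw [Fintype.prod_sum_type]
    simp only [hG]
    conv_rhs =>
      rw [Finset.prod_mul_distrib, ← mul_assoc (∏ i, _), ← Finset.prod_mul_distrib, prod_split, h1,
        one_mul, mul_left_comm, map_mul, ← seriesL_eq_extract hm, map_mul, map_prod, map_prod]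
    congr 2
    · refine Finset.prod_congr rfl fun x _ => ?_
      rw [X_sub_X_pow_eq_extract (hne₁ x), hinr, ← map_mul]
      simp only [G, Sum.elim_inl, h₁]
    · refine Finset.prod_congr rfl fun x _ => ?_
      rw [X_sub_X_pow_eq_extract (hne₂ x), hinr, ← map_mul]
      simp only [G, Sum.elim_inl, h₂]
  have he (i : Fin (a + (b + 1))) (hi : (Sum.inl i : Fin (a + (b + 1)) ⊕ Fin (a + (b + 1))) ≠
      Sum.inl j) : (((biExp fun _ : Fin (a + (b + 1)) => (k, d)).erase (Sum.inl j)) (Sum.inl i)) =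
        (k : ℕ).pred := by
    rw [Finsupp.erase_ne hi, biExp_inl]; rfl
  have he' (i : Fin (a + (b + 1))) : (((biExp fun _ : Fin (a + (b + 1)) => (k, d)).erase
      (Sum.inl j)) (Sum.inr i)) = d := by
    rw [Finsupp.erase_ne Sum.inr_ne_inl, biExp_inr]
  rw [key, coeff_extract, MvPowerSeries.coeff_C_mul, coeff_prod_subst_X, Fintype.prod_sum_type,
    ← Finset.prod_mul_distrib, prod_split, coeffMulMap_apply, biExp_inl,
    Finsupp.erase_same]
  simp only [he', he _ (hne₁ _), he _ (hne₂ _), G, Sum.elim_inl, Sum.elim_inr, h₁, h₂, h₀, E,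
    ← map_letterWeight]
  have hj : PowerSeries.coeff 0 ((PowerSeries.X - PowerSeries.C PowerSeries.X) ^
      (1 : ℕ+).natPred : PowerSeries (PowerSeries (PowerSeries ℚ))) *
      PowerSeries.coeff d (PowerSeries.X ^ 0 * PowerSeries.map
        ((PowerSeries.C (R := PowerSeries ℚ)).comp (algebraMap ℚ (PowerSeries ℚ)))
          (PowerSeries.rescale (m : ℚ) (PowerSeries.exp ℚ))) =
      PowerSeries.C (algebraMap ℚ (PowerSeries ℚ) ((m : ℚ) ^ d / (d ! : ℚ))) := by
    have hn : (1 : ℕ+).natPred = 0 := rfl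
    rw [hn, pow_zero, pow_zero, one_mul, PowerSeries.coeff_map, PowerSeries.coeff_rescale,
      PowerSeries.coeff_exp, RingHom.comp_apply]
    simp [div_eq_mul_inv]
  rw [hj, map_mul (PowerSeries.map _), map_prod, map_prod]
  congr 1
  ring

/-- The two bimoulds are expanded one after the other; multiplication by what belongs to the other
one is absorbed into the linear functional. -/
theorem coeff_eval_mul_seriesL_mul_eval (B C : Bimould ℚ) (k : ℕ+) (d : ℕ) {m : ℕ} (hm : m ≠ 0)
    (a b : ℕ) :
    MvPowerSeries.coeff (biExp fun _ : Fin (a + (b + 1)) => (k, d))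
      (B.eval (((bivars (PowerSeries ℚ) (a + (b + 1))).take a).map
          fun p => (p.1 - MvPowerSeries.X (Sum.inl (Fin.natAdd a 0)), p.2)) *
        seriesL m (MvPowerSeries.X (Sum.inl (Fin.natAdd a 0)))
          (∑ i : Fin (a + (b + 1)), MvPowerSeries.X (Sum.inr i)) *
        C.eval (((bivars (PowerSeries ℚ) (a + (b + 1))).drop (a + 1)).reverse.map
          fun p => (p.1 - MvPowerSeries.X (Sum.inl (Fin.natAdd a 0)), p.2))) =
      coeffMulMap k (PowerSeries.C (algebraMap ℚ (PowerSeries ℚ) ((m : ℚ) ^ d / (d ! : ℚ))) *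
          lambertKernel m hm)
        (wordSum (letterBox k d) (letterWeight k d m) a (fun w => algebraMap ℚ _ (B.bicoeff w)) *
          wordSum (letterBox k d) (letterWeight k d m) b
            fun w => algebraMap ℚ _ (C.bicoeff w)) := by
  set l₁ := ((bivars (PowerSeries ℚ) (a + (b + 1))).take a).map
    fun p => (p.1 - MvPowerSeries.X (Sum.inl (Fin.natAdd a 0)), p.2) with hl₁
  set l₂ := ((bivars (PowerSeries ℚ) (a + (b + 1))).drop (a + 1)).reverse.map
    fun p => (p.1 - MvPowerSeries.X (Sum.inl (Fin.natAdd a 0)), p.2) with hl₂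
  have hn₁ : l₁.length = a := by simp [hl₁, bivars]; omega
  have hn₂ : l₂.length = b := by simp [hl₂, bivars]
  have hb (p) (hp : p ∈ bivars (PowerSeries ℚ) (a + (b + 1))) :
      MvPowerSeries.constantCoeff (p.1 - MvPowerSeries.X (Sum.inl (Fin.natAdd a 0))) = 0 ∧
        MvPowerSeries.constantCoeff p.2 = 0 := by
    obtain ⟨i, rfl⟩ := (List.mem_ofFn' _ _).1 hp
    simp
  have hc₁ : ∀ p ∈ l₁, MvPowerSeries.constantCoeff p.1 = 0 ∧
      MvPowerSeries.constantCoeff p.2 = 0 := by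
    intro p hp
    obtain ⟨p', hp', rfl⟩ := List.mem_map.1 hp
    exact hb p' (List.mem_of_mem_take hp')
  have hc₂ : ∀ p ∈ l₂, MvPowerSeries.constantCoeff p.1 = 0 ∧
      MvPowerSeries.constantCoeff p.2 = 0 := by
    intro p hp
    obtain ⟨p', hp', rfl⟩ := List.mem_map.1 hp
    exact hb p' (List.mem_of_mem_drop (List.mem_reverse.1 hp'))
  have hg₁ (x : Fin a) : l₁.get (x.cast hn₁.symm) =
      (MvPowerSeries.X (Sum.inl (Fin.castAdd (b + 1) x)) -
        MvPowerSeries.X (Sum.inl (Fin.natAdd a 0)),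
        MvPowerSeries.X (Sum.inr (Fin.castAdd (b + 1) x))) := by
    simp only [hl₁, bivars, List.get_eq_getElem, List.getElem_map, List.getElem_take,
      List.getElem_ofFn]
    rfl
  have hg₂ (x : Fin b) : l₂.get (x.cast hn₂.symm) =
      (MvPowerSeries.X (Sum.inl (Fin.natAdd a x.rev.succ)) -
        MvPowerSeries.X (Sum.inl (Fin.natAdd a 0)),
        MvPowerSeries.X (Sum.inr (Fin.natAdd a x.rev.succ))) := by
    have hx : (⟨a + (b - 1 - x) + 1, by omega⟩ : Fin (a + (b + 1))) =
        Fin.natAdd a x.rev.succ := by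
      ext; simp; omega
    simp [hl₂, bivars, hx]
  set U : PowerSeries (PowerSeries ℚ) :=
    PowerSeries.C (algebraMap ℚ (PowerSeries ℚ) ((m : ℚ) ^ d / (d ! : ℚ))) * lambertKernel m hm
    with hU
  rw [mul_assoc, B.coeff_eval_mul hn₁ hc₁ _ _ (letterBox k d) (letterWeight k d m)
    ((coeffMulMap k U).comp (LinearMap.mulRight ℚ (wordSum (letterBox k d) (letterWeight k d m) b
      fun w => algebraMap ℚ _ (C.bicoeff w))))]
  · rfl
  · intro g hg x
    rw [LinearMap.comp_apply, LinearMap.mulRight_apply, mul_assoc,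
      coeffMulMap_letterWeight k d m U hg]
  intro g₁
  rw [← mul_assoc, mul_comm, C.coeff_eval_mul hn₂ hc₂ _ _ (letterBox k d) (letterWeight k d m)
    ((coeffMulMap k U).comp (LinearMap.mulLeft ℚ (∏ i, letterWeight k d m (g₁ i))))]
  · rfl
  · intro g hg x
    rw [LinearMap.comp_apply, LinearMap.mulLeft_apply, mul_left_comm,
      coeffMulMap_letterWeight k d m U hg]
  intro g₂
  simp only [hg₁, hg₂]
  rw [← mul_assoc, mul_comm (∏ i : Fin b, _), coeff_monomial_mul_seriesL k d hm]
  rfl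

/-! ### Rescaling -/

section Rescale

variable {L S : Type*} [CommRing S]

theorem HasLogDeriv.rescale (c : S) {F C : PowerSeries S} (h : HasLogDeriv F C) :
    HasLogDeriv (PowerSeries.rescale c F) (PowerSeries.rescale c C) := by
  refine ⟨?_, ?_⟩
  · rw [← PowerSeries.coeff_zero_eq_constantCoeff_apply, PowerSeries.coeff_rescale, pow_zero,
      one_mul, PowerSeries.coeff_zero_eq_constantCoeff_apply, h.1]
  · rw [← map_mul, ← h.2]
    ext n
    simp only [theta, PowerSeries.coeff_mk, PowerSeries.coeff_rescale]
    ring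

theorem rescale_altSeries (c : S) (g : ℕ → S) :
    PowerSeries.rescale c (altSeries g) = altSeries fun n => c ^ n * g n := by
  ext n
  by_cases h : n = 0
  · simp [altSeries, h]
  · simp only [altSeries, PowerSeries.coeff_rescale, PowerSeries.coeff_mk, h, if_false]
    ring

theorem wordSum_mul_weight (s : Finset L) (ρ c : L → S) (n : ℕ) (f : List L → S) :
    wordSum s ρ n (fun w => (w.map c).prod * f w) = wordSum s (fun a => ρ a * c a) n f := by
  induction n generalizing f with
  | zero => simp [wordSum]
  | succ n ih =>
    simp only [wordSum, List.map_cons, List.prod_cons, mul_assoc, wordSum_mul_left, ih]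

theorem wordSum_const_mul_weight (s : Finset L) (ρ : L → S) (c : S) (n : ℕ) (f : List L → S) :
    wordSum s (fun a => c * ρ a) n f = c ^ n * wordSum s ρ n f := by
  induction n generalizing f with
  | zero => simp [wordSum]
  | succ n ih =>
    simp only [wordSum, ih, Finset.mul_sum]
    exact Finset.sum_congr rfl fun a _ => by ring

end Rescale

/-! ### Characters -/

section Characters

theorem quasiShuffleMul_single {L : Type*} (dia : L → L → (L →₀ ℚ)) (w v : List L) :
    quasiShuffleMul dia (Finsupp.single w 1) (Finsupp.single v 1) = quasiShuffle dia w v := by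
  simp [quasiShuffleMul]

variable {S : Type*} [CommRing S] [Algebra ℚ S] {dia : ℕ+ → ℕ+ → (ℕ+ →₀ ℚ)} {Z : Mould ℚ}

theorem Mould.IsDiaSymmetril.map_nil (h : Z.IsDiaSymmetril dia) :
    algebraMap ℚ S (Z.coeff []) = 1 := by
  have := h.1
  rw [Mould.coeffMap, Finsupp.linearCombination_single, one_smul] at this
  rw [this, map_one]

theorem Mould.IsDiaSymmetril.map_shuffle (h : Z.IsDiaSymmetril dia) (a : ℕ+) (w : List ℕ+) :
    Finsupp.linearCombination ℚ (fun w => algebraMap ℚ S (Z.coeff w)) (quasiShuffle dia [a] w) =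
      algebraMap ℚ S (Z.coeff [a]) * algebraMap ℚ S (Z.coeff w) := by
  have h1 := h.2 (Finsupp.single [a] 1) (Finsupp.single w 1)
  rw [quasiShuffleMul_single, Mould.coeffMap, Finsupp.linearCombination_single,
    Finsupp.linearCombination_single, one_smul, one_smul] at h1
  rw [← map_mul, ← h1]
  exact (Finsupp.apply_linearCombination ℚ (Algebra.linearMap ℚ S) Z.coeff _).symm

theorem Mould.IsSymmetril.hasLogDeriv (h : Z.IsSymmetril) (s : Finset ℕ+) (ρ : ℕ+ → S) :
    HasLogDeriv (wordSeries s ρ fun w => algebraMap ℚ S (Z.coeff w))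
      (altSeries fun n => letterSum s ρ (n - 1) fun a => algebraMap ℚ S (Z.coeff [a])) :=
  hasLogDeriv_wordSeries_stuffle s ρ _ h.map_nil h.map_shuffle

theorem Mould.IsSymmetral.hasLogDeriv (h : Z.IsSymmetral) (s : Finset ℕ+) (ρ : ℕ+ → S) :
    HasLogDeriv (wordSeries s ρ fun w => algebraMap ℚ S (Z.coeff w))
      (altSeries fun n => if n = 1 then ∑ a ∈ s, ρ a * algebraMap ℚ S (Z.coeff [a]) else 0) :=
  hasLogDeriv_wordSeries_shuffle s ρ _ h.map_nil h.map_shuffle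

end Characters

/-! ### The depth one part of `β_γ` -/

section Gamma

variable {A : Type*} [CommRing A]

theorem Mould.sharp_one (Z : Mould A) : Z.sharp 1 = Z 1 := by
  rw [Mould.sharp, Z.eval_of_length (List.length_ofFn)]
  have : (fun i : Fin 1 => (List.ofFn fun i : Fin 1 => ∑ j ∈ Finset.Iic i.rev,
      (MvPowerSeries.X j : MvPowerSeries (Fin 1) A)).get (i.cast List.length_ofFn.symm)) =
      MvPowerSeries.X := by
    funext i
    have h : Finset.Iic i.rev = {i} := by
      ext x
      simp [Subsingleton.elim x i, Subsingleton.elim i.rev i]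
    rw [List.get_ofFn, Fin.cast_cast, Fin.cast_eq_self, h, Finset.sum_singleton]
  rw [this, MvPowerSeries.subst_self]
  rfl

theorem Mould.coeff_singleton_mul_const (Z : Mould A) (F : PowerSeries A) (a : ℕ+)
    (h0 : PowerSeries.coeff 0 F = 1) (h1 : PowerSeries.coeff 1 F = 0) :
    (Z.mul (Mould.const F)).coeff [a] = Z.coeff [a] := by
  have h : (Z.mul (Mould.const F)) 1 = Z 1 := by
    rw [Mould.mul, Finset.sum_range_succ, Finset.sum_range_one]
    have e1 : (Mould.const F).eval ((vars A 1).drop 0) = (0 : MvPowerSeries (Fin 1) A) := by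
      rw [Mould.eval_of_length (n := 1) _ (by simp [vars]), Mould.const, h1, MvPowerSeries.subst_C,
        map_zero]
    have e2 : (Mould.const F).eval ((vars A 1).drop 1) = (1 : MvPowerSeries (Fin 1) A) := by
      rw [Mould.eval_of_length (n := 0) _ (by simp [vars]), Mould.const, h0, MvPowerSeries.subst_C,
        map_one]
    have e3 : Z.eval ((vars A 1).take 1) = Z 1 := by
      rw [Z.eval_of_length (n := 1) (by simp [vars])]
      have : (fun i : Fin 1 => ((vars A 1).take 1).get (i.cast (by simp [vars]))) =
        MvPowerSeries.X := by
        funext i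
        simp [vars, Subsingleton.elim i 0]
      rw [this, MvPowerSeries.subst_self]
      rfl
    rw [e1, e2, e3, mul_zero, zero_add, mul_one]
  rw [Mould.coeff, Mould.coeff]
  exact congrArg _ h

theorem Mould.coeff_Gamma [Algebra ℚ A] (Z : Mould A) :
    PowerSeries.coeff 0 Z.Gamma = 1 ∧ PowerSeries.coeff 1 Z.Gamma = 0 := by
  rw [Mould.Gamma]
  set F : PowerSeries A := PowerSeries.mk fun n : ℕ =>
    if 2 ≤ n then ((-1 : ℚ) ^ n / n) • Z.coeff [n.toPNat'] else 0 with hF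
  obtain ⟨G, hG⟩ : PowerSeries.X ^ 2 ∣ F :=
    PowerSeries.X_pow_dvd_iff.2 fun n hn => by simp [hF, Nat.not_le.2 hn]
  have hF0 : PowerSeries.constantCoeff F = 0 := by rw [hG]; simp
  have hS : PowerSeries.HasSubst F := PowerSeries.HasSubst.of_constantCoeff_zero hF0
  have h (n : ℕ) (hn : n < 2) (i : ℕ) (hi : i ≠ 0) : PowerSeries.coeff n (F ^ i) = 0 := by
    obtain ⟨i, rfl⟩ := Nat.exists_eq_succ_of_ne_zero hi
    have : PowerSeries.X ^ 2 ∣ F ^ (i + 1) := (Dvd.intro _ hG.symm).trans (dvd_pow_self F hi)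
    exact PowerSeries.X_pow_dvd_iff.1 this n hn
  constructor
  · rw [PowerSeries.coeff_subst' hS, finsum_eq_single _ 0 fun i hi => by
      rw [h 0 (by omega) i hi, smul_zero]]
    simp
  · rw [PowerSeries.coeff_subst' hS, finsum_eq_single _ 0 fun i hi => by
      rw [h 1 (by omega) i hi, smul_zero]]
    simp [PowerSeries.coeff_one]

/-- The factor Γ^Z is 1 + O(T²) and ♯ is trivial in depth one, so the passage to Z_γ is not felt
there. -/
theorem Mould.coeff_gamma_singleton [Algebra ℚ A] (Z : Mould A) (a : ℕ+) :
    Z.gamma.coeff [a] = Z.coeff [a] := by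
  rw [Mould.gamma, Mould.coeff_singleton_mul_const _ _ _ Z.coeff_Gamma.1 Z.coeff_Gamma.2,
    Mould.coeff, Mould.coeff]
  exact congrArg _ Z.sharp_one

end Gamma

/-! ### Logarithmic derivatives of the word series of 𝔟 and 𝔟̃ -/

section WordSeries

variable {S : Type*} [CommRing S] (s : Finset (ℕ+ × ℕ)) (ρ : ℕ+ × ℕ → S)

/-- The letters `z_a` that come from the variables `X`. -/
def lettersX (s : Finset (ℕ+ × ℕ)) : Finset ℕ+ := (s.filter fun a => a.2 = 0).image Prod.fst

/-- The letters `z_{δ + 1}` that come from the variables `Y`. -/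
def lettersY (s : Finset (ℕ+ × ℕ)) : Finset ℕ+ :=
  (s.filter fun a => a.1 = 1).image fun a => a.2.succPNat

theorem sum_lettersX (g : ℕ+ → S) :
    ∑ a ∈ s, (if a.2 = 0 then ρ a * g a.1 else 0) = ∑ b ∈ lettersX s, ρ (b, 0) * g b := by
  rw [← Finset.sum_filter, lettersX, Finset.sum_image]
  · refine Finset.sum_congr rfl fun a ha => ?_
    rw [← (Finset.mem_filter.1 ha).2]
  · intro a ha b hb h
    exact Prod.ext h ((Finset.mem_filter.1 ha).2.trans (Finset.mem_filter.1 hb).2.symm)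

theorem sum_lettersY (g : ℕ+ → S) :
    ∑ a ∈ s, (if a.1 = 1 then ρ a * g a.2.succPNat else 0) =
      ∑ b ∈ lettersY s, ρ (1, b.natPred) * g b := by
  rw [← Finset.sum_filter, lettersY, Finset.sum_image]
  · refine Finset.sum_congr rfl fun a ha => ?_
    rw [Nat.natPred_succPNat, ← (Finset.mem_filter.1 ha).2]
  · intro a ha b hb h
    exact Prod.ext ((Finset.mem_filter.1 ha).2.trans (Finset.mem_filter.1 hb).2.symm)
      (Nat.succPNat_injective h)

theorem wordSum_singleton {L : Type*} (c : L) (ρ : L → S) (n : ℕ) (f : List L → S) :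
    wordSum {c} ρ n f = ρ c ^ n * f (List.replicate n c) := by
  induction n generalizing f with
  | zero => simp [wordSum]
  | succ n ih =>
    rw [wordSum, Finset.sum_singleton, ih, List.replicate_succ]
    ring

variable [Algebra ℚ S]

theorem wordSeries_toX (Z : Mould ℚ) :
    wordSeries s ρ (fun w => algebraMap ℚ S (Z.toX.bicoeff w)) =
      wordSeries (lettersX s) (fun b => ρ (b, 0)) fun w => algebraMap ℚ S (Z.coeff w) := by
  ext n
  rw [wordSeries, wordSeries, PowerSeries.coeff_mk, PowerSeries.coeff_mk,
    ← wordSum_map (sum_lettersX s ρ)]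
  refine wordSum_congr s ρ n fun w _ => ?_
  rw [Mould.bicoeff_toX, apply_ite (algebraMap ℚ S), map_zero]

theorem wordSeries_toY (Z : Mould ℚ) :
    wordSeries s ρ (fun w => algebraMap ℚ S (Z.toY.bicoeff w)) =
      wordSeries (lettersY s) (fun b => ρ (1, b.natPred)) fun w => algebraMap ℚ S (Z.coeff w) := by
  ext n
  rw [wordSeries, wordSeries, PowerSeries.coeff_mk, PowerSeries.coeff_mk,
    ← wordSum_map (sum_lettersY s ρ)]
  refine wordSum_congr s ρ n fun w _ => ?_
  rw [Mould.bicoeff_toY, apply_ite (algebraMap ℚ S), map_zero]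

theorem hasLogDeriv_toX {Z : Mould ℚ} (hZ : Z.IsSymmetril) :
    HasLogDeriv (wordSeries s ρ fun w => algebraMap ℚ S (Z.toX.bicoeff w))
      (altSeries fun n => letterSum (lettersX s) (fun b => ρ (b, 0)) (n - 1)
        fun a => algebraMap ℚ S (Z.coeff [a])) := by
  rw [wordSeries_toX]
  exact hZ.hasLogDeriv _ _

theorem hasLogDeriv_toY {Z : Mould ℚ} (hZ : Z.IsSymmetral) :
    HasLogDeriv (wordSeries s ρ fun w => algebraMap ℚ S (Z.toY.bicoeff w))
      (altSeries fun n => if n = 1 then ∑ a ∈ s, (if a.1 = 1 then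
        ρ a * algebraMap ℚ S (Z.coeff [a.2.succPNat]) else 0) else 0) := by
  rw [wordSeries_toY, sum_lettersY s ρ fun a => algebraMap ℚ S (Z.coeff [a])]
  exact hZ.hasLogDeriv _ _

/-- The signs of Z^- are multiplicative over letters and move into the weights, so symmetrality of Z
itself is enough. -/
theorem hasLogDeriv_minus_toY {Z : Mould ℚ} (hZ : Z.IsSymmetral) :
    HasLogDeriv (wordSeries s ρ fun w => algebraMap ℚ S (Z.minus.toY.bicoeff w))
      (altSeries fun n => if n = 1 then ∑ a ∈ s, (if a.1 = 1 then
        ρ a * ((-1) ^ a.2 * algebraMap ℚ S (Z.coeff [a.2.succPNat])) else 0) else 0) := by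
  have h := hZ.hasLogDeriv (lettersY s) fun b => ρ (1, b.natPred) * (-1) ^ b.natPred
  have h1 := sum_lettersY s ρ fun a => (-1) ^ a.natPred * algebraMap ℚ S (Z.coeff [a])
  simp only [Nat.natPred_succPNat] at h1
  simp only [mul_assoc, ← h1] at h
  convert! h using 1
  rw [wordSeries_toY]
  ext n
  rw [wordSeries, wordSeries, PowerSeries.coeff_mk, PowerSeries.coeff_mk, ← wordSum_mul_weight]
  refine wordSum_congr _ _ n fun w _ => ?_
  rw [Mould.coeff_minus, map_mul, map_list_prod, List.map_map]
  congr 3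
  funext a
  simp

theorem hasLogDeriv_exp (c : S) :
    HasLogDeriv (PowerSeries.rescale c (PowerSeries.exp S))
      (altSeries fun n => if n = 1 then c else 0) := by
  have h : HasLogDeriv (PowerSeries.exp S) (altSeries fun n => if n = 1 then 1 else 0) := by
    refine ⟨by simp, ?_⟩
    ext n
    rcases n with _ | n
    · simp [theta, constantCoeff_altSeries]
    have hX : (altSeries fun n => if n = 1 then 1 else 0 : PowerSeries S) = PowerSeries.X := by
      ext n
      rcases n with _ | _ | n <;> simp [altSeries, PowerSeries.coeff_X]
    rw [hX, PowerSeries.coeff_succ_mul_X, theta, PowerSeries.coeff_mk, PowerSeries.coeff_exp,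
      PowerSeries.coeff_exp, ← map_natCast (algebraMap ℚ S), ← map_mul]
    congr 1
    rw [Nat.factorial_succ]
    push_cast
    field_simp
  have h1 := h.rescale c
  rw [rescale_altSeries] at h1
  convert! h1 using 2
  funext n
  split_ifs with hn
  · rw [hn, pow_one, mul_one]
  · rw [mul_zero]

theorem hasLogDeriv_const_exp (c : ℚ) :
    HasLogDeriv (wordSeries s ρ fun w => algebraMap ℚ S
      ((Bimould.const (PowerSeries.rescale c (PowerSeries.exp ℚ))).bicoeff w))
      (altSeries fun n => if n = 1 then ∑ a ∈ s, (if a = (1, 0) then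
        ρ a * algebraMap ℚ S c else 0) else 0) := by
  convert! hasLogDeriv_exp (∑ a ∈ s, if a = (1, 0) then ρ a * algebraMap ℚ S c else 0) using 1
  ext n
  have h (g : Unit → S) : ∑ a ∈ s, (if a = (1, 0) then ρ a * g () else 0) =
      ∑ b ∈ {()}, (∑ a ∈ s, if a = (1, 0) then ρ a else 0) * g b := by
    rw [Finset.sum_singleton, Finset.sum_mul]
    exact Finset.sum_congr rfl fun a _ => by rw [ite_mul, zero_mul]
  have h2 := wordSum_map h n fun w => algebraMap ℚ S
    (PowerSeries.coeff w.length (PowerSeries.rescale c (PowerSeries.exp ℚ)))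
  simp only [List.length_map] at h2
  rw [wordSeries, PowerSeries.coeff_mk]
  simp only [Bimould.bicoeff_const, apply_ite (algebraMap ℚ S), map_zero]
  rw [h2, wordSum_singleton, List.length_replicate, PowerSeries.coeff_rescale,
    PowerSeries.coeff_rescale, map_mul, map_pow, ← mul_assoc, ← mul_pow, Finset.sum_mul,
    PowerSeries.coeff_exp, PowerSeries.coeff_exp, Algebra.algebraMap_self, RingHom.id_apply]
  simp only [ite_mul, zero_mul]

theorem wordSeries_mul (B C : Bimould ℚ) :
    wordSeries s ρ (fun w => algebraMap ℚ S ((B.mul C).bicoeff w)) =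
      wordSeries s ρ (fun w => algebraMap ℚ S (B.bicoeff w)) *
        wordSeries s ρ fun w => algebraMap ℚ S (C.bicoeff w) := by
  rw [← wordSeries_deconc]
  congr 1
  funext w
  rw [Bimould.bicoeff_mul, deconc, deconc, map_sum]
  simp only [map_mul]

theorem hasLogDeriv_bimouldB {β : Mould ℚ} (hβ : β.SatisfiesEDS) :
    HasLogDeriv (wordSeries s ρ fun w => algebraMap ℚ S ((bimouldB β).bicoeff w))
      (altSeries fun n => (if n = 1 then ∑ a ∈ s, (if a.1 = 1 then
        ρ a * algebraMap ℚ S (β.coeff [a.2.succPNat]) else 0) else 0) +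
        letterSum (lettersX s) (fun b => ρ (b, 0)) (n - 1)
          fun a => algebraMap ℚ S (β.coeff [a])) := by
  have h := (hasLogDeriv_toY s ρ hβ.2).mul (hasLogDeriv_toX s ρ hβ.1)
  rw [← wordSeries_mul, altSeries_add] at h
  simp only [Mould.coeff_gamma_singleton] at h
  exact h

theorem hasLogDeriv_bimouldBTilde {β : Mould ℚ} (hβ : β.SatisfiesEDS) :
    HasLogDeriv (wordSeries s ρ fun w => algebraMap ℚ S ((bimouldBTilde β).bicoeff w))
      (altSeries fun n => (if n = 1 then ∑ a ∈ s, (if a.1 = 1 then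
        ρ a * ((-1) ^ a.2 * algebraMap ℚ S (β.coeff [a.2.succPNat])) else 0) else 0) +
        (if n = 1 then ∑ a ∈ s, (if a = (1, 0) then
          ρ a * algebraMap ℚ S (-1 / 2) else 0) else 0) +
        letterSum (lettersX s) (fun b => ρ (b, 0)) (n - 1)
          fun a => algebraMap ℚ S (β.coeff [a])) := by
  have h := ((hasLogDeriv_minus_toY s ρ hβ.2).mul (hasLogDeriv_const_exp s ρ (-1 / 2))).mul
    (hasLogDeriv_toX s ρ hβ.1)
  rw [← wordSeries_mul, ← wordSeries_mul, altSeries_add, altSeries_add] at h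
  simp only [Mould.coeff_gamma_singleton] at h
  exact h

/-- In the product of the generating series of `𝔟` and `𝔟̃` the variables `Y` drop out. -/
theorem hasLogDeriv_bimouldB_mul_tilde {β : Mould ℚ} (hβ : β.SatisfiesEDS)
    (hβ_one : ∀ k : ℕ+, β.coeff [k] =
      if k = 1 then 0 else -(bernoulli (k : ℕ) / (2 * (Nat.factorial (k : ℕ) : ℚ)))) :
    HasLogDeriv (wordSeries s ρ (fun w => algebraMap ℚ S ((bimouldB β).bicoeff w)) *
      wordSeries s ρ fun w => algebraMap ℚ S ((bimouldBTilde β).bicoeff w))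
      (altSeries fun n => (if n = 1 then ∑ a ∈ s, (if a = (1, 0) then
          ρ a * algebraMap ℚ S (-1 / 2) else 0) else 0) +
        2 * letterSum (lettersX s) (fun b => ρ (b, 0)) (n - 1)
          fun a => algebraMap ℚ S (β.coeff [a])) := by
  have h := (hasLogDeriv_bimouldB s ρ hβ).mul (hasLogDeriv_bimouldBTilde s ρ hβ)
  rw [altSeries_add] at h
  convert! h using 2
  funext n
  -- The letter (1, δ) contributes (1 + (-1)^δ) β(δ+1): the sign kills it for odd δ, and the
  -- vanishing of β at odd arguments for even δ.
  have h0 : ∑ a ∈ s, (if a.1 = 1 then ρ a * algebraMap ℚ S (β.coeff [a.2.succPNat]) else 0) +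
      ∑ a ∈ s, (if a.1 = 1 then
        ρ a * ((-1) ^ a.2 * algebraMap ℚ S (β.coeff [a.2.succPNat])) else 0) = 0 := by
    rw [← Finset.sum_add_distrib]
    refine Finset.sum_eq_zero fun a _ => ?_
    split_ifs
    · rcases Nat.even_or_odd a.2 with ha | ha
      · have : β.coeff [a.2.succPNat] = 0 := by
          rw [hβ_one]
          split_ifs with h1
          · rfl
          · rw [bernoulli_eq_zero_of_odd, zero_div, neg_zero]
            · exact ha.add_one
            · have h2 : a.2.succPNat ≠ 1 := h1
              rw [Ne, ← PNat.coe_eq_one_iff, Nat.succPNat_coe] at h2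
              rw [Nat.succPNat_coe]
              omega
        rw [this, map_zero]
        simp
      · rw [ha.neg_one_pow]
        ring
    · simp
  simp only [Pi.add_apply]
  split_ifs
  · linear_combination -h0
  · ring

end WordSeries

/-! ### The diagonal series of a bimould -/

section Diagonal

variable {A : Type*} [CommRing A]

/-- The generating series of the coefficients of `B` at the words `z^k_d ⋯ z^k_d`. -/
def Bimould.diag (B : Bimould A) (k : ℕ+) (d : ℕ) : PowerSeries A :=
  wordSeries {(k, d)} (fun _ => (d ! : A)) B.bicoeff

theorem Bimould.coeff_diag (B : Bimould A) (k : ℕ+) (d r : ℕ) :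
    PowerSeries.coeff r (B.diag k d) =
      (d ! : A) ^ r * MvPowerSeries.coeff (biExp fun _ : Fin r => (k, d)) (B r) := by
  rw [Bimould.diag, wordSeries, PowerSeries.coeff_mk, wordSum_singleton,
    B.bicoeff_of_length List.length_replicate]
  simp

theorem Bimould.coeff_replicate (B : Bimould A) (k : ℕ+) (d r : ℕ) :
    B.coeff (List.replicate r (k, d)) = PowerSeries.coeff r (B.diag k d) := by
  rw [Bimould.coeff_eq, Bimould.diag, wordSeries, PowerSeries.coeff_mk, wordSum_singleton]
  simp

end Diagonal

/-! ### The diagonal series of `𝔏_m` -/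

section DiagonalL

theorem coeff_bimouldL_summand (B C : Bimould ℚ) (k : ℕ+) (d : ℕ) {m : ℕ} (hm : m ≠ 0)
    {r : ℕ} (j : Fin r) :
    MvPowerSeries.coeff (biExp fun _ : Fin r => (k, d))
      (B.eval (((bivars (PowerSeries ℚ) r).take (j : ℕ)).map
          fun p => (p.1 - MvPowerSeries.X (Sum.inl j), p.2)) *
        seriesL m (MvPowerSeries.X (Sum.inl j)) (∑ i : Fin r, MvPowerSeries.X (Sum.inr i)) *
        C.eval (((bivars (PowerSeries ℚ) r).drop ((j : ℕ) + 1)).reverse.map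
          fun p => (p.1 - MvPowerSeries.X (Sum.inl j), p.2))) =
      coeffMulMap k (PowerSeries.C (algebraMap ℚ (PowerSeries ℚ) ((m : ℚ) ^ d / (d ! : ℚ))) *
          lambertKernel m hm)
        (wordSum (letterBox k d) (letterWeight k d m) j (fun w => algebraMap ℚ _ (B.bicoeff w)) *
          wordSum (letterBox k d) (letterWeight k d m) (r - 1 - j)
            fun w => algebraMap ℚ _ (C.bicoeff w)) := by
  obtain ⟨a, ha⟩ : ∃ a, a = (j : ℕ) := ⟨_, rfl⟩
  obtain ⟨b, hb⟩ : ∃ b, r = a + (b + 1) := ⟨r - 1 - j, by have := j.2; omega⟩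
  subst hb
  obtain rfl : j = Fin.natAdd a 0 := Fin.ext (by simp [← ha])
  have h := coeff_eval_mul_seriesL_mul_eval B C k d hm a b
  have h1 : a + (b + 1) - 1 - a = b := by omega
  simp only [Fin.val_natAdd, Fin.val_zero, add_zero, h1]
  exact h

/-- The weight of the letter `(a, δ)` in the normalised diagonal coefficients. -/
def diagWeight (k : ℕ+) (d m : ℕ) (a : ℕ+ × ℕ) : PowerSeries ℚ :=
  binomWeight k ((m : ℚ) ^ (d - a.2) * (d.descFactorial a.2 : ℚ)) a.1

theorem C_factorial_mul_letterWeight (k : ℕ+) (d m : ℕ) (a : ℕ+ × ℕ) :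
    PowerSeries.C (d ! : ℚ) * letterWeight k d m a = diagWeight k d m a := by
  rw [letterWeight, diagWeight, binomWeight, binomWeight, ← mul_assoc, ← map_mul, ← mul_assoc,
    ← mul_assoc]
  split_ifs with h
  · rw [Nat.descFactorial_eq_div h, Nat.cast_div (Nat.factorial_dvd_factorial (by omega))
      (by positivity)]
    congr 4
    ring
  · rw [Nat.descFactorial_of_lt (by omega)]
    simp

/-- The sum over the distinguished position j is a Cauchy product. Of the n + 1 factors d!, n turn
`letterWeight` into `diagWeight`, and the last one cancels the denominator of m^d/d!. -/
theorem coeff_succ_diag_bimouldL (β : Mould ℚ) (k : ℕ+) (d : ℕ) {m : ℕ} (hm : m ≠ 0) (n : ℕ) :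
    PowerSeries.coeff (n + 1) ((bimouldL β m).diag k d) =
      algebraMap ℚ (PowerSeries ℚ) ((m : ℚ) ^ d) * coeffMulMap k (lambertKernel m hm)
        (PowerSeries.coeff n
          (wordSeries (letterBox k d) (diagWeight k d m)
              (fun w => algebraMap ℚ _ ((bimouldB β).bicoeff w)) *
            wordSeries (letterBox k d) (diagWeight k d m)
              fun w => algebraMap ℚ _ ((bimouldBTilde β).bicoeff w))) := by
  rw [Bimould.coeff_diag, bimouldL, if_neg (by omega), map_sum, PowerSeries.coeff_mul,
    Finset.Nat.sum_antidiagonal_eq_sum_range_succ_mk, Finset.sum_range, map_sum, Finset.mul_sum,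
    Finset.mul_sum]
  refine Finset.sum_congr rfl fun j _ => ?_
  have hd : diagWeight k d m = fun a => PowerSeries.C (d ! : ℚ) * letterWeight k d m a :=
    funext fun a => (C_factorial_mul_letterWeight k d m a).symm
  rw [coeff_bimouldL_summand _ _ k d hm, hd]
  simp only [wordSeries, PowerSeries.coeff_mk, wordSum_const_mul_weight, Nat.add_sub_cancel]
  set x := wordSum (letterBox k d) (letterWeight k d m) (j : ℕ)
    fun w => algebraMap ℚ (PowerSeries ℚ) ((bimouldB β).bicoeff w)
  set y := wordSum (letterBox k d) (letterWeight k d m) (n - j)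
    fun w => algebraMap ℚ (PowerSeries ℚ) ((bimouldBTilde β).bicoeff w)
  have h1 : PowerSeries.C (d ! : ℚ) ^ (j : ℕ) * x * (PowerSeries.C (d ! : ℚ) ^ (n - j) * y) =
      ((d ! : ℚ) ^ n) • (x * y) := by
    have h2 : (d ! : ℚ) ^ n = (d ! : ℚ) ^ (j : ℕ) * (d ! : ℚ) ^ (n - j) := by
      rw [← pow_add]
      congr 1
      omega
    rw [h2, PowerSeries.smul_eq_C_mul, map_mul, map_pow, map_pow]
    ring
  rw [h1, map_smul, coeffMulMap_apply, coeffMulMap_apply, mul_assoc, PowerSeries.coeff_C_mul,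
    Algebra.smul_def, ← mul_assoc, ← mul_assoc, ← map_natCast (algebraMap ℚ (PowerSeries ℚ)),
    ← map_pow, ← map_mul, ← map_mul]
  congr 2
  field_simp
  rw [pow_succ']

/-- The kernel is ∑_{l ≥ 1} e^{lZ} q^(ml), so the functional yields the coefficients of
`residueSeries` at t = q^m. -/
theorem coeffMulMap_lambertKernel (k : ℕ+) {m : ℕ} (hm : m ≠ 0) (V : PowerSeries (PowerSeries ℚ))
    (n : ℕ) : coeffMulMap k (lambertKernel m hm) (PowerSeries.coeff n V) =
      PowerSeries.expand m hm (PowerSeries.coeff (n + 1) (residueSeries k V)) := by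
  rw [coeffMulMap_apply, residueSeries, PowerSeries.coeff_mk, if_neg (by omega), Nat.add_sub_cancel,
    PowerSeries.coeff_mul]
  have : (PowerSeries.mk fun l => if l = 0 then 0 else PowerSeries.coeff ((k : ℕ) - 1)
      (PowerSeries.exp ℚ ^ l * PowerSeries.coeff n V) : PowerSeries ℚ) =
      ∑ p ∈ Finset.HasAntidiagonal.antidiagonal ((k : ℕ) - 1),
        powerSumSeries ℚ p.1 * PowerSeries.C (PowerSeries.coeff p.2 (PowerSeries.coeff n V)) := by
    ext l
    rw [PowerSeries.coeff_mk, map_sum]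
    simp only [PowerSeries.coeff_mul_C, powerSumSeries, PowerSeries.coeff_mk]
    split_ifs
    · simp
    · rw [PowerSeries.coeff_mul]
      refine Finset.sum_congr rfl fun p _ => ?_
      rw [PowerSeries.exp_pow_eq_rescale_exp, PowerSeries.coeff_rescale, PowerSeries.coeff_exp]
      simp [div_eq_mul_inv]
  rw [this, map_sum]
  refine Finset.sum_congr rfl fun p _ => ?_
  rw [map_mul, PowerSeries.expand_C, lambertKernel, PowerSeries.coeff_mk, PowerSeries.coeff_map,
    PowerSeries.algebraMap_apply]
  rfl

theorem coeffMulMap_congr (k : ℕ+) (U : PowerSeries (PowerSeries ℚ)) {x y : PowerSeries ℚ}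
    (h : x - y ∈ Ideal.span {(PowerSeries.X : PowerSeries ℚ) ^ (k : ℕ)}) :
    coeffMulMap k U x = coeffMulMap k U y := by
  obtain ⟨z, hz⟩ := Ideal.mem_span_singleton.1 h
  rw [← sub_eq_zero, ← map_sub, hz, coeffMulMap_apply, map_mul (PowerSeries.map _), map_pow,
    PowerSeries.map_X, mul_left_comm, PowerSeries.coeff_X_pow_mul',
    if_neg (by have := k.pos; omega)]

end DiagonalL

theorem lettersX_letterBox (k : ℕ+) (d : ℕ) :
    lettersX (letterBox k d) = Finset.Icc 1 (2 * k - 1) := by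
  ext a
  simp [lettersX, letterBox]

theorem mem_Icc_of_lt {k a : ℕ+} (h : (a : ℕ) < 2 * k) : a ∈ Finset.Icc 1 (2 * k - 1) := by
  rw [Finset.mem_Icc]
  refine ⟨one_le, ?_⟩
  have := k.pos
  have h1 : ((2 * k : ℕ+) : ℕ) = 2 * k := by rw [PNat.mul_coe]; rfl
  rw [← PNat.coe_le_coe, PNat.sub_coe, if_pos, h1, PNat.one_coe]
  · omega
  · rw [← PNat.coe_lt_coe, h1, PNat.one_coe]
    omega

theorem diagWeight_zero (k : ℕ+) (d m : ℕ) :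
    (fun b => diagWeight k d m (b, 0)) = binomWeight k ((m : ℚ) ^ d) := by
  funext b
  simp [diagWeight]

theorem diagWeight_one_zero (k : ℕ+) (d m : ℕ) :
    diagWeight k d m (1, 0) = if k = 1 then PowerSeries.C ((m : ℚ) ^ d) else 0 := by
  rw [diagWeight, binomWeight]
  split_ifs with hk
  · simp [hk]
  · rw [Nat.choose_eq_zero_of_lt]
    · simp
    · have h1 : (k : ℕ) ≠ 1 := fun h => hk (PNat.eq h)
      have := k.pos
      simp
      omega

/-- The coefficients of the logarithmic derivative of the product of the generating series of `𝔟`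
and `𝔟̃` are those of `toddCoeff`, modulo `Z^k`. -/
theorem coeff_logDeriv_eq_toddCoeff {β : Mould ℚ} (hβ_one : ∀ k : ℕ+, β.coeff [k] =
      if k = 1 then 0 else -(bernoulli (k : ℕ) / (2 * (Nat.factorial (k : ℕ) : ℚ))))
    (k : ℕ+) (d m : ℕ) {n : ℕ} (hn : n ≠ 0) {j : ℕ} (hj : j < k) :
    PowerSeries.coeff j ((if n = 1 then ∑ a ∈ letterBox k d, (if a = (1, 0) then
          diagWeight k d m a * algebraMap ℚ (PowerSeries ℚ) (-1 / 2) else 0) else 0) +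
        2 * letterSum (lettersX (letterBox k d)) (fun b => diagWeight k d m (b, 0)) (n - 1)
          fun a => algebraMap ℚ (PowerSeries ℚ) (β.coeff [a])) =
      PowerSeries.coeff j (PowerSeries.C ((m : ℚ) ^ d) ^ n * toddCoeff k n) := by
  obtain ⟨n, rfl⟩ := Nat.exists_eq_succ_of_ne_zero hn
  have h10 : ((1, 0) : ℕ+ × ℕ) ∈ letterBox k d := by
    have := k.pos
    exact Finset.mem_product.2 ⟨mem_Icc_of_lt (by rw [PNat.one_coe]; omega),
      Finset.mem_range.2 d.succ_pos⟩
  have hC : algebraMap ℚ (PowerSeries ℚ) = PowerSeries.C := rfl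
  have h2 : (2 : PowerSeries ℚ) = PowerSeries.C 2 := (map_ofNat PowerSeries.C 2).symm
  rw [Finset.sum_ite_eq' _ (1, 0), if_pos h10, lettersX_letterBox, diagWeight_zero,
    diagWeight_one_zero, hC, map_add, h2, PowerSeries.coeff_C_mul, Nat.succ_eq_add_one,
    Nat.add_sub_cancel, coeff_letterSum_binomWeight k _ _ (fun a _ h => mem_Icc_of_lt h) n
      (fun a => β.coeff [a]) hj, ← map_pow, PowerSeries.coeff_C_mul, toddCoeff,
    PowerSeries.coeff_mk]
  have hk := k.pos
  have hpos : 0 < (n + 1) * (k : ℕ) := by positivity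
  have hch : ((n + 1) * (k : ℕ) - 1 + j).choose ((n + 1) * k - 1) =
      ((n + 1) * (k : ℕ) - 1 + j).choose j := by
    rw [Nat.choose_symm_add]
  have hi : (n + 1) * (k : ℕ) - 1 + j + 1 = (n + 1) * k + j := by omega
  have hto : ((((n + 1) * (k : ℕ) + j).toPNat' : ℕ+) : ℕ) = (n + 1) * k + j := by
    rw [Nat.toPNat'_coe, if_pos (by omega)]
  rw [hch, hi, hβ_one]
  -- Only for total weight 1 does the factor exp(-T/2) of 𝔟̃ enter: β(1) = 0, and -1/2 supplies the
  -- missing Bernoulli term. In all other cases 2β(w) is already the required value.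
  by_cases h1 : (n + 1) * (k : ℕ) + j = 1
  · have hk1 : k = 1 := PNat.eq (by rw [PNat.one_coe]; nlinarith)
    subst hk1
    have hj0 : j = 0 := by simpa using hj
    have hn0 : n = 0 := by simpa [hj0] using h1
    subst hj0 hn0
    have h3 : Nat.toPNat' 1 = 1 := rfl
    simp [h3]
    ring
  · have h3 : ((n + 1) * (k : ℕ) + j).toPNat' ≠ 1 := fun h => h1 (by rw [← hto, h]; rfl)
    rw [if_neg h3, hto, bernoulli_eq_bernoulli'_of_ne_one h1]
    have h0 : PowerSeries.coeff j (if n + 1 = 1 then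
        (if k = 1 then PowerSeries.C ((m : ℚ) ^ d) else 0) * PowerSeries.C (-1 / 2) else 0) = 0 := by
      split_ifs with hn1 hk1
      · rw [hn1, hk1] at h1
        rw [← map_mul, PowerSeries.coeff_C, if_neg]
        rintro rfl
        exact h1 rfl
      · simp
      · simp
    rw [h0]
    field_simp
    ring

/-- The word series of 𝔟 times that of 𝔟̃ agrees modulo Z^k with the Todd series in m^d T; its
residue series at t = q^m is therefore the diagonal series of 𝔏_m, with T scaled by m^d. -/
theorem hasLogDeriv_diag_bimouldL {β : Mould ℚ} (hβ : β.SatisfiesEDS)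
    (hβ_one : ∀ k : ℕ+, β.coeff [k] =
      if k = 1 then 0 else -(bernoulli (k : ℕ) / (2 * (Nat.factorial (k : ℕ) : ℚ))))
    (k : ℕ+) (d : ℕ) {m : ℕ} (hm : m ≠ 0) :
    HasLogDeriv ((bimouldL β m).diag k d) (altSeries fun n => PowerSeries.C ((m : ℚ) ^ d) ^ n *
      PowerSeries.expand m hm (powerSumSeries ℚ (n * k - 1))) := by
  obtain ⟨V, hV⟩ := exists_hasLogDeriv (altSeries (toddCoeff k)) (constantCoeff_altSeries _)
  have hV' := hV.rescale (PowerSeries.C ((m : ℚ) ^ d))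
  rw [rescale_altSeries] at hV'
  have hW := hasLogDeriv_bimouldB_mul_tilde (letterBox k d) (diagWeight k d m) hβ hβ_one
  -- A congruence modulo Z^k is enough, because `coeffMulMap` only reads the coefficient of Z^(k-1).
  have hmod := hW.sub_mem (Ideal.span {(PowerSeries.X : PowerSeries ℚ) ^ (k : ℕ)}) hV'
    (constantCoeff_altSeries _) (constantCoeff_altSeries _) fun n => by
      rw [altSeries, altSeries, PowerSeries.coeff_mk, PowerSeries.coeff_mk]
      by_cases hn : n = 0
      · simp [hn]
      · rw [if_neg hn, if_neg hn, ← mul_sub]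
        refine Ideal.mul_mem_left _ _ ?_
        rw [Ideal.mem_span_singleton, PowerSeries.X_pow_dvd_iff]
        intro j hj
        rw [map_sub, sub_eq_zero]
        exact coeff_logDeriv_eq_toddCoeff hβ_one k d m hn hj
  have hU := ((hasLogDeriv_residueSeries k.ne_zero hV).map
    (PowerSeries.expand m hm : PowerSeries ℚ →ₐ[ℚ] PowerSeries ℚ).toRingHom).rescale
      (PowerSeries.C ((m : ℚ) ^ d))
  rw [map_altSeries, rescale_altSeries] at hU
  convert! hU using 1
  ext1 n
  rw [PowerSeries.coeff_rescale, PowerSeries.coeff_map]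
  rcases n with _ | n
  · rw [Bimould.coeff_diag, bimouldL, if_pos rfl, residueSeries, PowerSeries.coeff_mk, if_pos rfl,
      MvPowerSeries.coeff_one, if_pos (Subsingleton.elim _ _), map_one]
    simp
  · rw [coeff_succ_diag_bimouldL β k d hm, coeffMulMap_congr k _ (hmod n), PowerSeries.coeff_rescale,
      ← map_pow, ← PowerSeries.smul_eq_C_mul, map_smul, coeffMulMap_lambertKernel,
      PowerSeries.smul_eq_C_mul, ← mul_assoc, pow_succ', map_pow PowerSeries.C]
    rfl

/-! ### Sums over compositions and decreasing sequences -/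

section Compositions

variable {R : Type*} [CommRing R]

theorem sum_composition_zero (g : List ℕ → R) : ∑ c : Composition 0, g c.blocks = g [] := by
  have h (c : Composition 0) : c.blocks = [] := by
    rcases hb : c.blocks with _ | ⟨x, L⟩
    · rfl
    · have h1 := c.blocks_sum
      have h2 : 0 < x := c.blocks_pos (by rw [hb]; exact List.mem_cons_self)
      rw [hb, List.sum_cons] at h1
      omega
  simp [h, composition_card]

/-- The composition `b + 1, c_1, c_2, …` -/
def consComposition {n : ℕ} (x : Σ b : Fin (n + 1), Composition (n - b)) : Composition (n + 1) where
  blocks := (x.1 + 1 : ℕ) :: x.2.blocks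
  blocks_pos := by
    intro i hi
    rcases List.mem_cons.1 hi with rfl | hi
    · exact Nat.succ_pos _
    · exact x.2.blocks_pos hi
  blocks_sum := by
    rw [List.sum_cons, x.2.blocks_sum]
    have := x.1.2
    omega

theorem consComposition_bijective (n : ℕ) : Function.Bijective (consComposition (n := n)) := by
  constructor
  · rintro ⟨b, c⟩ ⟨b', c'⟩ h
    have h1 := congrArg Composition.blocks h
    simp only [consComposition, List.cons.injEq, Nat.add_right_cancel_iff] at h1
    obtain ⟨h1, h2⟩ := h1
    obtain rfl : b = b' := Fin.ext h1
    rw [Composition.ext h2]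
  · intro c
    obtain ⟨x, L, hL⟩ := List.exists_cons_of_ne_nil (l := c.blocks) fun h => by
      have := c.blocks_sum
      simp [h] at this
    have hsum := c.blocks_sum
    have hx : 0 < x := c.blocks_pos (by rw [hL]; exact List.mem_cons_self)
    rw [hL, List.sum_cons] at hsum
    refine ⟨⟨⟨x - 1, by omega⟩, ⟨L,
      fun hi => c.blocks_pos (by rw [hL]; exact List.mem_cons_of_mem _ hi),
      by simp only; omega⟩⟩, Composition.ext ?_⟩
    refine Eq.trans ?_ hL.symm
    simp only [consComposition]
    rw [Nat.sub_add_cancel hx]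

theorem sum_composition_succ (n : ℕ) (g : List ℕ → R) :
    ∑ c : Composition (n + 1), g c.blocks =
      ∑ b : Fin (n + 1), ∑ c : Composition (n - b), g ((b + 1 : ℕ) :: c.blocks) := by
  rw [← (consComposition_bijective n).sum_comp, Fintype.sum_sigma]
  rfl

/-- The sum of `∏ f (m i) (b i)` over all `M ≥ m_1 > m_2 > ⋯ > 0`. -/
def antiSum (f : ℕ → ℕ → R) : List ℕ → ℕ → R
  | [], _ => 1
  | b :: bs, M => ∑ m ∈ Finset.Icc 1 M, f m b * antiSum f bs (m - 1)

theorem sum_strictAnti_eq_antiSum (f : ℕ → ℕ → R) {l : ℕ} (b : Fin l → ℕ) (M : ℕ) :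
    ∑ m ∈ (Fintype.piFinset fun _ : Fin l => Finset.Icc 1 M) with StrictAnti m,
      ∏ i, f (m i) (b i) = antiSum f (List.ofFn b) M := by
  classical
  induction l generalizing M with
  | zero =>
    rw [Finset.filter_true_of_mem fun m _ i => i.elim0]
    simp [antiSum]
  | succ l ih =>
    rw [List.ofFn_succ, antiSum]
    simp only [← ih, Finset.mul_sum]
    rw [Finset.sum_sigma']
    refine Finset.sum_bij' (fun m _ => ⟨m 0, Fin.tail m⟩) (fun x _ => Fin.cons x.1 x.2)
      ?_ ?_ ?_ ?_ ?_
    · intro m hm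
      obtain ⟨h1, h2⟩ := Finset.mem_filter.1 hm
      rw [Fintype.mem_piFinset] at h1
      refine Finset.mem_sigma.2 ⟨h1 0, Finset.mem_filter.2 ⟨Fintype.mem_piFinset.2 fun i => ?_, ?_⟩⟩
      · have h3 := h2 (Fin.succ_pos i)
        have h4 := Finset.mem_Icc.1 (h1 i.succ)
        exact Finset.mem_Icc.2 ⟨h4.1, by simp only [Fin.tail]; omega⟩
      · exact h2.comp_strictMono (Fin.strictMono_succ)
    · rintro ⟨m₀, m⟩ hm
      obtain ⟨h0, h1⟩ := Finset.mem_sigma.1 hm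
      obtain ⟨h1, h2⟩ := Finset.mem_filter.1 h1
      rw [Fintype.mem_piFinset] at h1
      dsimp only at h0 h1 h2
      have h3 (i : Fin l) : 1 ≤ m i ∧ m i < m₀ := by
        have := Finset.mem_Icc.1 (h1 i)
        omega
      refine Finset.mem_filter.2 ⟨Fintype.mem_piFinset.2 fun i => ?_, ?_⟩
      · refine Fin.cases h0 (fun i => ?_) i
        have h4 := h3 i
        have h5 := Finset.mem_Icc.1 h0
        have h6 : m i ≤ M := by omega
        exact Finset.mem_Icc.2 ⟨h4.1, h6⟩
      · intro i
        refine Fin.cases (fun j => ?_) (fun i j => ?_) i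
        · refine Fin.cases (fun h => absurd h (lt_irrefl _)) (fun j _ => ?_) j
          rw [Fin.cons_succ, Fin.cons_zero]
          exact (h3 j).2
        · refine Fin.cases (fun h => absurd h (Fin.not_lt_zero _)) (fun j h => ?_) j
          rw [Fin.cons_succ, Fin.cons_succ]
          exact h2 (Fin.succ_lt_succ_iff.1 h)
    · intro m _
      simp
    · intro x _
      simp
    · intro m _
      rw [Fin.prod_univ_succ]
      rfl

theorem antiSum_cons_succ (f : ℕ → ℕ → R) (b : ℕ) (bs : List ℕ) (M : ℕ) :
    antiSum f (b :: bs) (M + 1) = antiSum f (b :: bs) M + f (M + 1) b * antiSum f bs M := by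
  rw [antiSum, Finset.sum_Icc_succ_top (by omega), Nat.add_sub_cancel]
  rfl

/-- Expanding the product, the indices m at which a positive exponent is chosen form a decreasing
sequence, and their exponents form a composition of r. The induction separates the terms by whether
M + 1 is used. -/
theorem sum_composition_antiSum (F : ℕ → PowerSeries R) (hF : ∀ m, PowerSeries.coeff 0 (F m) = 1)
    (M r : ℕ) :
    ∑ c : Composition r, antiSum (fun m b => PowerSeries.coeff b (F m)) c.blocks M =
      PowerSeries.coeff r (∏ m ∈ Finset.Icc 1 M, F m) := by
  induction M generalizing r with
  | zero =>
    rcases r with _ | n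
    · rw [sum_composition_zero fun w => antiSum _ w 0]
      simp [antiSum]
    · rw [sum_composition_succ n fun w => antiSum _ w 0]
      simp [antiSum, PowerSeries.coeff_one]
  | succ M ih =>
    rw [Finset.prod_Icc_succ_top (by omega), mul_comm, PowerSeries.coeff_mul,
      Finset.Nat.sum_antidiagonal_eq_sum_range_succ_mk]
    rcases r with _ | n
    · rw [sum_composition_zero fun w => antiSum _ w (M + 1), Finset.sum_range_one, hF, ← ih,
        sum_composition_zero fun w => antiSum _ w M]
      simp [antiSum]
    · rw [sum_composition_succ n fun w => antiSum _ w (M + 1), Finset.sum_range_succ', hF, one_mul,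
        Nat.sub_zero, ← ih, sum_composition_succ n fun w => antiSum _ w M, Finset.sum_range,
        ← Finset.sum_add_distrib]
      refine Finset.sum_congr rfl fun b _ => ?_
      simp only [antiSum_cons_succ, Finset.sum_add_distrib, ← Finset.mul_sum, ih,
        Nat.add_sub_add_right]
      rw [add_comm]

end Compositions

/-! ### The diagonal series of `𝔤^*` -/

section GStar

theorem coeff_coeff_formalSum {ι σ : Type*} (f : ι → MvPowerSeries σ (PowerSeries ℚ)) (e : σ →₀ ℕ)
    (n : ℕ) : PowerSeries.coeff n (MvPowerSeries.coeff e (formalSum f)) =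
      ∑ᶠ i, PowerSeries.coeff n (MvPowerSeries.coeff e (f i)) := by
  have h : MvPowerSeries.coeff e (formalSum f) =
    PowerSeries.mk fun n => ∑ᶠ i, PowerSeries.coeff n (MvPowerSeries.coeff e (f i)) := rfl
  rw [h, PowerSeries.coeff_mk]

/-- For a fixed power q^N the infinite sum over m_1 > m_2 > ⋯ may be cut off at any M ≥ N, after
which it is the expansion of a finite product. -/
theorem coeff_coeff_diag_bimouldGStar (β : Mould ℚ) (k : ℕ+) (d : ℕ)
    (h : ∀ m ≠ 0, ∀ b ≠ 0, (PowerSeries.X : PowerSeries ℚ) ^ m ∣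
      PowerSeries.coeff b ((bimouldL β m).diag k d)) (r : ℕ) {N M : ℕ} (hNM : N ≤ M) :
    PowerSeries.coeff N (PowerSeries.coeff r ((bimouldGStar β).diag k d)) =
      PowerSeries.coeff N (PowerSeries.coeff r
        (∏ m ∈ Finset.Icc 1 M, (bimouldL β m).diag k d)) := by
  classical
  have h0 (m : ℕ) : PowerSeries.coeff 0 ((bimouldL β m).diag k d) = 1 := by
    rw [Bimould.coeff_diag, bimouldL, if_pos rfl, MvPowerSeries.coeff_one,
      if_pos (Subsingleton.elim _ _), pow_zero, mul_one]
  rw [← sum_composition_antiSum _ h0, Bimould.coeff_diag, bimouldGStar, map_sum, Finset.mul_sum,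
    map_sum, map_sum]
  refine Finset.sum_congr rfl fun c _ => ?_
  have hc : c.blocks = List.ofFn c.blocksFun := c.ofFn_blocksFun.symm
  have hterm (m : Fin c.length → ℕ) : (d ! : PowerSeries ℚ) ^ r *
      MvPowerSeries.coeff (biExp fun _ : Fin r => (k, d))
        (∏ i : Fin c.length, (bimouldL β (m i)).eval
          (List.ofFn fun a : Fin (c.blocksFun i) =>
            ((MvPowerSeries.X (Sum.inl (c.embedding i a)),
              MvPowerSeries.X (Sum.inr (c.embedding i a))) :
              MvPowerSeries (Fin r ⊕ Fin r) (PowerSeries ℚ) ×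
                MvPowerSeries (Fin r ⊕ Fin r) (PowerSeries ℚ)))) =
      ∏ i, PowerSeries.coeff (c.blocksFun i) ((bimouldL β (m i)).diag k d) := by
    have h1 := coeff_prod_eval c.blocksFinEquiv (fun i => bimouldL β (m i)) fun _ => (k, d)
    simp only [Bimould.coeff_diag]
    rw [Finset.prod_mul_distrib, Finset.prod_pow_eq_pow_sum, c.sum_blocksFun, ← h1]
    rfl
  rw [hc, ← sum_strictAnti_eq_antiSum, map_sum]
  have hC : (d ! : PowerSeries ℚ) ^ r = PowerSeries.C ((d ! : ℚ) ^ r) := by simp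
  have hfs : (d ! : PowerSeries ℚ) ^ r * MvPowerSeries.coeff (biExp fun _ : Fin r => (k, d))
      (formalSum fun m : {m : Fin c.length → ℕ // StrictAnti m ∧ ∀ i, 0 < m i} =>
      ∏ i : Fin c.length, (bimouldL β (m.1 i)).eval
        (List.ofFn fun a : Fin (c.blocksFun i) =>
          ((MvPowerSeries.X (Sum.inl (c.embedding i a)),
            MvPowerSeries.X (Sum.inr (c.embedding i a))) :
            MvPowerSeries (Fin r ⊕ Fin r) (PowerSeries ℚ) ×
              MvPowerSeries (Fin r ⊕ Fin r) (PowerSeries ℚ)))) =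
      PowerSeries.mk fun n => ∑ᶠ m : {m : Fin c.length → ℕ // StrictAnti m ∧ ∀ i, 0 < m i},
        PowerSeries.coeff n
          (∏ i, PowerSeries.coeff (c.blocksFun i) ((bimouldL β (m.1 i)).diag k d)) := by
    ext n
    rw [hC, PowerSeries.coeff_C_mul, PowerSeries.coeff_mk]
    simp only [← hterm, hC, PowerSeries.coeff_C_mul]
    simp only [← smul_eq_mul (a := (d ! : ℚ) ^ r), ← smul_finsum]
    rw [coeff_coeff_formalSum]
  rw [hfs, PowerSeries.coeff_mk, finsum_eq_sum_of_support_subset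
    (s := (Fintype.piFinset fun _ : Fin c.length => Finset.Icc 1 M).subtype _)]
  · rw [Finset.sum_subtype_eq_sum_filter fun m : Fin c.length → ℕ => PowerSeries.coeff N
      (∏ i, PowerSeries.coeff (c.blocksFun i) ((bimouldL β (m i)).diag k d))]
    refine Finset.sum_congr (Finset.filter_congr fun m hm => ?_) fun _ _ => rfl
    rw [Fintype.mem_piFinset] at hm
    exact and_iff_left fun i => (Finset.mem_Icc.1 (hm i)).1
  -- Blocks of a composition are nonempty, so a factor with m_i > M is divisible by q^(m_i) and does
  -- not reach q^N.
  · rintro ⟨m, hm, hm0⟩ hne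
    rw [Finset.mem_coe, Finset.mem_subtype, Fintype.mem_piFinset]
    intro i
    refine Finset.mem_Icc.2 ⟨hm0 i, ?_⟩
    by_contra hi
    dsimp only at hi
    apply hne
    have h1 := (h (m i) (hm0 i).ne' (c.blocksFun i)
      (Nat.pos_iff_ne_zero.1 (c.one_le_blocksFun i))).trans
        (Finset.dvd_prod_of_mem (fun i => PowerSeries.coeff (c.blocksFun i)
          ((bimouldL β (m i)).diag k d)) (Finset.mem_univ i))
    exact PowerSeries.X_pow_dvd_iff.1 h1 N (by omega)

end GStar

/-! ### The logarithmic derivative of the diagonal series of 𝔊 -/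

section Assembly

variable {β : Mould ℚ}

theorem X_pow_dvd_expand_powerSumSeries {m : ℕ} (hm : m ≠ 0) (p : ℕ) :
    (PowerSeries.X : PowerSeries ℚ) ^ m ∣ PowerSeries.expand m hm (powerSumSeries ℚ p) := by
  obtain ⟨G, hG⟩ := PowerSeries.X_dvd_iff.2
    (show PowerSeries.constantCoeff (powerSumSeries ℚ p) = 0 by
      rw [← PowerSeries.coeff_zero_eq_constantCoeff_apply, powerSumSeries, PowerSeries.coeff_mk,
        if_pos rfl])
  rw [hG, map_mul, PowerSeries.expand_X]
  exact dvd_mul_right _ _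

theorem X_pow_dvd_coeff_diag_bimouldL (hβ : β.SatisfiesEDS)
    (hβ_one : ∀ k : ℕ+, β.coeff [k] =
      if k = 1 then 0 else -(bernoulli (k : ℕ) / (2 * (Nat.factorial (k : ℕ) : ℚ))))
    (k : ℕ+) (d : ℕ) {m : ℕ} (hm : m ≠ 0) {b : ℕ} (hb : b ≠ 0) :
    (PowerSeries.X : PowerSeries ℚ) ^ m ∣ PowerSeries.coeff b ((bimouldL β m).diag k d) := by
  have h := (hasLogDeriv_diag_bimouldL hβ hβ_one k d hm).sub_mem
    (Ideal.span {(PowerSeries.X : PowerSeries ℚ) ^ m}) HasLogDeriv.one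
    (constantCoeff_altSeries _) (map_zero _) (fun n => by
      rw [map_zero, sub_zero, altSeries, PowerSeries.coeff_mk, Ideal.mem_span_singleton]
      split_ifs
      · exact dvd_zero _
      · exact ((X_pow_dvd_expand_powerSumSeries hm _).mul_left _).mul_left _) b
  rwa [PowerSeries.coeff_one, if_neg hb, sub_zero, Ideal.mem_span_singleton] at h

theorem coeff_sum_expand_powerSumSeries (k d : ℕ) {N M : ℕ} (hNM : N ≤ M) :
    PowerSeries.coeff N (∑ m : Finset.Icc 1 M, PowerSeries.C (((m : ℕ) : ℚ) ^ d) *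
      PowerSeries.expand (m : ℕ) (Nat.one_le_iff_ne_zero.1 (Finset.mem_Icc.1 m.2).1)
        (powerSumSeries ℚ (k - 1))) =
      PowerSeries.coeff N (lambertSeries k d) := by
  have h (m : Finset.Icc 1 M) : PowerSeries.coeff N (PowerSeries.C (((m : ℕ) : ℚ) ^ d) *
      PowerSeries.expand (m : ℕ) (Nat.one_le_iff_ne_zero.1 (Finset.mem_Icc.1 m.2).1)
        (powerSumSeries ℚ (k - 1))) = if (m : ℕ) ∈ N.divisors then
          ((m : ℕ) : ℚ) ^ d * ((N / m : ℕ) : ℚ) ^ (k - 1) / ((k - 1)! : ℚ) else 0 := by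
    rw [PowerSeries.coeff_C_mul, PowerSeries.coeff_expand, powerSumSeries, PowerSeries.coeff_mk]
    have hm := (Finset.mem_Icc.1 m.2).1
    by_cases hd : (m : ℕ) ∣ N
    · obtain ⟨t, rfl⟩ := hd
      rw [if_pos (dvd_mul_right _ _), Nat.mul_div_cancel_left _ hm]
      by_cases ht : t = 0
      · simp [ht]
      · rw [if_neg ht, if_pos (Nat.mem_divisors.2
          ⟨dvd_mul_right _ _, mul_ne_zero (by omega) ht⟩)]
        ring
    · rw [if_neg hd, if_neg (fun h => hd (Nat.dvd_of_mem_divisors h)), mul_zero]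
  rw [map_sum, Finset.sum_congr rfl fun m _ => h m, Finset.sum_coe_sort (Finset.Icc 1 M)
    fun m => if m ∈ N.divisors then (m : ℚ) ^ d * ((N / m : ℕ) : ℚ) ^ (k - 1) / ((k - 1)! : ℚ)
      else 0, ← Finset.sum_filter, lambertSeries, PowerSeries.coeff_mk,
    Nat.sum_divisorsAntidiagonal fun a b => (a : ℚ) ^ d * (b : ℚ) ^ (k - 1) / ((k - 1)! : ℚ)]
  refine Finset.sum_congr ?_ fun _ _ => rfl
  ext m
  rw [Finset.mem_filter, and_iff_right_iff_imp, Finset.mem_Icc]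
  intro hm
  exact ⟨Nat.pos_of_mem_divisors hm, (Nat.divisor_le hm).trans hNM⟩

/-- The diagonal series is the infinite product over m of those of 𝔏_m, and the logarithmic
derivatives sum to the Lambert series. Convergence is replaced by comparing, modulo q^(N+1), the
product over m ≤ N with the series that has the desired logarithmic derivative. -/
theorem hasLogDeriv_diag_bimouldGStar (hβ : β.SatisfiesEDS)
    (hβ_one : ∀ k : ℕ+, β.coeff [k] =
      if k = 1 then 0 else -(bernoulli (k : ℕ) / (2 * (Nat.factorial (k : ℕ) : ℚ))))
    (k : ℕ+) (d : ℕ) :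
    HasLogDeriv ((bimouldGStar β).diag k d) (altSeries fun n => lambertSeries (n * k) (n * d)) := by
  obtain ⟨F, hF⟩ := exists_hasLogDeriv (altSeries fun n => lambertSeries (n * k) (n * d))
    (constantCoeff_altSeries _)
  convert! hF
  ext r N
  rw [coeff_coeff_diag_bimouldGStar β k d (fun m hm b hb =>
    X_pow_dvd_coeff_diag_bimouldL hβ hβ_one k d hm hb) r le_rfl]
  have hP := HasLogDeriv.prod (Finset.univ : Finset (Finset.Icc 1 N)) fun m _ =>
    hasLogDeriv_diag_bimouldL hβ hβ_one k d
      (Nat.one_le_iff_ne_zero.1 (Finset.mem_Icc.1 m.2).1)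
  rw [altSeries_sum, Finset.prod_coe_sort (Finset.Icc 1 N)
    fun m => (bimouldL β m).diag k d] at hP
  have h := hP.sub_mem (Ideal.span {(PowerSeries.X : PowerSeries ℚ) ^ (N + 1)}) hF
    (constantCoeff_altSeries _) (constantCoeff_altSeries _) (fun n => by
      rw [altSeries, altSeries, PowerSeries.coeff_mk, PowerSeries.coeff_mk]
      by_cases hn : n = 0
      · simp [hn]
      rw [if_neg hn, if_neg hn, ← mul_sub]
      refine Ideal.mul_mem_left _ _ ?_
      rw [Ideal.mem_span_singleton, PowerSeries.X_pow_dvd_iff]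
      intro j hj
      rw [map_sub, sub_eq_zero, ← coeff_sum_expand_powerSumSeries (n * k) (n * d)
        (Nat.lt_succ_iff.1 hj), Finset.sum_apply]
      congr 2
      funext m
      rw [← map_pow, ← pow_mul, mul_comm d]) r
  rw [Ideal.mem_span_singleton, PowerSeries.X_pow_dvd_iff] at h
  have := h N (by omega)
  rwa [map_sub, sub_eq_zero] at this

theorem letterSum_singleton {S : Type*} [CommRing S] (k : ℕ+) (ρ : ℕ+ → S) (hρ : ρ k = 1) (n : ℕ)
    (g : ℕ+ → S) : letterSum {k} ρ n g = g ((n + 1) * k : ℕ).toPNat' := by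
  induction n generalizing g with
  | zero => simp [letterSum, hρ]
  | succ n ih =>
    rw [letterSum, Finset.sum_singleton, hρ, one_mul, ih]
    congr 1
    apply PNat.eq
    have := k.pos
    rw [PNat.add_coe, Nat.toPNat'_coe, Nat.toPNat'_coe, if_pos (by positivity),
      if_pos (by positivity)]
    ring

theorem letterSum_empty {S : Type*} [CommRing S] (ρ : ℕ+ → S) (n : ℕ) (g : ℕ+ → S) :
    letterSum ∅ ρ n g = 0 := by
  cases n <;> simp [letterSum]

/-- The alphabet is the single letter (k, d). For d = 0 the stuffle part yields β(nk); for d > 0 the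
letter is visible only to the Y-part, and only if k = 1, and by symmetrality it yields d! β(d+1) for
n = 1 alone. These are the constant terms of the Lambert series of index (nk, nd). -/
theorem hasLogDeriv_diag_bimouldB (hβ : β.SatisfiesEDS)
    (hβ_one : ∀ k : ℕ+, β.coeff [k] =
      if k = 1 then 0 else -(bernoulli (k : ℕ) / (2 * (Nat.factorial (k : ℕ) : ℚ))))
    (k : ℕ+) (d : ℕ) (hkd : Even ((k : ℕ) + d)) :
    HasLogDeriv (((bimouldB β).baseChange (PowerSeries ℚ)).diag k d)
      (altSeries fun n => PowerSeries.C (lambertConst (n * k) (n * d))) := by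
  have h := hasLogDeriv_bimouldB {(k, d)} (fun _ => (d ! : PowerSeries ℚ)) hβ
  convert! h using 1
  ext1 n
  rw [altSeries, altSeries, PowerSeries.coeff_mk, PowerSeries.coeff_mk]
  by_cases hn : n = 0
  · rw [if_pos hn, if_pos hn]
  rw [if_neg hn, if_neg hn]
  congr 1
  obtain ⟨n, rfl⟩ := Nat.exists_eq_succ_of_ne_zero hn
  have hk := k.pos
  have hC : algebraMap ℚ (PowerSeries ℚ) = PowerSeries.C := rfl
  rw [Finset.sum_singleton, lambertConst, hC, Nat.succ_eq_add_one, Nat.add_sub_cancel]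
  by_cases hd : d = 0
  · have hX : lettersX {(k, d)} = {k} := by
      rw [lettersX, Finset.filter_singleton, if_pos hd, Finset.image_singleton]
    -- The parity of k + d excludes (1, 0), the one letter that both the X-part and the Y-part see.
    have hk1 : k ≠ 1 := by
      rintro rfl
      rw [hd] at hkd
      exact absurd hkd (by decide)
    have hk1' : (k : ℕ) ≠ 1 := fun h => hk1 (PNat.eq h)
    have hto : ((((n + 1) * (k : ℕ)).toPNat' : ℕ+) : ℕ) = (n + 1) * k := by
      rw [Nat.toPNat'_coe, if_pos (by positivity)]
    have hne : ((n + 1) * (k : ℕ)).toPNat' ≠ 1 := fun h => by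
      rw [h, PNat.one_coe] at hto
      nlinarith [show 2 ≤ (k : ℕ) by omega]
    rw [hX, letterSum_singleton k _ (by rw [hd]; simp), if_pos (by rw [hd, mul_zero]), if_neg hk1,
      ite_self, zero_add, hβ_one, if_neg hne, hto]
  · have hX : lettersX {(k, d)} = ∅ := by
      rw [lettersX, Finset.filter_singleton, if_neg hd, Finset.image_empty]
    rw [hX, letterSum_empty, add_zero, if_neg (mul_ne_zero n.succ_ne_zero hd)]
    by_cases hnk : (n + 1) * (k : ℕ) = 1
    · have hk1 : k = 1 := PNat.eq (by rw [PNat.one_coe]; nlinarith)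
      have hn0 : n = 0 := by
        rw [hk1, PNat.one_coe] at hnk
        omega
      have hne : d.succPNat ≠ 1 := fun h => hd (by
        have := congrArg PNat.val h
        simpa using this)
      rw [if_pos hnk, hn0, if_pos (zero_add 1), if_pos hk1, hβ_one, if_neg hne, zero_add, one_mul,
        map_mul, map_natCast, Nat.succPNat_coe]
    · rw [if_neg hnk, map_zero]
      split_ifs with h1 h2
      · have h3 : k = 1 := h2
        exact absurd (by rw [h1, h3]; rfl) hnk
      · rfl
      · rfl

theorem Bimould.diag_mul {A : Type*} [CommRing A] (B C : Bimould A) (k : ℕ+) (d : ℕ) :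
    (B.mul C).diag k d = B.diag k d * C.diag k d := by
  rw [Bimould.diag, Bimould.bicoeff_mul, wordSeries_deconc]
  rfl

/-- If the coefficients of the logarithmic derivative of `F` are quasi-modular forms, then so are
the coefficients of `F`. -/
theorem HasLogDeriv.coeff_mem_quasiModularForms {F : PowerSeries (PowerSeries ℚ)}
    {c : ℕ → PowerSeries ℚ} (h : HasLogDeriv F (altSeries c)) {w : ℕ}
    (hc : ∀ n, n ≠ 0 → c n ∈ quasiModularForms (n * w)) (r : ℕ) :
    PowerSeries.coeff r F ∈ quasiModularForms (r * w) := by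
  induction r using Nat.strong_induction_on with
  | _ r ih =>
  rcases eq_or_ne r 0 with rfl | hr
  · rw [PowerSeries.coeff_zero_eq_constantCoeff_apply, h.1, zero_mul]
    exact one_mem_quasiModularForms
  have h1 : (r : ℚ) • PowerSeries.coeff r F ∈ quasiModularForms (r * w) := by
    rw [Nat.cast_smul_eq_nsmul, nsmul_eq_mul, h.coeff_eq]
    refine Submodule.sum_mem _ fun p hp => ?_
    have hp' := Finset.HasAntidiagonal.mem_antidiagonal.1 hp
    rw [altSeries, PowerSeries.coeff_mk]
    split_ifs with h2
    · rw [mul_zero]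
      exact Submodule.zero_mem _
    · rw [← hp', add_mul, mul_left_comm]
      have h3 := mul_mem_quasiModularForms (ih p.1 (by omega)) (hc p.2 h2)
      rcases neg_one_pow_eq_or (PowerSeries ℚ) (p.2 - 1) with h4 | h4
      · rwa [h4, one_mul]
      · rw [h4, neg_one_mul]
        exact Submodule.neg_mem _ h3
  have h2 := Submodule.smul_mem _ ((r : ℚ)⁻¹) h1
  rwa [smul_smul, inv_mul_cancel₀ (by exact_mod_cast hr), one_smul] at h2

end Assembly

end
end CombEis

theorem proposition5p7 (β : CombEis.Mould ℚ) (hβ : β.SatisfiesEDS)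
    (hβ_one : ∀ k : ℕ+, β.coeff [k] =
      if k = 1 then 0 else -(bernoulli (k : ℕ) / (2 * (Nat.factorial (k : ℕ) : ℚ))))
    (k : ℕ+) (d : ℕ) (hkd : Even ((k : ℕ) + d)) (r : ℕ) (hr : 1 ≤ r) :
    CombEis.combEisenstein β (List.replicate r (k, d)) ∈
      CombEis.quasiModularForms (r * ((k : ℕ) + d)) := by
  -- The two logarithmic derivatives add up to the Lambert series completed by their constant terms;
  -- at index n these have weight n(k+d), again an even number.
  have h := (CombEis.hasLogDeriv_diag_bimouldGStar hβ hβ_one k d).mul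
    (CombEis.hasLogDeriv_diag_bimouldB hβ hβ_one k d hkd)
  rw [← CombEis.Bimould.diag_mul, CombEis.altSeries_add] at h
  rw [CombEis.combEisenstein, CombEis.Bimould.coeff_replicate]
  refine h.coeff_mem_quasiModularForms (fun n hn => ?_) r
  rw [mul_add]
  refine CombEis.lambertSeries_add_const_mem ?_ ?_
  · exact Nat.one_le_iff_ne_zero.2 (mul_ne_zero hn k.ne_zero)
  · rw [← mul_add]
    exact hkd.mul_left n
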